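/- Let $b\in[0,1)$ and consider the neutral KPP--Fisher equation $$\partial_t\big(u(t,x)-b\,u(t-\tau,x)\big)=\partial_{xx}\big(u(t,x)-b\,u(t-\tau,x)\big)+u(t,x)\big(1-u(t-\tau,x)\big),\qquad t,x\in\mathbb R .$$ For $\tau,c\ge 0$ and real $z$ with $1-be^{-zc\tau}>0$ put $$\chi_0(z)=z^2-cz+\frac{1}{1-be^{-zc\tau}},\qquad \chi_1(z)=z^2-cz-\frac{e^{-zc\tau}}{1-be^{-zc\tau}},$$ and let $\mathfrak D$ be the set of all pairs $(\tau,c)$ with $\tau\ge 0$, $c\ge 0$ such that $\chi_0$ has a positive zero and $\chi_1$ has a negative zero. A monotone travelling front with speed $c$ is a solution of the form $u(t,x)=\phi(x+ct)$, where $\phi:\mathbb R\to\mathbb R$ is monotone, $\phi(-\infty)=0$, $\phi(+\infty)=1$, and $v(r):=\phi(r)-b\,\phi(r-c\tau)$ is $C^2$-smooth on $\mathbb R$; equivalently, $v''(r)-cv'(r)+\phi(r)(1-\phi(r-c\tau))=0$ for all $r\in\mathbb R$. Then for every $(\tau,c)\in\mathfrak D$ the equation has a monotone travelling front with speed $c$,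 and this front is unique up to translation: if $u$ and $w$ are two such fronts (with the same $\tau$ and $c$), then there is $s\in\mathbb R$ with $w(t,x)=u(t,x+s)$ for all $t,x\in\mathbb R$. This includes the critical case, in which the positive zero of $\chi_0$ is a double zero. -/

import Mathlib

open Filter Topology

noncomputable section

/-- The neutral combination `u(t,x) - b u(t-τ,x)`; the first argument of `u` is time,
the second one is space. -/
def neutralPart (b τ : ℝ) (u : ℝ → ℝ → ℝ) (t x : ℝ) : ℝ :=
  u t x - b * u (t - τ) x

/-- `u` is a classical solution on `ℝ × ℝ` of the neutral KPP-Fisher equation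
`∂ₜ (u(t,x) - b u(t-τ,x)) = ∂ₓₓ (u(t,x) - b u(t-τ,x)) + u(t,x) (1 - u(t-τ,x))`.
The derivatives fall on the neutral combination only, so only this one has to be smooth. -/
structure IsNeutralKPPFisherSolution (b τ : ℝ) (u : ℝ → ℝ → ℝ) : Prop where
  differentiable_time : ∀ x : ℝ, Differentiable ℝ (fun s : ℝ => neutralPart b τ u s x)
  contDiff_space : ∀ t : ℝ, ContDiff ℝ 2 (fun y : ℝ => neutralPart b τ u t y)
  equation : ∀ t x : ℝ,
    deriv (fun s : ℝ => neutralPart b τ u s x) t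
      = deriv (deriv (fun y : ℝ => neutralPart b τ u t y)) x + u t x * (1 - u (t - τ) x)

/-- `u` is a monotone traveling front with speed `c` of the neutral KPP-Fisher equation: it is a
solution of the form `u(t,x) = φ(x + ct)`, where the profile `φ` is monotone, connects `0` at `-∞`
with `1` at `+∞`, and is such that `v(r) = φ(r) - b φ(r - cτ)` is of class `C²`. -/
def IsMonotoneTravelingFront (b τ c : ℝ) (u : ℝ → ℝ → ℝ) : Prop :=
  IsNeutralKPPFisherSolution b τ u ∧
    ∃ φ : ℝ → ℝ,
      (∀ t x : ℝ, u t x = φ (x + c * t)) ∧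
      Monotone φ ∧
      ContDiff ℝ 2 (fun r : ℝ => φ r - b * φ (r - c * τ)) ∧
      Tendsto φ atBot (𝓝 0) ∧
      Tendsto φ atTop (𝓝 1)

/-- The characteristic function `χ₀(z) = z² - cz + 1 / (1 - b e^{-zcτ})` on the real line. -/
def chiZero (b τ c z : ℝ) : ℝ :=
  z ^ 2 - c * z + 1 / (1 - b * Real.exp (-(z * c * τ)))

/-- The characteristic function `χ₁(z) = z² - cz - e^{-zcτ} / (1 - b e^{-zcτ})` on the real
line. -/
def chiOne (b τ c z : ℝ) : ℝ :=
  z ^ 2 - c * z - Real.exp (-(z * c * τ)) / (1 - b * Real.exp (-(z * c * τ)))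

/-- The set of pairs `(τ, c)` of nonnegative numbers such that `χ₀` has a positive zero and `χ₁`
has a negative zero. The characteristic functions are considered where `1 - b e^{-zcτ} > 0`,
i.e. for `z > ln b / (cτ)` when `b, c, τ > 0`. -/
def frontDomain (b : ℝ) : Set (ℝ × ℝ) :=
  {p | 0 ≤ p.1 ∧ 0 ≤ p.2 ∧
    (∃ z : ℝ, 0 < z ∧ 0 < 1 - b * Real.exp (-(z * p.2 * p.1)) ∧ chiZero b p.1 p.2 z = 0) ∧
    (∃ z : ℝ, z < 0 ∧ 0 < 1 - b * Real.exp (-(z * p.2 * p.1)) ∧ chiOne b p.1 p.2 z = 0)}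

/-- In terms of the profile, being a solution is the neutral functional differential equation
`v''(r) - c v'(r) + φ(r) (1 - φ(r - cτ)) = 0`, where `v(r) = φ(r) - b φ(r - cτ)` is `C²`. -/
theorem isNeutralKPPFisherSolution_iff_profile (b τ c : ℝ) (φ : ℝ → ℝ)
    (hv : ContDiff ℝ 2 (fun r : ℝ => φ r - b * φ (r - c * τ))) :
    IsNeutralKPPFisherSolution b τ (fun t x => φ (x + c * t)) ↔
      ∀ r : ℝ, deriv (deriv (fun r : ℝ => φ r - b * φ (r - c * τ))) r
        - c * deriv (fun r : ℝ => φ r - b * φ (r - c * τ)) r + φ r * (1 - φ (r - c * τ)) = 0 := by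
  set v : ℝ → ℝ := fun r => φ r - b * φ (r - c * τ) with hvdef
  have hN : ∀ t x, neutralPart b τ (fun t x => φ (x + c * t)) t x = v (x + c * t) := by
    intro t x
    simp only [neutralPart, hvdef]
    congr 3
    ring
  have hd : Differentiable ℝ v := hv.differentiable (by norm_num)
  have ht : ∀ t x, HasDerivAt (fun s => v (x + c * s)) (c * deriv v (x + c * t)) t := by
    intro t x
    have h1 : HasDerivAt (fun s : ℝ => x + c * s) c t := by
      simpa using ((hasDerivAt_id t).const_mul c).const_add x
    have h2 := (hd (x + c * t)).hasDerivAt.comp t h1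
    simpa [mul_comm, Function.comp_def] using h2
  have hx : ∀ t x, deriv (deriv (fun y => v (y + c * t))) x = deriv (deriv v) (x + c * t) := by
    intro t x
    have h1 : deriv (fun y => v (y + c * t)) = fun y => deriv v (y + c * t) := by
      funext y
      exact deriv_comp_add_const v (c * t) y
    rw [h1]
    exact deriv_comp_add_const (deriv v) (c * t) x
  constructor
  · rintro ⟨-, -, h⟩ r
    have := h 0 r
    simp only [hN, hx, (ht _ _).deriv] at this
    have e : r + c * (0 - τ) = r - c * τ := by ring
    simp only [mul_zero, add_zero, e] at this
    linarith
  · intro h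
    refine ⟨fun x t => ?_, fun t => ?_, fun t x => ?_⟩
    · simp only [hN]
      exact (ht t x).differentiableAt
    · simp only [hN]
      exact hv.comp (contDiff_id.add contDiff_const)
    · simp only [hN, hx, (ht _ _).deriv]
      have := h (x + c * t)
      have e : x + c * (t - τ) = x + c * t - c * τ := by ring
      rw [e]
      linarith

end

/-!
Write `h = c τ` and `v = φ - b φ(· - h)`.

Existence. A negative zero `-θ` of `χ₁` makes the factorization `(∂ + θ) (∂ - (c + θ))` useful:
adding `θ (c + θ) v` on both sides turns the profile equation into a fixed point equation
`φ = step φ`, and although `φ (1 - φ(· - h))` is not monotone in the pointwise order, `step` is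
monotone in the order of the cone of the nonnegative functions `x` with `e^{θ t} x` nondecreasing.
If `χ₀(r) = 0 > χ₀(m)` for some `0 < r < m ≤ 2 r`, the iterates of an upper solution that behaves
like `e^{r t}` at `-∞` decrease to a front, which a lower solution behaving like
`e^{r t} - E e^{m t}` keeps away from zero. At a double zero of `χ₀` there is no such `m`; there
the fronts for reaction rates `κ < 1` are noncritical, and normalized by `φ(0) = 1 / 2` they
converge along a subsequence as `κ → 1`.

Uniqueness. Testing the profile equation with `e^{-r t}`, where `r` is the smallest positive zero
of `χ₀`, gives a flux with derivative `e^{-r t} φ φ(· - h)`. It has a negative limit at `-∞`, which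
a translation multiplies by an arbitrary positive factor, so two fronts may be assumed to have the
same limit. Then `e^{-r t} (v₁ - v₂)` is bounded. By a maximum principle its supremum, if positive,
is not attained, and it can only be approached at `-∞`, since the weight tends to zero at `+∞`. The
difference of the fluxes decays there, and integrating it, separately for a simple and for a double
zero, rules that out as well.
-/

noncomputable section
namespace NeutralKPP
open Set Real MeasureTheory

/-! ### Derivatives and exponential weights -/

lemma monotoneOn_of_hasDerivAt_nonneg {s : Set ℝ} (hs : Convex ℝ s) {f f' : ℝ → ℝ}
    (hf : ∀ t ∈ s, HasDerivAt f (f' t) t) (hf' : ∀ t ∈ s, 0 ≤ f' t) : MonotoneOn f s :=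
  monotoneOn_of_hasDerivWithinAt_nonneg hs
    (fun t ht => (hf t ht).continuousAt.continuousWithinAt)
    (fun t ht => (hf t (interior_subset ht)).hasDerivWithinAt)
    (fun t ht => hf' t (interior_subset ht))

lemma antitoneOn_of_hasDerivAt_nonpos {s : Set ℝ} (hs : Convex ℝ s) {f f' : ℝ → ℝ}
    (hf : ∀ t ∈ s, HasDerivAt f (f' t) t) (hf' : ∀ t ∈ s, f' t ≤ 0) : AntitoneOn f s :=
  antitoneOn_of_hasDerivWithinAt_nonpos hs
    (fun t ht => (hf t ht).continuousAt.continuousWithinAt)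
    (fun t ht => (hf t (interior_subset ht)).hasDerivWithinAt)
    (fun t ht => hf' t (interior_subset ht))

lemma exp_mul_sub (r t h : ℝ) : exp (r * (t - h)) = exp (-(r * h)) * exp (r * t) := by
  rw [← exp_add]
  ring_nf

lemma exp_div_sub_shift {b r h : ℝ} (hr : 1 - b * exp (-(r * h)) ≠ 0) (t : ℝ) :
    exp (r * t) / (1 - b * exp (-(r * h))) - b * (exp (r * (t - h)) / (1 - b * exp (-(r * h)))) =
      exp (r * t) := by
  rw [exp_mul_sub]
  field_simp

lemma hasDerivAt_exp_mul (r t : ℝ) : HasDerivAt (fun s => exp (r * s)) (r * exp (r * t)) t := by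
  simpa [mul_comm] using ((hasDerivAt_id t).const_mul r).exp

lemma hasDerivAt_exp_mul_mul {f : ℝ → ℝ} {f' t : ℝ} (r : ℝ) (hf : HasDerivAt f f' t) :
    HasDerivAt (fun s => exp (r * s) * f s) (exp (r * t) * (f' + r * f t)) t :=
  ((hasDerivAt_exp_mul r t).mul hf).congr_deriv (by ring)

lemma tendsto_exp_mul_atBot {r : ℝ} (hr : 0 < r) :
    Tendsto (fun t => exp (r * t)) atBot (𝓝 0) :=
  tendsto_exp_atBot.comp (tendsto_id.const_mul_atBot hr)

lemma tendsto_exp_neg_mul_atTop {r : ℝ} (hr : 0 < r) :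
    Tendsto (fun t => exp (-r * t)) atTop (𝓝 0) :=
  tendsto_exp_atBot.comp (tendsto_id.const_mul_atTop_of_neg (neg_neg_of_pos hr))

lemma nonneg_of_monotoneOn_exp_mul {θ C T : ℝ} (hθ : 0 < θ) {x : ℝ → ℝ}
    (hC : ∀ t ≤ T, -C ≤ x t) (hx : MonotoneOn (fun t => exp (θ * t) * x t) (Iic T)) :
    ∀ t ≤ T, 0 ≤ x t := by
  intro t ht
  have lower : ∀ s ≤ t, exp (θ * s) * -C ≤ exp (θ * t) * x t := fun s hs =>
    (mul_le_mul_of_nonneg_left (hC s (hs.trans ht)) (exp_pos _).le).trans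
      (hx (hs.trans ht) ht hs)
  have lower_tendsto : Tendsto (fun s => exp (θ * s) * -C) atBot (𝓝 0) := by
    simpa using (tendsto_exp_mul_atBot hθ).mul_const (-C)
  exact nonneg_of_mul_nonneg_right
    (le_of_tendsto lower_tendsto ((eventually_le_atBot t).mono lower)) (exp_pos _)

/-! ### The neutral difference operator -/

lemma nonneg_of_mul_comp_le {α : Type*} {b C : ℝ} (hb0 : 0 ≤ b) (hb1 : b < 1) {T : α → α}
    {s : Set α} (hT : MapsTo T s s) {D : α → ℝ} (hC : ∀ t ∈ s, -C ≤ D t)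
    (hD : ∀ t ∈ s, b * D (T t) ≤ D t) : ∀ t ∈ s, 0 ≤ D t := by
  have iterated : ∀ n : ℕ, ∀ t ∈ s, -(b ^ n * C) ≤ D t := by
    intro n
    induction n with
    | zero => simpa using hC
    | succ n ih =>
      intro t ht
      calc -(b ^ (n + 1) * C) = b * -(b ^ n * C) := by ring
        _ ≤ b * D (T t) := mul_le_mul_of_nonneg_left (ih _ (hT ht)) hb0
        _ ≤ D t := hD t ht
  intro t ht
  have lower_tendsto : Tendsto (fun n : ℕ => -(b ^ n * C)) atTop (𝓝 0) := by
    simpa using ((tendsto_pow_atTop_nhds_zero_of_lt_one hb0 hb1).mul_const C).neg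
  exact le_of_tendsto' lower_tendsto fun n => iterated n t ht

lemma nonneg_of_shift {b h C : ℝ} (hb0 : 0 ≤ b) (hb1 : b < 1) {D : ℝ → ℝ} (hC : ∀ t, -C ≤ D t)
    (hD : ∀ t, b * D (t - h) ≤ D t) (t : ℝ) : 0 ≤ D t :=
  nonneg_of_mul_comp_le hb0 hb1 (T := (· - h)) (mapsTo_univ _ univ) (fun t _ => hC t)
    (fun t _ => hD t) t (mem_univ t)

lemma eq_of_sub_shift_eq {b h C : ℝ} (hb0 : 0 ≤ b) (hb1 : b < 1) {x y : ℝ → ℝ}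
    (hx : ∀ t, |x t| ≤ C) (hy : ∀ t, |y t| ≤ C)
    (hxy : ∀ t, x t - b * x (t - h) = y t - b * y (t - h)) : x = y := by
  have sub_nonneg_of : ∀ {x y : ℝ → ℝ}, (∀ t, |x t| ≤ C) → (∀ t, |y t| ≤ C) →
      (∀ t, x t - b * x (t - h) = y t - b * y (t - h)) → ∀ t, 0 ≤ x t - y t :=
    fun hx hy hxy => nonneg_of_shift hb0 hb1 (h := h) (C := 2 * C)
      (fun t => by linarith [(abs_le.1 (hx t)).1, (abs_le.1 (hy t)).2])
      (fun t => by linarith [hxy t])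
  funext t
  exact le_antisymm (sub_nonneg.1 (sub_nonneg_of hy hx (fun t => (hxy t).symm) t))
    (sub_nonneg.1 (sub_nonneg_of hx hy hxy t))

/-- The Neumann series of the operator `x ↦ x - b x(· - h)`, which inverts it on bounded
functions when `0 ≤ b < 1`. -/
def neumannSeries (b h : ℝ) (v : ℝ → ℝ) (t : ℝ) : ℝ := ∑' k : ℕ, b ^ k * v (t - k * h)

lemma norm_neumannSeries_term_le {b h C : ℝ} (hb0 : 0 ≤ b) {v : ℝ → ℝ} (hv : ∀ t, |v t| ≤ C)
    (k : ℕ) (t : ℝ) : ‖b ^ k * v (t - k * h)‖ ≤ b ^ k * C := by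
  rw [norm_mul, Real.norm_of_nonneg (pow_nonneg hb0 k)]
  exact mul_le_mul_of_nonneg_left (hv _) (pow_nonneg hb0 k)

lemma summable_pow_mul_const {b : ℝ} (hb0 : 0 ≤ b) (hb1 : b < 1) (C : ℝ) :
    Summable (fun k : ℕ => b ^ k * C) :=
  (summable_geometric_of_lt_one hb0 hb1).mul_right C

lemma summable_neumannSeries {b h C : ℝ} (hb0 : 0 ≤ b) (hb1 : b < 1) {v : ℝ → ℝ}
    (hv : ∀ t, |v t| ≤ C) (t : ℝ) : Summable (fun k : ℕ => b ^ k * v (t - k * h)) :=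
  (summable_pow_mul_const hb0 hb1 C).of_norm_bounded
    (fun k => norm_neumannSeries_term_le hb0 hv k t)

lemma neumannSeries_sub_shift {b h C : ℝ} (hb0 : 0 ≤ b) (hb1 : b < 1) {v : ℝ → ℝ}
    (hv : ∀ t, |v t| ≤ C) (t : ℝ) :
    neumannSeries b h v t - b * neumannSeries b h v (t - h) = v t := by
  have tail : ∑' k : ℕ, b ^ (k + 1) * v (t - ((k + 1 : ℕ) : ℝ) * h)
      = b * neumannSeries b h v (t - h) := by
    rw [neumannSeries, ← tsum_mul_left]
    refine tsum_congr fun k => ?_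
    rw [show t - ((k + 1 : ℕ) : ℝ) * h = t - h - k * h by push_cast; ring]
    ring
  rw [neumannSeries, (summable_neumannSeries (h := h) hb0 hb1 hv t).tsum_eq_zero_add, tail]
  simp

lemma abs_neumannSeries_le {b h C : ℝ} (hb0 : 0 ≤ b) (hb1 : b < 1) {v : ℝ → ℝ}
    (hv : ∀ t, |v t| ≤ C) (t : ℝ) : |neumannSeries b h v t| ≤ C / (1 - b) := by
  rw [div_eq_inv_mul]
  exact tsum_of_norm_bounded ((hasSum_geometric_of_lt_one hb0 hb1).mul_right C)
    (fun k => norm_neumannSeries_term_le hb0 hv k t)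

lemma continuous_neumannSeries {b h C : ℝ} (hb0 : 0 ≤ b) (hb1 : b < 1) {v : ℝ → ℝ}
    (hv : ∀ t, |v t| ≤ C) (hc : Continuous v) : Continuous (neumannSeries b h v) :=
  continuous_tsum (fun k => by fun_prop) (summable_pow_mul_const hb0 hb1 C)
    (fun k t => norm_neumannSeries_term_le hb0 hv k t)

lemma hasDerivAt_neumannSeries {b h C C' : ℝ} (hb0 : 0 ≤ b) (hb1 : b < 1) {v v' : ℝ → ℝ}
    (hv : ∀ t, |v t| ≤ C) (hv' : ∀ t, |v' t| ≤ C') (hd : ∀ t, HasDerivAt v (v' t) t) (t : ℝ) :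
    HasDerivAt (neumannSeries b h v) (neumannSeries b h v' t) t :=
  hasDerivAt_tsum (summable_pow_mul_const hb0 hb1 C')
    (fun k y => ((hd (y - k * h)).comp_sub_const y (k * h)).const_mul (b ^ k))
    (fun k y => norm_neumannSeries_term_le hb0 hv' k y) (summable_neumannSeries hb0 hb1 hv 0) t

lemma eq_neumannSeries {b h C : ℝ} (hb0 : 0 ≤ b) (hb1 : b < 1) {x v : ℝ → ℝ}
    (hx : ∀ t, |x t| ≤ C) (hv : ∀ t, x t - b * x (t - h) = v t) : x = neumannSeries b h v := by
  have hvC : ∀ t, |v t| ≤ C + b * C := fun t => by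
    rw [← hv t]
    refine (abs_sub _ _).trans (add_le_add (hx t) ?_)
    rw [abs_mul, abs_of_nonneg hb0]
    exact mul_le_mul_of_nonneg_left (hx _) hb0
  refine eq_of_sub_shift_eq hb0 hb1 (h := h) (C := max C ((C + b * C) / (1 - b)))
    (fun t => (hx t).trans (le_max_left _ _))
    (fun t => (abs_neumannSeries_le hb0 hb1 hvC t).trans (le_max_right _ _)) (fun t => ?_)
  rw [hv, neumannSeries_sub_shift hb0 hb1 hvC]

lemma hasSum_pow_mul_exp_sub {b h z : ℝ} (hb0 : 0 ≤ b) (hz : b * exp (-(z * h)) < 1) (A t : ℝ) :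
    HasSum (fun k : ℕ => b ^ k * (A * exp (z * (t - k * h))))
      (A / (1 - b * exp (-(z * h))) * exp (z * t)) := by
  have ratio : ∀ k : ℕ, b ^ k * (A * exp (z * (t - k * h)))
      = (b * exp (-(z * h))) ^ k * (A * exp (z * t)) := fun k => by
    rw [mul_pow, ← exp_nat_mul, mul_sub, sub_eq_neg_add, exp_add]
    ring_nf
  simp only [ratio, div_eq_inv_mul, mul_assoc _ A]
  exact (hasSum_geometric_of_lt_one (mul_nonneg hb0 (exp_pos _).le) hz).mul_right _

lemma neumannSeries_le_exp {b h z A C : ℝ} (hb0 : 0 ≤ b) (hb1 : b < 1)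
    (hz : b * exp (-(z * h)) < 1) {v : ℝ → ℝ} (hC : ∀ t, |v t| ≤ C)
    (hv : ∀ t, v t ≤ A * exp (z * t)) (t : ℝ) :
    neumannSeries b h v t ≤ A / (1 - b * exp (-(z * h))) * exp (z * t) :=
  hasSum_le (fun k => mul_le_mul_of_nonneg_left (hv _) (pow_nonneg hb0 k))
    (summable_neumannSeries hb0 hb1 hC t).hasSum (hasSum_pow_mul_exp_sub hb0 hz A t)

lemma exp_sub_exp_le_neumannSeries {b h y z A B C : ℝ} (hb0 : 0 ≤ b) (hb1 : b < 1)
    (hy : b * exp (-(y * h)) < 1) (hz : b * exp (-(z * h)) < 1) {v : ℝ → ℝ}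
    (hC : ∀ t, |v t| ≤ C) (hv : ∀ t, A * exp (y * t) - B * exp (z * t) ≤ v t) (t : ℝ) :
    A / (1 - b * exp (-(y * h))) * exp (y * t) - B / (1 - b * exp (-(z * h))) * exp (z * t)
      ≤ neumannSeries b h v t := by
  refine hasSum_le (fun k => ?_)
    ((hasSum_pow_mul_exp_sub hb0 hy A t).sub (hasSum_pow_mul_exp_sub hb0 hz B t))
    (summable_neumannSeries hb0 hb1 hC t).hasSum
  rw [← mul_sub]
  exact mul_le_mul_of_nonneg_left (hv _) (pow_nonneg hb0 k)

/-! ### First-order resolvents -/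

/-- The bounded solution `w` of `w' = ρ w - g`, for `0 < ρ` and a bounded `g`. -/
def fwdResolvent (ρ : ℝ) (g : ℝ → ℝ) (t : ℝ) : ℝ := ∫ σ in Ioi 0, exp (-ρ * σ) * g (t + σ)

/-- The bounded solution `x` of `x' = -θ x + w`, for `0 < θ` and a bounded `w`. -/
def bwdResolvent (θ : ℝ) (w : ℝ → ℝ) (t : ℝ) : ℝ := ∫ σ in Ioi 0, exp (-θ * σ) * w (t - σ)

lemma bwdResolvent_eq_fwdResolvent_neg (θ : ℝ) (w : ℝ → ℝ) (t : ℝ) :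
    bwdResolvent θ w t = fwdResolvent θ (fun s => w (-s)) (-t) := by
  simp only [bwdResolvent, fwdResolvent, neg_add, neg_neg, sub_eq_add_neg]

lemma integrableOn_exp_mul_comp_add {ρ C : ℝ} (hρ : 0 < ρ) {g : ℝ → ℝ} (hg : Continuous g)
    (hC : ∀ t, |g t| ≤ C) (a t : ℝ) :
    IntegrableOn (fun σ => exp (-ρ * σ) * g (t + σ)) (Ioi a) :=
  (exp_neg_integrableOn_Ioi a hρ).mul_bdd (c := C)
    (by fun_prop : Continuous fun σ => g (t + σ)).aestronglyMeasurable
    (Eventually.of_forall fun _ => hC _)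

lemma fwdResolvent_mono {ρ C C' : ℝ} (hρ : 0 < ρ) {f g : ℝ → ℝ} (hf : Continuous f)
    (hg : Continuous g) (hfC : ∀ t, |f t| ≤ C) (hgC : ∀ t, |g t| ≤ C') {t : ℝ}
    (hfg : ∀ s, t ≤ s → f s ≤ g s) : fwdResolvent ρ f t ≤ fwdResolvent ρ g t :=
  setIntegral_mono_on (integrableOn_exp_mul_comp_add hρ hf hfC 0 t)
    (integrableOn_exp_mul_comp_add hρ hg hgC 0 t) measurableSet_Ioi fun _ hσ =>
      mul_le_mul_of_nonneg_left (hfg _ (le_add_of_nonneg_right (mem_Ioi.1 hσ).le)) (exp_pos _).le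

lemma fwdResolvent_const {ρ : ℝ} (hρ : 0 < ρ) (C t : ℝ) :
    fwdResolvent ρ (fun _ => C) t = C / ρ := by
  rw [fwdResolvent, integral_mul_const, integral_exp_mul_Ioi (neg_neg_of_pos hρ)]
  simp [div_eq_inv_mul]

lemma fwdResolvent_nonneg {ρ : ℝ} {g : ℝ → ℝ} {t : ℝ} (hg : ∀ s, t ≤ s → 0 ≤ g s) :
    0 ≤ fwdResolvent ρ g t :=
  setIntegral_nonneg measurableSet_Ioi fun _ hσ =>
    mul_nonneg (exp_pos _).le (hg _ (le_add_of_nonneg_right (mem_Ioi.1 hσ).le))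

lemma fwdResolvent_le {ρ C C' : ℝ} (hρ : 0 < ρ) {g : ℝ → ℝ} (hg : Continuous g)
    (hgC : ∀ t, |g t| ≤ C) {t : ℝ} (hgC' : ∀ s, t ≤ s → g s ≤ C') :
    fwdResolvent ρ g t ≤ C' / ρ := by
  rw [← fwdResolvent_const hρ C' t]
  exact fwdResolvent_mono hρ hg continuous_const hgC (fun _ => le_refl |C'|) hgC'

lemma abs_fwdResolvent_le {ρ C : ℝ} (hρ : 0 < ρ) {g : ℝ → ℝ} (hg : Continuous g)
    (hgC : ∀ t, |g t| ≤ C) (t : ℝ) : |fwdResolvent ρ g t| ≤ C / ρ := by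
  refine abs_le.2 ⟨?_, fwdResolvent_le hρ hg hgC fun s _ => (abs_le.1 (hgC s)).2⟩
  rw [← neg_div, ← fwdResolvent_const hρ (-C) t]
  exact fwdResolvent_mono hρ continuous_const hg (fun _ => le_refl |-C|) hgC
    (fun s _ => (abs_le.1 (hgC s)).1)

lemma fwdResolvent_sub {ρ C C' : ℝ} (hρ : 0 < ρ) {f g : ℝ → ℝ} (hf : Continuous f)
    (hg : Continuous g) (hfC : ∀ t, |f t| ≤ C) (hgC : ∀ t, |g t| ≤ C') (t : ℝ) :
    fwdResolvent ρ (fun s => f s - g s) t = fwdResolvent ρ f t - fwdResolvent ρ g t := by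
  simp only [fwdResolvent, mul_sub]
  exact integral_sub (integrableOn_exp_mul_comp_add hρ hf hfC 0 t)
    (integrableOn_exp_mul_comp_add hρ hg hgC 0 t)

lemma fwdResolvent_comp_add (ρ : ℝ) (g : ℝ → ℝ) (s t : ℝ) :
    fwdResolvent ρ (fun r => g (r + s)) t = fwdResolvent ρ g (t + s) := by
  simp only [fwdResolvent, add_right_comm]

lemma fwdResolvent_eq_exp_mul_sub_integral {ρ C : ℝ} (hρ : 0 < ρ) {g : ℝ → ℝ} (hg : Continuous g)
    (hgC : ∀ t, |g t| ≤ C) (t : ℝ) :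
    fwdResolvent ρ g t
      = exp (ρ * t) * (fwdResolvent ρ g 0 - ∫ s in (0 : ℝ)..t, exp (-ρ * s) * g s) := by
  have integrable : ∀ a, IntegrableOn (fun s => exp (-ρ * s) * g s) (Ioi a) := fun a => by
    simpa using integrableOn_exp_mul_comp_add hρ hg hgC a 0
  have translated : fwdResolvent ρ g t = exp (ρ * t) * ∫ s in Ioi t, exp (-ρ * s) * g s := by
    rw [← (measurePreserving_add_left volume t).setIntegral_preimage_emb
      (measurableEmbedding_addLeft t) (fun s => exp (-ρ * s) * g s) (Ioi t),
      ← integral_const_mul, fwdResolvent, show (fun x => t + x) ⁻¹' Ioi t = Ioi 0 by simp]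
    congr 1
    funext σ
    rw [← mul_assoc, ← exp_add]
    congr 2
    ring
  have at_zero : fwdResolvent ρ g 0 = ∫ s in Ioi 0, exp (-ρ * s) * g s := by simp [fwdResolvent]
  rw [translated, at_zero,
    ← intervalIntegral.integral_Ioi_sub_Ioi' (integrable 0) (integrable t)]
  ring

lemma hasDerivAt_fwdResolvent {ρ C : ℝ} (hρ : 0 < ρ) {g : ℝ → ℝ} (hg : Continuous g)
    (hgC : ∀ t, |g t| ≤ C) (t : ℝ) :
    HasDerivAt (fwdResolvent ρ g) (ρ * fwdResolvent ρ g t - g t) t := by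
  have hc : Continuous fun s => exp (-ρ * s) * g s := by fun_prop
  have hderiv := hasDerivAt_exp_mul_mul ρ
    ((hc.integral_hasStrictDerivAt 0 t).hasDerivAt.const_sub (fwdResolvent ρ g 0))
  rw [← funext (fwdResolvent_eq_exp_mul_sub_integral hρ hg hgC)] at hderiv
  refine hderiv.congr_deriv ?_
  rw [fwdResolvent_eq_exp_mul_sub_integral hρ hg hgC t]
  have cancel : exp (ρ * t) * exp (-ρ * t) = 1 := by rw [← exp_add]; simp
  linear_combination -g t * cancel

lemma continuous_fwdResolvent {ρ C : ℝ} (hρ : 0 < ρ) {g : ℝ → ℝ} (hg : Continuous g)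
    (hgC : ∀ t, |g t| ≤ C) : Continuous (fwdResolvent ρ g) :=
  continuous_iff_continuousAt.2 fun t => (hasDerivAt_fwdResolvent hρ hg hgC t).continuousAt

lemma tendsto_fwdResolvent {ι : Type*} {l : Filter ι} [l.IsCountablyGenerated] {ρ C : ℝ}
    (hρ : 0 < ρ) {G : ι → ℝ → ℝ} {T : ι → ℝ} {g : ℝ → ℝ} {r : ℝ} (hG : ∀ i, Continuous (G i))
    (hC : ∀ i t, |G i t| ≤ C) (hlim : ∀ σ, Tendsto (fun i => G i (T i + σ)) l (𝓝 (g (r + σ)))) :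
    Tendsto (fun i => fwdResolvent ρ (G i) (T i)) l (𝓝 (fwdResolvent ρ g r)) := by
  refine tendsto_integral_filter_of_dominated_convergence (fun σ => exp (-ρ * σ) * C) ?_ ?_ ?_ ?_
  · exact Eventually.of_forall fun i =>
      (integrableOn_exp_mul_comp_add hρ (hG i) (hC i) 0 (T i)).aestronglyMeasurable
  · refine Eventually.of_forall fun i => Eventually.of_forall fun σ => ?_
    rw [norm_mul, Real.norm_of_nonneg (exp_pos _).le]
    exact mul_le_mul_of_nonneg_left (hC _ _) (exp_pos _).le
  · exact (exp_neg_integrableOn_Ioi 0 hρ).mul_const C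
  · exact Eventually.of_forall fun σ => (hlim σ).const_mul _

lemma exp_neg_mul_mul_exp_mul_add (ρ z A t σ : ℝ) :
    exp (-ρ * σ) * (A * exp (z * (t + σ))) = exp (-(ρ - z) * σ) * (A * exp (z * t)) := by
  rw [neg_sub, sub_mul, sub_eq_add_neg, mul_add, exp_add, exp_add]
  ring_nf

lemma integrableOn_exp_mul_exp_comp_add {ρ z : ℝ} (hz : z < ρ) (A t : ℝ) :
    IntegrableOn (fun σ => exp (-ρ * σ) * (A * exp (z * (t + σ)))) (Ioi 0) := by
  simp only [exp_neg_mul_mul_exp_mul_add]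
  exact (exp_neg_integrableOn_Ioi 0 (sub_pos.2 hz)).mul_const _

lemma fwdResolvent_const_mul_exp {ρ z : ℝ} (hz : z < ρ) (A t : ℝ) :
    fwdResolvent ρ (fun s => A * exp (z * s)) t = A / (ρ - z) * exp (z * t) := by
  simp only [fwdResolvent, exp_neg_mul_mul_exp_mul_add]
  exact (fwdResolvent_const (sub_pos.2 hz) (A * exp (z * t)) 0).trans (by ring)

lemma fwdResolvent_le_exp {ρ z A C : ℝ} (hρ : 0 < ρ) (hz : z < ρ) {g : ℝ → ℝ}
    (hg : Continuous g) (hC : ∀ t, |g t| ≤ C) (hgz : ∀ t, g t ≤ A * exp (z * t)) (t : ℝ) :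
    fwdResolvent ρ g t ≤ A / (ρ - z) * exp (z * t) := by
  rw [← fwdResolvent_const_mul_exp hz]
  exact setIntegral_mono_on (integrableOn_exp_mul_comp_add hρ hg hC 0 t)
    (integrableOn_exp_mul_exp_comp_add hz A t) measurableSet_Ioi
    fun _ _ => mul_le_mul_of_nonneg_left (hgz _) (exp_pos _).le

lemma exp_sub_exp_le_fwdResolvent {ρ y z A B C : ℝ} (hρ : 0 < ρ) (hy : y < ρ) (hz : z < ρ)
    {g : ℝ → ℝ} (hg : Continuous g) (hC : ∀ t, |g t| ≤ C)
    (hgyz : ∀ t, A * exp (y * t) - B * exp (z * t) ≤ g t) (t : ℝ) :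
    A / (ρ - y) * exp (y * t) - B / (ρ - z) * exp (z * t) ≤ fwdResolvent ρ g t := by
  have hyint := integrableOn_exp_mul_exp_comp_add hy A t
  have hzint := integrableOn_exp_mul_exp_comp_add hz B t
  rw [← fwdResolvent_const_mul_exp hy, ← fwdResolvent_const_mul_exp hz, fwdResolvent,
    fwdResolvent, ← integral_sub hyint hzint]
  refine setIntegral_mono_on (hyint.sub hzint) (integrableOn_exp_mul_comp_add hρ hg hC 0 t)
    measurableSet_Ioi fun _ _ => ?_
  rw [← mul_sub]
  exact mul_le_mul_of_nonneg_left (hgyz _) (exp_pos _).le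

lemma bwdResolvent_nonneg {θ : ℝ} {w : ℝ → ℝ} (hw : ∀ s, 0 ≤ w s) (t : ℝ) :
    0 ≤ bwdResolvent θ w t := by
  rw [bwdResolvent_eq_fwdResolvent_neg]
  exact fwdResolvent_nonneg fun _ _ => hw _

lemma abs_bwdResolvent_le {θ C : ℝ} (hθ : 0 < θ) {w : ℝ → ℝ} (hw : Continuous w)
    (hC : ∀ t, |w t| ≤ C) (t : ℝ) : |bwdResolvent θ w t| ≤ C / θ := by
  rw [bwdResolvent_eq_fwdResolvent_neg]
  exact abs_fwdResolvent_le hθ (by fun_prop) (fun _ => hC _) _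

lemma bwdResolvent_sub {θ C C' : ℝ} (hθ : 0 < θ) {f g : ℝ → ℝ} (hf : Continuous f)
    (hg : Continuous g) (hfC : ∀ t, |f t| ≤ C) (hgC : ∀ t, |g t| ≤ C') (t : ℝ) :
    bwdResolvent θ (fun s => f s - g s) t = bwdResolvent θ f t - bwdResolvent θ g t := by
  simp only [bwdResolvent_eq_fwdResolvent_neg]
  exact fwdResolvent_sub hθ (by fun_prop) (by fun_prop) (fun _ => hfC _) (fun _ => hgC _) _

lemma bwdResolvent_comp_add (θ : ℝ) (w : ℝ → ℝ) (s t : ℝ) :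
    bwdResolvent θ (fun r => w (r + s)) t = bwdResolvent θ w (t + s) := by
  simp only [bwdResolvent, add_sub_right_comm]

lemma hasDerivAt_bwdResolvent {θ C : ℝ} (hθ : 0 < θ) {w : ℝ → ℝ} (hw : Continuous w)
    (hC : ∀ t, |w t| ≤ C) (t : ℝ) :
    HasDerivAt (bwdResolvent θ w) (w t - θ * bwdResolvent θ w t) t := by
  rw [funext (bwdResolvent_eq_fwdResolvent_neg θ w)]
  have hderiv := hasDerivAt_fwdResolvent hθ (g := fun s => w (-s)) (by fun_prop)
    (fun _ => hC _) (-t)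
  exact (hderiv.comp t (hasDerivAt_neg t)).congr_deriv (by simp)

lemma continuous_bwdResolvent {θ C : ℝ} (hθ : 0 < θ) {w : ℝ → ℝ} (hw : Continuous w)
    (hC : ∀ t, |w t| ≤ C) : Continuous (bwdResolvent θ w) :=
  continuous_iff_continuousAt.2 fun t => (hasDerivAt_bwdResolvent hθ hw hC t).continuousAt

lemma tendsto_bwdResolvent {ι : Type*} {l : Filter ι} [l.IsCountablyGenerated] {θ C : ℝ}
    (hθ : 0 < θ) {W : ι → ℝ → ℝ} {T : ι → ℝ} {w : ℝ → ℝ} {r : ℝ} (hW : ∀ i, Continuous (W i))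
    (hC : ∀ i t, |W i t| ≤ C) (hlim : ∀ σ, Tendsto (fun i => W i (T i - σ)) l (𝓝 (w (r - σ)))) :
    Tendsto (fun i => bwdResolvent θ (W i) (T i)) l (𝓝 (bwdResolvent θ w r)) := by
  simp only [bwdResolvent_eq_fwdResolvent_neg]
  refine tendsto_fwdResolvent (G := fun i s => W i (-s)) (T := fun i => -T i) hθ
    (fun i => by have := hW i; fun_prop) (fun i t => hC i _) (fun σ => ?_)
  simpa [sub_eq_add_neg, add_comm] using hlim σ

lemma bwdResolvent_le_exp {θ z A C : ℝ} (hθ : 0 < θ) (hz : -θ < z) {w : ℝ → ℝ}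
    (hw : Continuous w) (hC : ∀ t, |w t| ≤ C) (hwz : ∀ t, w t ≤ A * exp (z * t)) (t : ℝ) :
    bwdResolvent θ w t ≤ A / (z + θ) * exp (z * t) := by
  rw [bwdResolvent_eq_fwdResolvent_neg]
  refine (fwdResolvent_le_exp (A := A) hθ (neg_lt.1 hz) (by fun_prop) (fun _ => hC _)
    (fun s => (hwz (-s)).trans_eq (by ring_nf)) (-t)).trans_eq ?_
  rw [neg_mul_neg, sub_neg_eq_add, add_comm]

lemma exp_sub_exp_le_bwdResolvent {θ y z A B C : ℝ} (hθ : 0 < θ) (hy : -θ < y) (hz : -θ < z)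
    {w : ℝ → ℝ} (hw : Continuous w) (hC : ∀ t, |w t| ≤ C)
    (hwyz : ∀ t, A * exp (y * t) - B * exp (z * t) ≤ w t) (t : ℝ) :
    A / (y + θ) * exp (y * t) - B / (z + θ) * exp (z * t) ≤ bwdResolvent θ w t := by
  rw [bwdResolvent_eq_fwdResolvent_neg]
  refine Eq.trans_le ?_ (exp_sub_exp_le_fwdResolvent (A := A) (B := B) hθ (neg_lt.1 hy)
    (neg_lt.1 hz) (by fun_prop) (fun _ => hC _)
    (fun s => Eq.trans_le (by ring_nf) (hwyz (-s))) (-t))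
  simp only [neg_mul_neg, sub_neg_eq_add, add_comm θ]

/-! ### The monotone iteration scheme -/

/-- The cone of nonnegative functions `x` for which `t ↦ e^{θ t} x t` is nondecreasing. The
iteration is monotone with respect to the order of this cone, not with respect to the pointwise
order. -/
structure MemExpCone (θ : ℝ) (x : ℝ → ℝ) : Prop where
  nonneg : ∀ t, 0 ≤ x t
  monotone : Monotone fun t => exp (θ * t) * x t

namespace MemExpCone

lemma le_exp_mul_add {θ : ℝ} {x : ℝ → ℝ} (hx : MemExpCone θ x) (t : ℝ) {s : ℝ} (hs : 0 ≤ s) :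
    x t ≤ exp (θ * s) * x (t + s) := by
  have weighted : exp (θ * t) * x t ≤ exp (θ * (t + s)) * x (t + s) :=
    hx.monotone (le_add_of_nonneg_right hs)
  rw [mul_add, exp_add, mul_assoc] at weighted
  exact le_of_mul_le_mul_left weighted (exp_pos _)

lemma of_le_exp_mul_add {θ : ℝ} {x : ℝ → ℝ} (hx : ∀ t, 0 ≤ x t)
    (hgrowth : ∀ t s, 0 ≤ s → x t ≤ exp (θ * s) * x (t + s)) : MemExpCone θ x := by
  refine ⟨hx, fun t s hts => ?_⟩
  calc exp (θ * t) * x t ≤ exp (θ * t) * (exp (θ * (s - t)) * x (t + (s - t))) :=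
        mul_le_mul_of_nonneg_left (hgrowth t _ (sub_nonneg.2 hts)) (exp_pos _).le
    _ = exp (θ * s) * x s := by
        rw [← mul_assoc, ← exp_add, ← mul_add, add_sub_cancel]

lemma of_sub_shift {b h θ C : ℝ} (hb0 : 0 ≤ b) (hb1 : b < 1) {x : ℝ → ℝ}
    (hx : ∀ t, |x t| ≤ C) (hv : MemExpCone θ fun t => x t - b * x (t - h)) : MemExpCone θ x := by
  refine of_le_exp_mul_add (nonneg_of_shift hb0 hb1 (h := h) (fun t => (abs_le.1 (hx t)).1)
    fun t => by linarith [hv.nonneg t]) fun t s hs => sub_nonneg.1 ?_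
  refine nonneg_of_shift hb0 hb1 (h := h) (C := (exp (θ * s) + 1) * C)
    (D := fun t => exp (θ * s) * x (t + s) - x t) (fun t => ?_) (fun t => ?_) t
  · have := mul_le_mul_of_nonneg_left (abs_le.1 (hx (t + s))).1 (exp_pos (θ * s)).le
    linarith [(abs_le.1 (hx t)).2]
  · have := hv.le_exp_mul_add t hs
    rw [sub_add_eq_add_sub]
    linarith

lemma bwdResolvent {θ C : ℝ} (hθ : 0 < θ) {w : ℝ → ℝ} (hw : Continuous w) (hC : ∀ t, |w t| ≤ C)
    (hw0 : ∀ t, 0 ≤ w t) : MemExpCone θ (bwdResolvent θ w) :=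
  ⟨bwdResolvent_nonneg hw0, monotone_of_hasDerivAt_nonneg
    (fun t => hasDerivAt_exp_mul_mul θ (hasDerivAt_bwdResolvent hθ hw hC t))
    fun t => mul_nonneg (exp_pos _).le (by linarith [hw0 t])⟩

end MemExpCone

/-- The parameters of the iteration for the reaction term `κ φ(t) (1 - φ(t - h))`, where
`h = c τ` and `-θ` is negative. For `κ = 1` the field `κ_mul_exp_le` says that `χ₁(-θ) ≥ 0`; values
`κ < 1` serve to approximate the critical case by noncritical ones. -/
structure StepParams (b c h θ κ : ℝ) : Prop where
  b_nonneg : 0 ≤ b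
  b_lt_one : b < 1
  c_pos : 0 < c
  h_nonneg : 0 ≤ h
  θ_pos : 0 < θ
  κ_pos : 0 < κ
  κ_le_one : κ ≤ 1
  shift_pos : 0 < 1 - b * exp (θ * h)
  κ_mul_exp_le : κ * exp (θ * h) ≤ θ * (c + θ) * (1 - b * exp (θ * h))

namespace StepParams
variable {b c h θ κ : ℝ} (H : StepParams b c h θ κ)
include H

lemma add_pos : 0 < c + θ := _root_.add_pos H.c_pos H.θ_pos

lemma mul_add_pos : 0 < θ * (c + θ) := mul_pos H.θ_pos H.add_pos

lemma one_sub_b_pos : 0 < 1 - b := sub_pos.2 H.b_lt_one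

end StepParams

/-- Continuous functions on the line with values in the unit interval. -/
structure UnitFun (φ : ℝ → ℝ) : Prop where
  continuous : Continuous φ
  nonneg : ∀ t, 0 ≤ φ t
  le_one : ∀ t, φ t ≤ 1

/-- The bounded solution `φ` of `(∂ + θ) (φ - b φ(· - h)) = f`, for a bounded `f`. -/
def neutralResolvent (b h θ : ℝ) (f : ℝ → ℝ) : ℝ → ℝ := neumannSeries b h (bwdResolvent θ f)

section
variable {b c h θ κ C : ℝ} {f g : ℝ → ℝ}

lemma neutralResolvent_sub_shift (H : StepParams b c h θ κ) (hf : Continuous f)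
    (hfC : ∀ t, |f t| ≤ C) (t : ℝ) :
    neutralResolvent b h θ f t - b * neutralResolvent b h θ f (t - h) = bwdResolvent θ f t :=
  neumannSeries_sub_shift H.b_nonneg H.b_lt_one (abs_bwdResolvent_le H.θ_pos hf hfC) t

lemma abs_neutralResolvent_le (H : StepParams b c h θ κ) (hf : Continuous f)
    (hfC : ∀ t, |f t| ≤ C) (t : ℝ) : |neutralResolvent b h θ f t| ≤ C / θ / (1 - b) :=
  abs_neumannSeries_le H.b_nonneg H.b_lt_one (abs_bwdResolvent_le H.θ_pos hf hfC) t

lemma continuous_neutralResolvent (H : StepParams b c h θ κ) (hf : Continuous f)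
    (hfC : ∀ t, |f t| ≤ C) : Continuous (neutralResolvent b h θ f) :=
  continuous_neumannSeries H.b_nonneg H.b_lt_one (abs_bwdResolvent_le H.θ_pos hf hfC)
    (continuous_bwdResolvent H.θ_pos hf hfC)

lemma neutralResolvent_comp_add (f : ℝ → ℝ) (s : ℝ) :
    neutralResolvent b h θ (fun t => f (t + s)) = fun t => neutralResolvent b h θ f (t + s) := by
  funext t
  simp only [neutralResolvent, neumannSeries, bwdResolvent_comp_add, sub_add_eq_add_sub]

theorem neutralResolvent_sub_memExpCone {C' : ℝ} (H : StepParams b c h θ κ) (hf : Continuous f)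
    (hg : Continuous g) (hfC : ∀ t, |f t| ≤ C) (hgC : ∀ t, |g t| ≤ C') (hfg : ∀ t, g t ≤ f t) :
    MemExpCone θ fun t => neutralResolvent b h θ f t - neutralResolvent b h θ g t := by
  refine MemExpCone.of_sub_shift H.b_nonneg H.b_lt_one (h := h) (fun t => (abs_sub _ _).trans
    (add_le_add (abs_neutralResolvent_le H hf hfC t) (abs_neutralResolvent_le H hg hgC t))) ?_
  convert MemExpCone.bwdResolvent (w := fun t => f t - g t) H.θ_pos (hf.sub hg)
    (fun t => (abs_sub (f t) (g t)).trans (add_le_add (hfC t) (hgC t)))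
    (fun t => sub_nonneg.2 (hfg t)) using 2 with t
  have sub_eq := bwdResolvent_sub H.θ_pos hf hg hfC hgC t
  linarith [neutralResolvent_sub_shift H hf hfC t, neutralResolvent_sub_shift H hg hgC t]

end

/-- The profile equation for `v = φ - b φ(· - h)` with reaction rate `κ` reads
`v'' - c v' - θ (c + θ) v + source φ = 0`. -/
def source (b c h θ κ : ℝ) (φ : ℝ → ℝ) (t : ℝ) : ℝ :=
  θ * (c + θ) * (φ t - b * φ (t - h)) + κ * (φ t * (1 - φ (t - h)))

/-- The bounded solution `v` of `v'' - c v' - θ (c + θ) v + source φ = 0`, obtained from the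
factorization `(∂ + θ) (∂ - (c + θ))` of the left-hand side. -/
def green (b c h θ κ : ℝ) (φ : ℝ → ℝ) : ℝ → ℝ :=
  bwdResolvent θ (fwdResolvent (c + θ) (source b c h θ κ φ))

/-- The iteration map, whose fixed points in `[0, 1]` are the solutions of the profile equation. -/
def step (b c h θ κ : ℝ) (φ : ℝ → ℝ) : ℝ → ℝ :=
  neutralResolvent b h θ (fwdResolvent (c + θ) (source b c h θ κ φ))

/-- A bound for `|source b c h θ κ φ|` that holds for all unit-valued `φ`. -/
def sourceBound (c θ : ℝ) : ℝ := θ * (c + θ) + 1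

/-- A Lipschitz constant that is valid for all functions in the range of `step`. -/
def stepLipschitzConst (b c θ : ℝ) : ℝ := 2 * (sourceBound c θ / (c + θ)) / (1 - b)

section
variable {b c h θ κ : ℝ} {φ ψ : ℝ → ℝ}

lemma continuous_source (hφ : UnitFun φ) : Continuous (source b c h θ κ φ) := by
  have := hφ.continuous
  unfold source
  fun_prop

lemma UnitFun.abs_sub_shift_le (hφ : UnitFun φ) (hb0 : 0 ≤ b) (hb1 : b ≤ 1) (h t : ℝ) :
    |φ t - b * φ (t - h)| ≤ 1 := by
  have delayed_nonneg : 0 ≤ b * φ (t - h) := mul_nonneg hb0 (hφ.nonneg _)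
  have delayed_le : b * φ (t - h) ≤ 1 := mul_le_one₀ hb1 (hφ.nonneg _) (hφ.le_one _)
  exact abs_le.2 ⟨by linarith [hφ.nonneg t], by linarith [hφ.le_one t]⟩

lemma UnitFun.reaction_mem_Icc (hφ : UnitFun φ) (hκ0 : 0 ≤ κ) (hκ1 : κ ≤ 1) (h t : ℝ) :
    κ * (φ t * (1 - φ (t - h))) ∈ Icc 0 1 := by
  have factor_nonneg : 0 ≤ 1 - φ (t - h) := sub_nonneg.2 (hφ.le_one _)
  have product_le : φ t * (1 - φ (t - h)) ≤ 1 :=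
    mul_le_one₀ (hφ.le_one t) factor_nonneg (by linarith [hφ.nonneg (t - h)])
  exact ⟨mul_nonneg hκ0 (mul_nonneg (hφ.nonneg t) factor_nonneg),
    mul_le_one₀ hκ1 (mul_nonneg (hφ.nonneg t) factor_nonneg) product_le⟩

lemma abs_source_le (H : StepParams b c h θ κ) (hφ : UnitFun φ) (t : ℝ) :
    |source b c h θ κ φ t| ≤ sourceBound c θ := by
  have reaction := hφ.reaction_mem_Icc H.κ_pos.le H.κ_le_one h t
  refine (abs_add_le _ _).trans (add_le_add ?_ ?_)
  · rw [abs_mul, abs_of_pos H.mul_add_pos]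
    exact mul_le_of_le_one_right H.mul_add_pos.le
      (hφ.abs_sub_shift_le H.b_nonneg H.b_lt_one.le h t)
  · rw [abs_of_nonneg reaction.1]
    exact reaction.2

lemma continuous_fwdResolvent_source (H : StepParams b c h θ κ) (hφ : UnitFun φ) :
    Continuous (fwdResolvent (c + θ) (source b c h θ κ φ)) :=
  continuous_fwdResolvent H.add_pos (continuous_source hφ) (abs_source_le H hφ)

lemma abs_fwdResolvent_source_le (H : StepParams b c h θ κ) (hφ : UnitFun φ) (t : ℝ) :
    |fwdResolvent (c + θ) (source b c h θ κ φ) t| ≤ sourceBound c θ / (c + θ) :=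
  abs_fwdResolvent_le H.add_pos (continuous_source hφ) (abs_source_le H hφ) t

lemma hasDerivAt_fwdResolvent_source (H : StepParams b c h θ κ) (hφ : UnitFun φ) (t : ℝ) :
    HasDerivAt (fwdResolvent (c + θ) (source b c h θ κ φ))
      ((c + θ) * fwdResolvent (c + θ) (source b c h θ κ φ) t - source b c h θ κ φ t) t :=
  hasDerivAt_fwdResolvent H.add_pos (continuous_source hφ) (abs_source_le H hφ) t

lemma abs_green_le (H : StepParams b c h θ κ) (hφ : UnitFun φ) (t : ℝ) :
    |green b c h θ κ φ t| ≤ sourceBound c θ / (c + θ) / θ :=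
  abs_bwdResolvent_le H.θ_pos (continuous_fwdResolvent_source H hφ)
    (abs_fwdResolvent_source_le H hφ) t

lemma hasDerivAt_green (H : StepParams b c h θ κ) (hφ : UnitFun φ) (t : ℝ) :
    HasDerivAt (green b c h θ κ φ)
      (fwdResolvent (c + θ) (source b c h θ κ φ) t - θ * green b c h θ κ φ t) t :=
  hasDerivAt_bwdResolvent H.θ_pos (continuous_fwdResolvent_source H hφ)
    (abs_fwdResolvent_source_le H hφ) t

lemma continuous_green (H : StepParams b c h θ κ) (hφ : UnitFun φ) :
    Continuous (green b c h θ κ φ) :=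
  continuous_bwdResolvent H.θ_pos (continuous_fwdResolvent_source H hφ)
    (abs_fwdResolvent_source_le H hφ)

lemma abs_deriv_green_le (H : StepParams b c h θ κ) (hφ : UnitFun φ) (t : ℝ) :
    |fwdResolvent (c + θ) (source b c h θ κ φ) t - θ * green b c h θ κ φ t|
      ≤ 2 * (sourceBound c θ / (c + θ)) := by
  have hgreen := abs_green_le H hφ t
  rw [le_div_iff₀ H.θ_pos] at hgreen
  calc _ ≤ |fwdResolvent (c + θ) (source b c h θ κ φ) t| + |θ * green b c h θ κ φ t| :=
        abs_sub _ _
    _ ≤ _ := by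
        rw [abs_mul, abs_of_pos H.θ_pos]
        linarith [abs_fwdResolvent_source_le H hφ t]

lemma step_sub_shift (H : StepParams b c h θ κ) (hφ : UnitFun φ) (t : ℝ) :
    step b c h θ κ φ t - b * step b c h θ κ φ (t - h) = green b c h θ κ φ t :=
  neutralResolvent_sub_shift H (continuous_fwdResolvent_source H hφ)
    (abs_fwdResolvent_source_le H hφ) t

lemma abs_step_le (H : StepParams b c h θ κ) (hφ : UnitFun φ) (t : ℝ) :
    |step b c h θ κ φ t| ≤ sourceBound c θ / (c + θ) / θ / (1 - b) :=
  abs_neutralResolvent_le H (continuous_fwdResolvent_source H hφ)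
    (abs_fwdResolvent_source_le H hφ) t

lemma continuous_step (H : StepParams b c h θ κ) (hφ : UnitFun φ) :
    Continuous (step b c h θ κ φ) :=
  continuous_neutralResolvent H (continuous_fwdResolvent_source H hφ)
    (abs_fwdResolvent_source_le H hφ)

lemma source_comp_add (φ : ℝ → ℝ) (s : ℝ) :
    source b c h θ κ (fun t => φ (t + s)) = fun t => source b c h θ κ φ (t + s) := by
  funext t
  simp only [source, sub_add_eq_add_sub]

lemma fwdResolvent_source_comp_add (φ : ℝ → ℝ) (s : ℝ) :
    fwdResolvent (c + θ) (source b c h θ κ fun t => φ (t + s))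
      = fun t => fwdResolvent (c + θ) (source b c h θ κ φ) (t + s) := by
  rw [source_comp_add]
  exact funext (fwdResolvent_comp_add (c + θ) _ s)

lemma step_comp_add (φ : ℝ → ℝ) (s : ℝ) :
    step b c h θ κ (fun t => φ (t + s)) = fun t => step b c h θ κ φ (t + s) := by
  rw [step, step, ← neutralResolvent_comp_add, fwdResolvent_source_comp_add]

lemma green_comp_add (φ : ℝ → ℝ) (s : ℝ) :
    green b c h θ κ (fun t => φ (t + s)) = fun t => green b c h θ κ φ (t + s) := by
  rw [green, green, fwdResolvent_source_comp_add]
  exact funext (bwdResolvent_comp_add θ _ s)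

lemma source_le_source (H : StepParams b c h θ κ) (hφ : UnitFun φ) (hψ : UnitFun ψ)
    (hcone : MemExpCone θ fun t => φ t - ψ t) (t : ℝ) :
    source b c h θ κ ψ t ≤ source b c h θ κ φ t := by
  set Q := θ * (c + θ) with hQ
  set x := φ t - ψ t with hx
  set y := φ (t - h) - ψ (t - h) with hy
  have x_nonneg : 0 ≤ x := hcone.nonneg t
  have y_nonneg : 0 ≤ y := hcone.nonneg (t - h)
  have y_le : y ≤ exp (θ * h) * x := by
    simpa only [sub_add_cancel] using hcone.le_exp_mul_add (t - h) H.h_nonneg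
  have Q_mul_b_nonneg : 0 ≤ Q * b := mul_nonneg H.mul_add_pos.le H.b_nonneg
  have delayed : (Q * b + κ) * y ≤ (Q * b + κ) * (exp (θ * h) * x) :=
    mul_le_mul_of_nonneg_left y_le (add_nonneg Q_mul_b_nonneg H.κ_pos.le)
  have hκx : κ * exp (θ * h) * x ≤ Q * (1 - b * exp (θ * h)) * x :=
    mul_le_mul_of_nonneg_right H.κ_mul_exp_le x_nonneg
  have gain : 0 ≤ κ * (x * (1 - ψ (t - h))) :=
    mul_nonneg H.κ_pos.le (mul_nonneg x_nonneg (sub_nonneg.2 (hψ.le_one _)))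
  have loss : κ * (φ t * y) ≤ κ * y :=
    mul_le_mul_of_nonneg_left (mul_le_of_le_one_left y_nonneg (hφ.le_one t)) H.κ_pos.le
  have difference : source b c h θ κ φ t - source b c h θ κ ψ t
      = Q * (x - b * y) + κ * (x * (1 - ψ (t - h)) - φ t * y) := by
    simp only [source, hx, hy, hQ]
    ring
  linarith

theorem step_sub_memExpCone (H : StepParams b c h θ κ) (hφ : UnitFun φ) (hψ : UnitFun ψ)
    (hcone : MemExpCone θ fun t => φ t - ψ t) :
    MemExpCone θ fun t => step b c h θ κ φ t - step b c h θ κ ψ t :=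
  neutralResolvent_sub_memExpCone H (continuous_fwdResolvent_source H hφ)
    (continuous_fwdResolvent_source H hψ) (abs_fwdResolvent_source_le H hφ)
    (abs_fwdResolvent_source_le H hψ) fun _ =>
      fwdResolvent_mono H.add_pos (continuous_source hψ) (continuous_source hφ)
        (abs_source_le H hψ) (abs_source_le H hφ) fun s _ => source_le_source H hφ hψ hcone s

lemma abs_green_sub_le (H : StepParams b c h θ κ) (hφ : UnitFun φ) (t s : ℝ) :
    |green b c h θ κ φ t - green b c h θ κ φ s|
      ≤ 2 * (sourceBound c θ / (c + θ)) * |t - s| := by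
  simpa only [Real.norm_eq_abs] using
    convex_univ.norm_image_sub_le_of_norm_hasDerivWithin_le (f := green b c h θ κ φ)
      (fun r _ => (hasDerivAt_green H hφ r).hasDerivWithinAt)
      (fun r _ => abs_deriv_green_le H hφ r) (mem_univ s) (mem_univ t)

lemma abs_sub_le_of_sub_shift_eq_green {x : ℝ → ℝ} {C : ℝ} (H : StepParams b c h θ κ)
    (hφ : UnitFun φ) (hx : ∀ t, |x t| ≤ C)
    (hs : ∀ t, x t - b * x (t - h) = green b c h θ κ φ t) (t s : ℝ) :
    |x t - x s| ≤ stepLipschitzConst b c θ * |t - s| := by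
  set Λ := stepLipschitzConst b c θ with hΛ
  have const_eq : Λ * (1 - b) = 2 * (sourceBound c θ / (c + θ)) := by
    rw [hΛ, stepLipschitzConst, div_mul_cancel₀ _ H.one_sub_b_pos.ne']
  have increment_le : ∀ d r, 0 ≤ Λ * |d| - (x (r + d) - x r) := by
    intro d
    refine nonneg_of_shift H.b_nonneg H.b_lt_one (h := h) (C := -(Λ * |d|) + 2 * C)
      (fun r => by linarith [(abs_le.1 (hx (r + d))).2, (abs_le.1 (hx r)).1]) (fun r => ?_)
    have green_le := (abs_le.1 (abs_green_sub_le H hφ (r + d) r)).2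
    rw [add_sub_cancel_left, ← const_eq, ← hs, ← hs] at green_le
    rw [sub_add_eq_add_sub]
    linarith
  have forward := increment_le (t - s) s
  have backward := increment_le (s - t) t
  rw [abs_sub_comm s t] at backward
  simp only [add_sub_cancel] at forward backward
  exact abs_le.2 ⟨by linarith, by linarith⟩

end

/-! ### Upper and lower solutions -/

/-- The characteristic function of the linearization at zero, with reaction rate `κ`. -/
def chi (b c h κ z : ℝ) : ℝ := z ^ 2 - c * z + κ / (1 - b * exp (-(z * h)))

/-- The factor by which `neutralResolvent b h θ` multiplies `t ↦ (1 - b) θ e^{z t}`. -/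
def expGain (b h θ z : ℝ) : ℝ := (1 - b) * θ / (z + θ) / (1 - b * exp (-(z * h)))

/-- Right-hand sides between zero and the constant `(1 - b) θ`, which `neutralResolvent b h θ`
maps to the constant `1`. -/
structure UnitSource (b θ : ℝ) (f : ℝ → ℝ) : Prop where
  continuous : Continuous f
  nonneg : ∀ t, 0 ≤ f t
  le : ∀ t, f t ≤ (1 - b) * θ

/-- The source of the upper solution. -/
def upperSource (b θ r t : ℝ) : ℝ := (1 - b) * θ * min (exp (r * t)) 1

/-- The upper solution: the start of the monotone iteration. -/
def upperSol (b h θ r : ℝ) : ℝ → ℝ := neutralResolvent b h θ (upperSource b θ r)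

/-- The source of the lower solution. -/
def lowerSource (b θ r m E t : ℝ) : ℝ :=
  (1 - b) * θ * max (exp (r * t) - E * exp (m * t)) 0

/-- The lower solution, which keeps the limit of the iteration away from zero. -/
def lowerSol (b h θ r m E : ℝ) : ℝ → ℝ := neutralResolvent b h θ (lowerSource b θ r m E)

section
variable {b c h θ κ r z : ℝ}

lemma StepParams.mul_exp_lt_one (H : StepParams b c h θ κ) (hz : 0 ≤ z) :
    b * exp (-(z * h)) < 1 :=
  (mul_le_of_le_one_right H.b_nonneg
    (exp_le_one_iff.2 (neg_nonpos.2 (mul_nonneg hz H.h_nonneg)))).trans_lt H.b_lt_one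

lemma StepParams.source_bound_pos (H : StepParams b c h θ κ) : 0 < (1 - b) * θ :=
  mul_pos H.one_sub_b_pos H.θ_pos

lemma StepParams.expGain_pos (H : StepParams b c h θ κ) (hz : 0 ≤ z) : 0 < expGain b h θ z :=
  div_pos (div_pos H.source_bound_pos (add_pos_of_nonneg_of_pos hz H.θ_pos))
    (sub_pos.2 (H.mul_exp_lt_one hz))

lemma StepParams.lt_speed_of_chi_nonpos (H : StepParams b c h θ κ) (hz : 0 < z)
    (hχ : chi b c h κ z ≤ 0) : z < c := by
  have reaction_pos : 0 < κ / (1 - b * exp (-(z * h))) :=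
    div_pos H.κ_pos (sub_pos.2 (H.mul_exp_lt_one hz.le))
  rw [chi] at hχ
  nlinarith

lemma linear_source_expGain (hz : z + θ ≠ 0) :
    θ * (c + θ) * ((1 - b) * θ / (z + θ)) + κ * expGain b h θ z
      = (1 - b) * θ * (c + θ - z) + (1 - b) * θ / (z + θ) * chi b c h κ z := by
  have cancel : (1 - b) * θ / (z + θ) * (z + θ) = (1 - b) * θ := div_mul_cancel₀ _ hz
  rw [expGain, chi]
  linear_combination (c + θ - z) * cancel

namespace UnitSource
variable {f : ℝ → ℝ}

lemma abs_le (hf : UnitSource b θ f) (t : ℝ) : |f t| ≤ (1 - b) * θ :=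
  (abs_of_nonneg (hf.nonneg t)).trans_le (hf.le t)

lemma bwdResolvent_le (H : StepParams b c h θ κ) (hf : UnitSource b θ f) (t : ℝ) :
    bwdResolvent θ f t ≤ 1 - b := by
  have abs_le := abs_bwdResolvent_le H.θ_pos hf.continuous hf.abs_le t
  rw [mul_div_cancel_right₀ _ H.θ_pos.ne'] at abs_le
  exact (_root_.abs_le.1 abs_le).2

lemma unitFun_neutralResolvent (H : StepParams b c h θ κ) (hf : UnitSource b θ f) :
    UnitFun (neutralResolvent b h θ f) := by
  have abs_le_one : ∀ t, |neutralResolvent b h θ f t| ≤ 1 := fun t => by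
    have abs_le := abs_neutralResolvent_le H hf.continuous hf.abs_le t
    rwa [mul_div_cancel_right₀ _ H.θ_pos.ne', div_self H.one_sub_b_pos.ne'] at abs_le
  refine ⟨continuous_neutralResolvent H hf.continuous hf.abs_le,
    nonneg_of_shift H.b_nonneg H.b_lt_one (h := h) (fun t => (_root_.abs_le.1 (abs_le_one t)).1)
      fun t => ?_, fun t => (_root_.abs_le.1 (abs_le_one t)).2⟩
  rw [← sub_nonneg, neutralResolvent_sub_shift H hf.continuous hf.abs_le]
  exact bwdResolvent_nonneg hf.nonneg t

lemma hasDerivAt_exp_mul_sub_bwdResolvent (H : StepParams b c h θ κ) (hf : UnitSource b θ f)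
    (t : ℝ) : HasDerivAt (fun s => exp (θ * s) * (1 - b - bwdResolvent θ f s))
      (exp (θ * t) * ((1 - b) * θ - f t)) t :=
  (hasDerivAt_exp_mul_mul θ
    ((hasDerivAt_bwdResolvent H.θ_pos hf.continuous hf.abs_le t).const_sub _)).congr_deriv
      (by ring)

lemma monotone_exp_mul_sub_bwdResolvent (H : StepParams b c h θ κ) (hf : UnitSource b θ f) :
    Monotone fun t => exp (θ * t) * (1 - b - bwdResolvent θ f t) :=
  monotone_of_hasDerivAt_nonneg (hf.hasDerivAt_exp_mul_sub_bwdResolvent H)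
    fun t => mul_nonneg (exp_pos _).le (sub_nonneg.2 (hf.le t))

lemma bwdResolvent_le_of_nonneg (H : StepParams b c h θ κ) (hf : UnitSource b θ f) {t : ℝ}
    (ht : 0 ≤ t) :
    bwdResolvent θ f t ≤ 1 - b - (1 - b - bwdResolvent θ f 0) * exp (-θ * t) := by
  have weighted := hf.monotone_exp_mul_sub_bwdResolvent H ht
  simp only [mul_zero, exp_zero, one_mul] at weighted
  rw [neg_mul, exp_neg, le_sub_comm, ← div_eq_mul_inv, div_le_iff₀' (exp_pos _)]
  exact weighted

end UnitSource

lemma unitSource_upperSource (H : StepParams b c h θ κ) (r : ℝ) :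
    UnitSource b θ (upperSource b θ r) where
  continuous := by
    unfold upperSource
    fun_prop
  nonneg t := mul_nonneg H.source_bound_pos.le (le_min (exp_pos _).le zero_le_one)
  le t := mul_le_of_le_one_right H.source_bound_pos.le (min_le_right _ _)

lemma unitFun_upperSol (H : StepParams b c h θ κ) (r : ℝ) : UnitFun (upperSol b h θ r) :=
  (unitSource_upperSource H r).unitFun_neutralResolvent H

lemma upperSol_sub_shift (H : StepParams b c h θ κ) (r t : ℝ) :
    upperSol b h θ r t - b * upperSol b h θ r (t - h) = bwdResolvent θ (upperSource b θ r) t :=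
  neutralResolvent_sub_shift H (unitSource_upperSource H r).continuous
    (unitSource_upperSource H r).abs_le t

lemma bwdResolvent_upperSource_le_exp (H : StepParams b c h θ κ) (hr : 0 < r) (t : ℝ) :
    bwdResolvent θ (upperSource b θ r) t ≤ (1 - b) * θ / (r + θ) * exp (r * t) :=
  bwdResolvent_le_exp H.θ_pos (by linarith [H.θ_pos]) (unitSource_upperSource H r).continuous
    (unitSource_upperSource H r).abs_le
    (fun _ => mul_le_mul_of_nonneg_left (min_le_left _ _) H.source_bound_pos.le) t

lemma upperSol_le_exp (H : StepParams b c h θ κ) (hr : 0 < r) (t : ℝ) :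
    upperSol b h θ r t ≤ expGain b h θ r * exp (r * t) :=
  neumannSeries_le_exp H.b_nonneg H.b_lt_one (H.mul_exp_lt_one hr.le)
    (abs_bwdResolvent_le H.θ_pos (unitSource_upperSource H r).continuous
      (unitSource_upperSource H r).abs_le) (bwdResolvent_upperSource_le_exp H hr) t

lemma le_bwdResolvent_upperSource (H : StepParams b c h θ κ) (hr : 0 < r) (t : ℝ) :
    1 - b - (1 - b - bwdResolvent θ (upperSource b θ r) 0) * exp (-θ * t)
      ≤ bwdResolvent θ (upperSource b θ r) t := by
  have hU := unitSource_upperSource H r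
  have saturated : ∀ s ∈ Ici (0 : ℝ), (1 - b) * θ - upperSource b θ r s = 0 := fun s hs => by
    rw [upperSource, min_eq_right (one_le_exp (mul_nonneg hr.le hs)), mul_one, sub_self]
  have antitone := antitoneOn_of_hasDerivAt_nonpos (convex_Ici 0)
    (fun s _ => hU.hasDerivAt_exp_mul_sub_bwdResolvent H s)
    fun s hs => by rw [saturated s hs, mul_zero]
  have weighted : exp (θ * t) * (1 - b - bwdResolvent θ (upperSource b θ r) t)
      ≤ exp (θ * 0) * (1 - b - bwdResolvent θ (upperSource b θ r) 0) := by
    rcases le_total 0 t with ht | ht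
    · exact antitone (mem_Ici.2 le_rfl) (mem_Ici.2 ht) ht
    · exact hU.monotone_exp_mul_sub_bwdResolvent H ht
  simp only [mul_zero, exp_zero, one_mul] at weighted
  rw [neg_mul, exp_neg, sub_le_comm, ← div_eq_mul_inv, le_div_iff₀' (exp_pos _)]
  exact weighted

lemma le_upperSol (H : StepParams b c h θ κ) (hr : 0 < r) (t : ℝ) :
    1 - (1 - b - bwdResolvent θ (upperSource b θ r) 0) / (1 - b * exp (θ * h)) * exp (-θ * t)
      ≤ upperSol b h θ r t := by
  have shift_lt_one : b * exp (-(-θ * h)) < 1 := by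
    rw [neg_mul, neg_neg]
    exact sub_pos.1 H.shift_pos
  have := exp_sub_exp_le_neumannSeries H.b_nonneg H.b_lt_one (H.mul_exp_lt_one le_rfl)
    shift_lt_one (abs_bwdResolvent_le H.θ_pos (unitSource_upperSource H r).continuous
      (unitSource_upperSource H r).abs_le) (A := 1 - b)
    (fun s => by simpa using le_bwdResolvent_upperSource H hr s) t
  simpa [upperSol, neutralResolvent, div_self H.one_sub_b_pos.ne'] using this

lemma source_upperSol_le_const (H : StepParams b c h θ κ) (hr : 0 < r) {t : ℝ} (ht : 0 ≤ t) :
    source b c h θ κ (upperSol b h θ r) t ≤ θ * (c + θ) * (1 - b) := by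
  have hU := unitFun_upperSol H r
  set M := 1 - b - bwdResolvent θ (upperSource b θ r) 0
  set a := 1 - b * exp (θ * h)
  have a_pos : 0 < a := H.shift_pos
  have M_nonneg : 0 ≤ M := sub_nonneg.2 ((unitSource_upperSource H r).bwdResolvent_le H 0)
  have neutral_le : θ * (c + θ) * (upperSol b h θ r t - b * upperSol b h θ r (t - h))
      ≤ θ * (c + θ) * (1 - b - M * exp (-θ * t)) := by
    rw [upperSol_sub_shift H]
    exact mul_le_mul_of_nonneg_left
      ((unitSource_upperSource H r).bwdResolvent_le_of_nonneg H ht) H.mul_add_pos.le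
  have delayed_le : upperSol b h θ r t * (1 - upperSol b h θ r (t - h))
      ≤ exp (θ * h) * (M / a * exp (-θ * t)) := by
    have := le_upperSol H hr (t - h)
    rw [mul_sub, neg_mul θ h, sub_neg_eq_add, exp_add] at this
    have := mul_le_of_le_one_left (sub_nonneg.2 (hU.le_one (t - h))) (hU.le_one t)
    linarith
  have reaction_le : κ * (upperSol b h θ r t * (1 - upperSol b h θ r (t - h)))
      ≤ θ * (c + θ) * (M * exp (-θ * t)) :=
    calc _ ≤ κ * (exp (θ * h) * (M / a * exp (-θ * t))) :=
          mul_le_mul_of_nonneg_left delayed_le H.κ_pos.le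
      _ = κ * exp (θ * h) * (M / a * exp (-θ * t)) := by ring
      _ ≤ θ * (c + θ) * a * (M / a * exp (-θ * t)) :=
          mul_le_mul_of_nonneg_right H.κ_mul_exp_le (by positivity)
      _ = θ * (c + θ) * (M * exp (-θ * t)) := by field_simp
  rw [source]
  linarith

lemma source_upperSol_le_exp (H : StepParams b c h θ κ) (hr : 0 < r) (hχ : chi b c h κ r = 0)
    (t : ℝ) : source b c h θ κ (upperSol b h θ r) t
      ≤ (1 - b) * θ * (c + θ - r) * exp (r * t) := by
  have hU := unitFun_upperSol H r
  have gain := linear_source_expGain (b := b) (c := c) (h := h) (κ := κ)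
    (_root_.add_pos hr H.θ_pos).ne'
  rw [hχ, mul_zero, add_zero] at gain
  have reaction_le : upperSol b h θ r t * (1 - upperSol b h θ r (t - h))
      ≤ expGain b h θ r * exp (r * t) :=
    (mul_le_of_le_one_right (hU.nonneg t) (by linarith [hU.nonneg (t - h)])).trans
      (upperSol_le_exp H hr t)
  rw [source, upperSol_sub_shift H, ← gain, add_mul, mul_assoc _ ((1 - b) * θ / (r + θ)),
    mul_assoc κ]
  exact add_le_add
    (mul_le_mul_of_nonneg_left (bwdResolvent_upperSource_le_exp H hr t) H.mul_add_pos.le)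
    (mul_le_mul_of_nonneg_left reaction_le H.κ_pos.le)

lemma fwdResolvent_source_upperSol_le (H : StepParams b c h θ κ) (hr : 0 < r)
    (hχ : chi b c h κ r = 0) (t : ℝ) :
    fwdResolvent (c + θ) (source b c h θ κ (upperSol b h θ r)) t ≤ upperSource b θ r t := by
  have hU := unitFun_upperSol H r
  have r_lt : r < c + θ := by linarith [H.lt_speed_of_chi_nonpos hr hχ.le, H.θ_pos]
  have le_exp : fwdResolvent (c + θ) (source b c h θ κ (upperSol b h θ r)) t
      ≤ (1 - b) * θ * exp (r * t) := by
    have := fwdResolvent_le_exp H.add_pos r_lt (continuous_source hU) (abs_source_le H hU)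
      (source_upperSol_le_exp H hr hχ) t
    rwa [mul_div_cancel_right₀ _ (sub_pos.2 r_lt).ne'] at this
  rw [upperSource, mul_min_of_nonneg _ _ H.source_bound_pos.le, mul_one]
  refine le_min le_exp ?_
  rcases le_total 0 t with ht | ht
  · have := fwdResolvent_le H.add_pos (continuous_source hU) (abs_source_le H hU)
      fun s hs => source_upperSol_le_const H hr (ht.trans hs)
    rwa [mul_right_comm, mul_div_cancel_right₀ _ H.add_pos.ne', mul_comm θ] at this
  · exact le_exp.trans (mul_le_of_le_one_right H.source_bound_pos.le
      (exp_le_one_iff.2 (mul_nonpos_of_nonneg_of_nonpos hr.le ht)))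

lemma upperSol_sub_step (H : StepParams b c h θ κ) (hr : 0 < r) (hχ : chi b c h κ r = 0) :
    MemExpCone θ fun t => upperSol b h θ r t - step b c h θ κ (upperSol b h θ r) t :=
  neutralResolvent_sub_memExpCone H (unitSource_upperSource H r).continuous
    (continuous_fwdResolvent_source H (unitFun_upperSol H r)) (unitSource_upperSource H r).abs_le
    (abs_fwdResolvent_source_le H (unitFun_upperSol H r)) (fwdResolvent_source_upperSol_le H hr hχ)

lemma upperSol_comp_add_sub (H : StepParams b c h θ κ) (hr : 0 < r) {s : ℝ} (hs : 0 ≤ s) :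
    MemExpCone θ fun t => upperSol b h θ r (t + s) - upperSol b h θ r t := by
  have hU := unitSource_upperSource H r
  have cone := neutralResolvent_sub_memExpCone H (f := fun t => upperSource b θ r (t + s))
    (hU.continuous.comp (continuous_add_const s)) hU.continuous (fun t => hU.abs_le (t + s))
    hU.abs_le fun t => mul_le_mul_of_nonneg_left
      (min_le_min_right _ (exp_le_exp.2 (mul_le_mul_of_nonneg_left (le_add_of_nonneg_right hs)
        hr.le))) H.source_bound_pos.le
  rwa [neutralResolvent_comp_add] at cone

end

/-- The parameters `r < m` and `E` of a lower solution: `χ(r) = 0 > χ(m)`, and `E` is large. -/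
structure LowerParams (b c h θ κ r m E : ℝ) : Prop extends StepParams b c h θ κ where
  r_pos : 0 < r
  r_lt_m : r < m
  m_le : m ≤ 2 * r
  chi_r : chi b c h κ r = 0
  chi_m : chi b c h κ m < 0
  one_le_E : 1 ≤ E
  decay : c + θ - r ≤ E * (c + θ - m)
  quadratic : κ * expGain b h θ r ^ 2 ≤ E * ((1 - b) * θ / (m + θ) * -chi b c h κ m)

lemma StepParams.exists_lowerParams {b c h θ κ r m : ℝ} (H : StepParams b c h θ κ) (hr : 0 < r)
    (hrm : r < m) (hm : m ≤ 2 * r) (hχr : chi b c h κ r = 0) (hχm : chi b c h κ m < 0) :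
    ∃ E, LowerParams b c h θ κ r m E := by
  have m_pos : 0 < m := hr.trans hrm
  have decay_pos : 0 < c + θ - m := by linarith [H.lt_speed_of_chi_nonpos m_pos hχm.le, H.θ_pos]
  have quadratic_pos : 0 < (1 - b) * θ / (m + θ) * -chi b c h κ m :=
    mul_pos (div_pos H.source_bound_pos (_root_.add_pos m_pos H.θ_pos)) (neg_pos.2 hχm)
  obtain ⟨E, hE⟩ := ((eventually_ge_atTop (1 : ℝ)).and
    (((tendsto_id.atTop_mul_const decay_pos).eventually_ge_atTop (c + θ - r)).and
      ((tendsto_id.atTop_mul_const quadratic_pos).eventually_ge_atTop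
        (κ * expGain b h θ r ^ 2)))).exists
  exact ⟨E, H, hr, hrm, hm, hχr, hχm, hE.1, hE.2.1, hE.2.2⟩

namespace LowerParams
variable {b c h θ κ r m E : ℝ} (H : LowerParams b c h θ κ r m E)
include H

lemma m_pos : 0 < m := H.r_pos.trans H.r_lt_m

lemma r_lt_add : r < c + θ := by
  linarith [H.lt_speed_of_chi_nonpos H.r_pos H.chi_r.le, H.θ_pos]

lemma m_lt_add : m < c + θ := by
  linarith [H.lt_speed_of_chi_nonpos H.m_pos H.chi_m.le, H.θ_pos]

lemma lowerSource_le_upperSource (t : ℝ) : lowerSource b θ r m E t ≤ upperSource b θ r t := by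
  refine mul_le_mul_of_nonneg_left ?_ H.source_bound_pos.le
  have E_mul_pos : 0 < E * exp (m * t) :=
    mul_pos (zero_lt_one.trans_le H.one_le_E) (exp_pos _)
  refine max_le (le_min (by linarith) ?_) (le_min (exp_pos _).le zero_le_one)
  rcases le_total t 0 with ht | ht
  · linarith [exp_le_one_iff.2 (mul_nonpos_of_nonneg_of_nonpos H.r_pos.le ht)]
  · have exp_le : exp (r * t) ≤ exp (m * t) :=
      exp_le_exp.2 (mul_le_mul_of_nonneg_right H.r_lt_m.le ht)
    linarith [le_mul_of_one_le_left (exp_pos (m * t)).le H.one_le_E]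

lemma unitSource_lowerSource : UnitSource b θ (lowerSource b θ r m E) where
  continuous := by
    unfold lowerSource
    fun_prop
  nonneg t := mul_nonneg H.source_bound_pos.le (le_max_right _ _)
  le t := (H.lowerSource_le_upperSource t).trans ((unitSource_upperSource H.toStepParams r).le t)

lemma unitFun_lowerSol : UnitFun (lowerSol b h θ r m E) :=
  H.unitSource_lowerSource.unitFun_neutralResolvent H.toStepParams

lemma lowerSol_sub_shift (t : ℝ) :
    lowerSol b h θ r m E t - b * lowerSol b h θ r m E (t - h)
      = bwdResolvent θ (lowerSource b θ r m E) t :=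
  neutralResolvent_sub_shift H.toStepParams H.unitSource_lowerSource.continuous
    H.unitSource_lowerSource.abs_le t

lemma upperSol_sub_lowerSol :
    MemExpCone θ fun t => upperSol b h θ r t - lowerSol b h θ r m E t :=
  neutralResolvent_sub_memExpCone H.toStepParams
    (unitSource_upperSource H.toStepParams r).continuous H.unitSource_lowerSource.continuous
    (unitSource_upperSource H.toStepParams r).abs_le H.unitSource_lowerSource.abs_le
    H.lowerSource_le_upperSource

lemma le_bwdResolvent_lowerSource (t : ℝ) :
    (1 - b) * θ / (r + θ) * exp (r * t) - E * ((1 - b) * θ / (m + θ)) * exp (m * t)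
      ≤ bwdResolvent θ (lowerSource b θ r m E) t := by
  rw [← mul_div_assoc]
  refine exp_sub_exp_le_bwdResolvent H.θ_pos (by linarith [H.θ_pos, H.r_pos])
    (by linarith [H.θ_pos, H.m_pos]) H.unitSource_lowerSource.continuous
    H.unitSource_lowerSource.abs_le (fun s => ?_) t
  rw [mul_comm E, mul_assoc _ E, ← mul_sub]
  exact mul_le_mul_of_nonneg_left (le_max_left _ _) H.source_bound_pos.le

lemma le_lowerSol (t : ℝ) :
    expGain b h θ r * exp (r * t) - E * expGain b h θ m * exp (m * t)
      ≤ lowerSol b h θ r m E t := by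
  rw [expGain, expGain, ← mul_div_assoc]
  exact exp_sub_exp_le_neumannSeries H.b_nonneg H.b_lt_one (H.mul_exp_lt_one H.r_pos.le)
    (H.mul_exp_lt_one H.m_pos.le) (abs_bwdResolvent_le H.θ_pos
      H.unitSource_lowerSource.continuous H.unitSource_lowerSource.abs_le)
    H.le_bwdResolvent_lowerSource t

lemma source_lowerSol_nonneg (t : ℝ) : 0 ≤ source b c h θ κ (lowerSol b h θ r m E) t := by
  have hL := H.unitFun_lowerSol
  rw [source, H.lowerSol_sub_shift]
  exact add_nonneg
    (mul_nonneg H.mul_add_pos.le (bwdResolvent_nonneg H.unitSource_lowerSource.nonneg t))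
    (mul_nonneg H.κ_pos.le (mul_nonneg (hL.nonneg t) (sub_nonneg.2 (hL.le_one (t - h)))))

lemma lowerSol_mul_shift_le {t : ℝ} (ht : t ≤ 0) :
    lowerSol b h θ r m E t * lowerSol b h θ r m E (t - h)
      ≤ expGain b h θ r ^ 2 * exp (m * t) := by
  have gain_nonneg := (H.expGain_pos H.r_pos.le).le
  have le_exp : ∀ s ≤ t, lowerSol b h θ r m E s ≤ expGain b h θ r * exp (r * t) := fun s hs =>
    (sub_nonneg.1 (H.upperSol_sub_lowerSol.nonneg s)).trans
      ((upperSol_le_exp H.toStepParams H.r_pos s).trans (mul_le_mul_of_nonneg_left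
        (exp_le_exp.2 (mul_le_mul_of_nonneg_left hs H.r_pos.le)) gain_nonneg))
  calc lowerSol b h θ r m E t * lowerSol b h θ r m E (t - h)
      ≤ expGain b h θ r * exp (r * t) * (expGain b h θ r * exp (r * t)) :=
        mul_le_mul (le_exp t le_rfl) (le_exp _ (sub_le_self t H.h_nonneg))
          (H.unitFun_lowerSol.nonneg _) (mul_nonneg gain_nonneg (exp_pos _).le)
    _ = expGain b h θ r ^ 2 * exp (2 * r * t) := by
        rw [mul_assoc 2, two_mul, exp_add]
        ring
    _ ≤ expGain b h θ r ^ 2 * exp (m * t) :=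
        mul_le_mul_of_nonneg_left (exp_le_exp.2 (mul_le_mul_of_nonpos_right H.m_le ht))
          (sq_nonneg _)

lemma le_source_lowerSol (t : ℝ) :
    (1 - b) * θ * (c + θ - r) * exp (r * t) - (1 - b) * θ * E * (c + θ - m) * exp (m * t)
      ≤ source b c h θ κ (lowerSol b h θ r m E) t := by
  rcases le_total 0 t with ht | ht
  · refine le_trans ?_ (H.source_lowerSol_nonneg t)
    have le_mul : (c + θ - r) * exp (r * t) ≤ E * (c + θ - m) * exp (m * t) :=
      mul_le_mul H.decay (exp_le_exp.2 (mul_le_mul_of_nonneg_right H.r_lt_m.le ht))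
        (exp_pos _).le ((sub_pos.2 H.r_lt_add).le.trans H.decay)
    linarith [mul_le_mul_of_nonneg_left le_mul H.source_bound_pos.le]
  · have gain_r := linear_source_expGain (b := b) (c := c) (h := h) (κ := κ)
      (_root_.add_pos H.r_pos H.θ_pos).ne'
    have gain_m := linear_source_expGain (b := b) (c := c) (h := h) (κ := κ)
      (_root_.add_pos H.m_pos H.θ_pos).ne'
    rw [H.chi_r, mul_zero, add_zero] at gain_r
    have neutral := mul_le_mul_of_nonneg_left (H.le_bwdResolvent_lowerSource t) H.mul_add_pos.le
    have linear := mul_le_mul_of_nonneg_left (H.le_lowerSol t) H.κ_pos.le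
    have delayed := mul_le_mul_of_nonneg_left (H.lowerSol_mul_shift_le ht) H.κ_pos.le
    have quadratic := mul_le_mul_of_nonneg_right H.quadratic (exp_pos (m * t)).le
    rw [source, H.lowerSol_sub_shift]
    linear_combination neutral + linear + delayed + quadratic - exp (r * t) * gain_r
      + E * exp (m * t) * gain_m

lemma lowerSource_le_fwdResolvent (t : ℝ) :
    lowerSource b θ r m E t
      ≤ fwdResolvent (c + θ) (source b c h θ κ (lowerSol b h θ r m E)) t := by
  have hL := H.unitFun_lowerSol
  have le_fwd := exp_sub_exp_le_fwdResolvent H.add_pos H.r_lt_add H.m_lt_add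
    (continuous_source hL) (abs_source_le H.toStepParams hL) H.le_source_lowerSol t
  rw [mul_div_cancel_right₀ _ (sub_pos.2 H.r_lt_add).ne',
    mul_div_cancel_right₀ _ (sub_pos.2 H.m_lt_add).ne', mul_assoc _ E, ← mul_sub] at le_fwd
  rw [lowerSource, mul_max_of_nonneg _ _ H.source_bound_pos.le, mul_zero]
  exact max_le le_fwd (fwdResolvent_nonneg fun s _ => H.source_lowerSol_nonneg s)

lemma step_sub_lowerSol :
    MemExpCone θ fun t => step b c h θ κ (lowerSol b h θ r m E) t - lowerSol b h θ r m E t :=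
  neutralResolvent_sub_memExpCone H.toStepParams
    (continuous_fwdResolvent_source H.toStepParams H.unitFun_lowerSol)
    H.unitSource_lowerSource.continuous
    (abs_fwdResolvent_source_le H.toStepParams H.unitFun_lowerSol)
    H.unitSource_lowerSource.abs_le H.lowerSource_le_fwdResolvent

end LowerParams

/-! ### Monotone solutions of the integrated equation -/

/-- Nondecreasing unit-valued solutions of the profile equation with reaction rate `κ`, in the
integrated form `φ - b φ(· - h) = green φ`. -/
structure IsMonotoneSolution (b c h θ κ : ℝ) (φ : ℝ → ℝ) : Prop where
  unit : UnitFun φ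
  mono : Monotone φ
  eq : ∀ t, φ t - b * φ (t - h) = green b c h θ κ φ t

/-- Nondecreasing solutions of the integrated equation that connect zero to one. -/
structure IsIntegralFront (b c h θ κ : ℝ) (φ : ℝ → ℝ) : Prop
    extends IsMonotoneSolution b c h θ κ φ where
  bot : Tendsto φ atBot (𝓝 0)
  top : Tendsto φ atTop (𝓝 1)

lemma UnitFun.comp_add {φ : ℝ → ℝ} (hφ : UnitFun φ) (s : ℝ) : UnitFun fun t => φ (t + s) :=
  ⟨hφ.continuous.comp (continuous_add_const s), fun _ => hφ.nonneg _, fun _ => hφ.le_one _⟩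

lemma UnitFun.abs_le {φ : ℝ → ℝ} (hφ : UnitFun φ) (t : ℝ) : |φ t| ≤ 1 :=
  _root_.abs_le.2 ⟨by linarith [hφ.nonneg t], hφ.le_one t⟩

section
variable {b c h θ κ : ℝ} {φ : ℝ → ℝ}

lemma tendsto_green {ι : Type*} {l : Filter ι} [l.IsCountablyGenerated] [Nonempty ι] {K : ι → ℝ}
    {Φ : ι → ℝ → ℝ} {T : ι → ℝ} {r : ℝ} (hK : ∀ i, StepParams b c h θ (K i))
    (hΦ : ∀ i, UnitFun (Φ i)) (hκ : Tendsto K l (𝓝 κ))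
    (hlim : ∀ σ, Tendsto (fun i => Φ i (T i + σ)) l (𝓝 (φ (r + σ)))) :
    Tendsto (fun i => green b c h θ (K i) (Φ i) (T i)) l (𝓝 (green b c h θ κ φ r)) := by
  have H := hK (Classical.arbitrary ι)
  refine tendsto_bwdResolvent H.θ_pos (fun i => continuous_fwdResolvent_source (hK i) (hΦ i))
    (fun i => abs_fwdResolvent_source_le (hK i) (hΦ i)) fun σ => ?_
  refine tendsto_fwdResolvent H.add_pos (fun i => continuous_source (hΦ i))
    (fun i => abs_source_le (hK i) (hΦ i)) fun σ' => ?_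
  have current : Tendsto (fun i => Φ i (T i - σ + σ')) l (𝓝 (φ (r - σ + σ'))) := by
    convert hlim (-σ + σ') using 3 <;> ring_nf
  have delayed : Tendsto (fun i => Φ i (T i - σ + σ' - h)) l (𝓝 (φ (r - σ + σ' - h))) := by
    convert hlim (-σ + σ' - h) using 3 <;> ring_nf
  exact ((current.sub (delayed.const_mul b)).const_mul _).add
    (hκ.mul (current.mul (delayed.const_sub 1)))

lemma green_const (H : StepParams b c h θ κ) (L t : ℝ) :
    green b c h θ κ (fun _ => L) t
      = (θ * (c + θ) * (L - b * L) + κ * (L * (1 - L))) / (c + θ) / θ := by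
  rw [green, bwdResolvent_eq_fwdResolvent_neg, ← fwdResolvent_const H.θ_pos _ (-t)]
  congr 1
  exact funext fun _ => fwdResolvent_const H.add_pos _ _

lemma eq_zero_or_one_of_tendsto {l : Filter ℝ} [l.IsCountablyGenerated] [l.NeBot]
    (H : StepParams b c h θ κ) (hφ : UnitFun φ)
    (heq : ∀ t, φ t - b * φ (t - h) = green b c h θ κ φ t)
    (hl : ∀ σ : ℝ, Tendsto (fun t => t + σ) l l) {L : ℝ} (hL : Tendsto φ l (𝓝 L)) :
    L = 0 ∨ L = 1 := by
  have green_tendsto : Tendsto (green b c h θ κ φ) l (𝓝 (green b c h θ κ (fun _ => L) 0)) :=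
    tendsto_green (K := fun _ => κ) (T := id) (fun _ => H) (fun _ => hφ) tendsto_const_nhds
      fun σ => hL.comp (hl σ)
  have neutral_tendsto : Tendsto (fun t => φ t - b * φ (t - h)) l (𝓝 (L - b * L)) :=
    hL.sub ((hL.comp (hl (-h))).const_mul b)
  have limit_eq := tendsto_nhds_unique (neutral_tendsto.congr heq) green_tendsto
  rw [green_const H] at limit_eq
  have θ_ne := H.θ_pos.ne'
  have add_ne := H.add_pos.ne'
  have reaction_eq_zero : κ * (L * (1 - L)) = 0 := by
    field_simp at limit_eq
    linarith
  refine (mul_eq_zero.1 ((mul_eq_zero.1 reaction_eq_zero).resolve_left H.κ_pos.ne')).imp_right ?_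
  exact fun one_sub => (sub_eq_zero.1 one_sub).symm

namespace IsMonotoneSolution

lemma abs_sub_le (H : StepParams b c h θ κ) (hφ : IsMonotoneSolution b c h θ κ φ) (t s : ℝ) :
    |φ t - φ s| ≤ stepLipschitzConst b c θ * |t - s| :=
  abs_sub_le_of_sub_shift_eq_green H hφ.unit hφ.unit.abs_le hφ.eq t s

theorem isIntegralFront (H : StepParams b c h θ κ) (hφ : IsMonotoneSolution b c h θ κ φ) {s t : ℝ}
    (hs : φ s < 1) (ht : 0 < φ t) : IsIntegralFront b c h θ κ φ := by
  have bddAbove : BddAbove (range φ) := ⟨1, forall_mem_range.2 hφ.unit.le_one⟩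
  have bddBelow : BddBelow (range φ) := ⟨0, forall_mem_range.2 hφ.unit.nonneg⟩
  have top := tendsto_atTop_ciSup hφ.mono bddAbove
  have bot := tendsto_atBot_ciInf hφ.mono bddBelow
  have inf_eq_zero : ⨅ i, φ i = 0 :=
    (eq_zero_or_one_of_tendsto H hφ.unit hφ.eq
      (fun σ => tendsto_atBot_add_const_right _ σ tendsto_id) bot).resolve_right
        ((ciInf_le bddBelow s).trans_lt hs).ne
  have sup_eq_one : ⨆ i, φ i = 1 :=
    (eq_zero_or_one_of_tendsto H hφ.unit hφ.eq
      (fun σ => tendsto_atTop_add_const_right _ σ tendsto_id) top).resolve_left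
        (ht.trans_le (le_ciSup bddAbove t)).ne'
  exact ⟨hφ, inf_eq_zero ▸ bot, sup_eq_one ▸ top⟩

theorem of_tendsto {K : ℕ → ℝ} {Φ : ℕ → ℝ → ℝ} (hK : ∀ n, StepParams b c h θ (K n))
    (hΦ : ∀ n, IsMonotoneSolution b c h θ (K n) (Φ n)) (hκ : Tendsto K atTop (𝓝 κ))
    (hlim : ∀ t, Tendsto (fun n => Φ n t) atTop (𝓝 (φ t))) :
    IsMonotoneSolution b c h θ κ φ where
  unit :=
    { continuous := (LipschitzWith.of_dist_le' fun t s =>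
        le_of_tendsto' ((hlim t).sub (hlim s)).abs fun n => (hΦ n).abs_sub_le (hK n) t s).continuous
      nonneg := fun t => ge_of_tendsto' (hlim t) fun n => (hΦ n).unit.nonneg t
      le_one := fun t => le_of_tendsto' (hlim t) fun n => (hΦ n).unit.le_one t }
  mono := fun s t hst => le_of_tendsto_of_tendsto' (hlim s) (hlim t) fun n => (hΦ n).mono hst
  eq := fun t => tendsto_nhds_unique ((hlim t).sub ((hlim (t - h)).const_mul b))
    ((tendsto_green (T := fun _ => t) hK (fun n => (hΦ n).unit) hκ fun _ => hlim _).congr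
      fun n => ((hΦ n).eq t).symm)

end IsMonotoneSolution

namespace IsIntegralFront

lemma comp_add (hφ : IsIntegralFront b c h θ κ φ) (s : ℝ) :
    IsIntegralFront b c h θ κ fun t => φ (t + s) where
  unit := hφ.unit.comp_add s
  mono := hφ.mono.comp (add_left_mono (a := s))
  eq t := by
    rw [green_comp_add, sub_add_eq_add_sub]
    exact hφ.eq (t + s)
  bot := hφ.bot.comp (tendsto_atBot_add_const_right _ s tendsto_id)
  top := hφ.top.comp (tendsto_atTop_add_const_right _ s tendsto_id)

lemma exists_eq_half (hφ : IsIntegralFront b c h θ κ φ) : ∃ t, φ t = 1 / 2 := by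
  obtain ⟨s, hs⟩ := (hφ.bot.eventually_lt_const (by norm_num : (0 : ℝ) < 1 / 2)).exists
  obtain ⟨t, ht⟩ := (hφ.top.eventually_const_lt (by norm_num : (1 / 2 : ℝ) < 1)).exists
  exact mem_range_of_exists_le_of_exists_ge hφ.unit.continuous ⟨s, hs.le⟩ ⟨t, ht.le⟩

end IsIntegralFront

end

/-! ### Existence of integral fronts -/

lemma MemExpCone.add {θ : ℝ} {x y : ℝ → ℝ} (hx : MemExpCone θ x) (hy : MemExpCone θ y) :
    MemExpCone θ fun t => x t + y t :=
  ⟨fun t => add_nonneg (hx.nonneg t) (hy.nonneg t), by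
    simpa only [mul_add] using hx.monotone.add hy.monotone⟩

/-- The properties shared by all iterates of `step`: unit-valued supersolutions, nondecreasing
with respect to translation and above `lo`, where all comparisons are made in the order of the
cone. -/
structure IsSupersolution (b c h θ κ : ℝ) (lo φ : ℝ → ℝ) : Prop where
  unit : UnitFun φ
  sub_lower : MemExpCone θ fun t => φ t - lo t
  sub_step : MemExpCone θ fun t => φ t - step b c h θ κ φ t
  comp_add_sub : ∀ s, 0 ≤ s → MemExpCone θ fun t => φ (t + s) - φ t

section
variable {b c h θ κ : ℝ} {lo φ : ℝ → ℝ}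

lemma IsSupersolution.step (H : StepParams b c h θ κ) (hlo : UnitFun lo)
    (hsub : MemExpCone θ fun t => step b c h θ κ lo t - lo t)
    (hφ : IsSupersolution b c h θ κ lo φ) :
    IsSupersolution b c h θ κ lo (step b c h θ κ φ) := by
  have sub_lower : MemExpCone θ fun t => NeutralKPP.step b c h θ κ φ t - lo t := by
    simpa using (step_sub_memExpCone H hφ.unit hlo hφ.sub_lower).add hsub
  have unit : UnitFun (NeutralKPP.step b c h θ κ φ) :=
    ⟨continuous_step H hφ.unit,
      fun t => (hlo.nonneg t).trans (sub_nonneg.1 (sub_lower.nonneg t)),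
      fun t => (sub_nonneg.1 (hφ.sub_step.nonneg t)).trans (hφ.unit.le_one t)⟩
  refine ⟨unit, sub_lower, step_sub_memExpCone H hφ.unit unit hφ.sub_step, fun s hs => ?_⟩
  simpa only [step_comp_add] using
    step_sub_memExpCone H (hφ.unit.comp_add s) hφ.unit (hφ.comp_add_sub s hs)

lemma IsSupersolution.iterate (H : StepParams b c h θ κ) (hlo : UnitFun lo)
    (hsub : MemExpCone θ fun t => NeutralKPP.step b c h θ κ lo t - lo t)
    (hφ : IsSupersolution b c h θ κ lo φ) (n : ℕ) :
    IsSupersolution b c h θ κ lo ((NeutralKPP.step b c h θ κ)^[n] φ) := by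
  induction n with
  | zero => exact hφ
  | succ n ih =>
    rw [Function.iterate_succ_apply']
    exact ih.step H hlo hsub

theorem IsSupersolution.exists_isMonotoneSolution (H : StepParams b c h θ κ) (hlo : UnitFun lo)
    (hsub : MemExpCone θ fun t => NeutralKPP.step b c h θ κ lo t - lo t) {up : ℝ → ℝ}
    (hup : IsSupersolution b c h θ κ lo up) :
    ∃ φ, IsMonotoneSolution b c h θ κ φ ∧ (∀ t, lo t ≤ φ t) ∧ ∀ t, φ t ≤ up t := by
  set Φ : ℕ → ℝ → ℝ := fun n => (NeutralKPP.step b c h θ κ)^[n] up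
  have hΦ : ∀ n, IsSupersolution b c h θ κ lo (Φ n) := hup.iterate H hlo hsub
  have Φ_succ : ∀ n, Φ (n + 1) = NeutralKPP.step b c h θ κ (Φ n) := fun n =>
    Function.iterate_succ_apply' _ _ _
  have anti : ∀ t, Antitone fun n => Φ n t := fun t => antitone_nat_of_succ_le fun n => by
    rw [Φ_succ]
    exact sub_nonneg.1 ((hΦ n).sub_step.nonneg t)
  have hlim : ∀ t, Tendsto (fun n => Φ n t) atTop (𝓝 (⨅ n, Φ n t)) := fun t =>
    tendsto_atTop_ciInf (anti t) ⟨0, forall_mem_range.2 fun n => (hΦ n).unit.nonneg t⟩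
  have hlim_succ : ∀ t, Tendsto (fun n => NeutralKPP.step b c h θ κ (Φ n) t) atTop
      (𝓝 (⨅ n, Φ n t)) := fun t => by
    simpa only [Function.comp_def, Φ_succ] using (hlim t).comp (tendsto_add_atTop_nat 1)
  have step_lipschitz : ∀ n t s, |NeutralKPP.step b c h θ κ (Φ n) t
      - NeutralKPP.step b c h θ κ (Φ n) s| ≤ stepLipschitzConst b c θ * |t - s| := fun n =>
    abs_sub_le_of_sub_shift_eq_green H (hΦ n).unit (abs_step_le H (hΦ n).unit)
      (step_sub_shift H (hΦ n).unit)
  refine ⟨fun t => ⨅ n, Φ n t, ⟨⟨?_, ?_, ?_⟩, fun s t hst => ?_, fun t => ?_⟩, ?_, ?_⟩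
  · exact (LipschitzWith.of_dist_le' fun t s =>
      le_of_tendsto' ((hlim_succ t).sub (hlim_succ s)).abs fun n => step_lipschitz n t s).continuous
  · exact fun t => ge_of_tendsto' (hlim t) fun n => (hΦ n).unit.nonneg t
  · exact fun t => le_of_tendsto' (hlim t) fun n => (hΦ n).unit.le_one t
  · refine le_of_tendsto_of_tendsto' (hlim s) (hlim t) fun n => ?_
    have := ((hΦ n).comp_add_sub (t - s) (sub_nonneg.2 hst)).nonneg s
    rwa [add_sub_cancel, sub_nonneg] at this
  · exact tendsto_nhds_unique ((hlim_succ t).sub ((hlim_succ (t - h)).const_mul b))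
      ((tendsto_green (T := fun _ => t) (fun _ => H) (fun n => (hΦ n).unit) tendsto_const_nhds
        fun _ => hlim _).congr fun n => (step_sub_shift H (hΦ n).unit t).symm)
  · exact fun t => ge_of_tendsto' (hlim t) fun n => sub_nonneg.1 ((hΦ n).sub_lower.nonneg t)
  · exact fun t => le_of_tendsto' (hlim t) fun n => anti t (Nat.zero_le n)

end

section
variable {b c h θ κ r m E : ℝ}

lemma LowerParams.isSupersolution_upperSol (H : LowerParams b c h θ κ r m E) :
    IsSupersolution b c h θ κ (lowerSol b h θ r m E) (upperSol b h θ r) where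
  unit := unitFun_upperSol H.toStepParams r
  sub_lower := H.upperSol_sub_lowerSol
  sub_step := upperSol_sub_step H.toStepParams H.r_pos H.chi_r
  comp_add_sub _ hs := upperSol_comp_add_sub H.toStepParams H.r_pos hs

lemma exists_upperSol_lt_one (H : StepParams b c h θ κ) (hr : 0 < r) :
    ∃ t, upperSol b h θ r t < 1 := by
  have bound_tendsto : Tendsto (fun t => expGain b h θ r * exp (r * t)) atBot (𝓝 0) := by
    simpa using (tendsto_exp_mul_atBot hr).const_mul (expGain b h θ r)
  obtain ⟨t, ht⟩ := (bound_tendsto.eventually_lt_const zero_lt_one).exists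
  exact ⟨t, (upperSol_le_exp H hr t).trans_lt ht⟩

lemma LowerParams.exists_lowerSol_pos (H : LowerParams b c h θ κ r m E) :
    ∃ t, 0 < lowerSol b h θ r m E t := by
  have ratio_tendsto :
      Tendsto (fun t => E * expGain b h θ m * exp ((m - r) * t)) atBot (𝓝 0) := by
    simpa using (tendsto_exp_mul_atBot (sub_pos.2 H.r_lt_m)).const_mul (E * expGain b h θ m)
  obtain ⟨t, ht⟩ := (ratio_tendsto.eventually_lt_const (H.expGain_pos H.r_pos.le)).exists
  refine ⟨t, lt_of_lt_of_le ?_ (H.le_lowerSol t)⟩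
  have exp_eq : exp (m * t) = exp ((m - r) * t) * exp (r * t) := by
    rw [← exp_add]
    ring_nf
  rw [exp_eq, ← mul_assoc, ← sub_mul]
  exact mul_pos (sub_pos.2 ht) (exp_pos _)

theorem exists_isIntegralFront_of_chi_neg (H : StepParams b c h θ κ) (hr : 0 < r) (hrm : r < m)
    (hm : m ≤ 2 * r) (hχr : chi b c h κ r = 0) (hχm : chi b c h κ m < 0) :
    ∃ φ, IsIntegralFront b c h θ κ φ := by
  obtain ⟨E, L⟩ := H.exists_lowerParams hr hrm hm hχr hχm
  obtain ⟨φ, hφ, lower_le, le_upper⟩ := L.isSupersolution_upperSol.exists_isMonotoneSolution H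
    L.unitFun_lowerSol L.step_sub_lowerSol
  obtain ⟨s, hs⟩ := exists_upperSol_lt_one H hr
  obtain ⟨t, ht⟩ := L.exists_lowerSol_pos
  exact ⟨φ, hφ.isIntegralFront H ((le_upper s).trans_lt hs) (ht.trans_le (lower_le t))⟩

lemma continuousOn_chi (hb0 : 0 ≤ b) (hb1 : b < 1) (hh : 0 ≤ h) :
    ContinuousOn (chi b c h κ) (Ici 0) := by
  unfold chi
  refine ContinuousOn.add (by fun_prop) (ContinuousOn.div (by fun_prop) (by fun_prop) ?_)
  intro z hz
  have exp_le : exp (-(z * h)) ≤ 1 := exp_le_one_iff.2 (neg_nonpos.2 (mul_nonneg hz hh))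
  linarith [mul_le_of_le_one_right hb0 exp_le]

lemma exists_chi_eq_zero_and_neg (hb0 : 0 ≤ b) (hb1 : b < 1) (hh : 0 ≤ h) (hκ : 0 < κ) {z : ℝ}
    (hz : 0 < z) (hχ : chi b c h κ z < 0) :
    ∃ r m, 0 < r ∧ r < m ∧ m ≤ 2 * r ∧ chi b c h κ r = 0 ∧ chi b c h κ m < 0 := by
  have hcont : ContinuousOn (chi b c h κ) (Icc 0 z) :=
    (continuousOn_chi hb0 hb1 hh).mono Icc_subset_Ici_self
  have chi_zero_pos : 0 < chi b c h κ 0 := by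
    simpa [chi] using div_pos hκ (sub_pos.2 hb1)
  have nonneg_compact : IsCompact (Icc 0 z ∩ chi b c h κ ⁻¹' Ici 0) :=
    isCompact_Icc.of_isClosed_subset
      (hcont.preimage_isClosed_of_isClosed isClosed_Icc isClosed_Ici) inter_subset_left
  obtain ⟨r, ⟨hr, chi_r_nonneg⟩, r_greatest⟩ :=
    nonneg_compact.exists_isGreatest ⟨0, ⟨le_rfl, hz.le⟩, chi_zero_pos.le⟩
  have chi_neg : ∀ x, r < x → x ≤ z → chi b c h κ x < 0 := fun x hx hxz =>
    not_le.1 fun hcon => hx.not_ge (r_greatest ⟨⟨hr.1.trans hx.le, hxz⟩, hcon⟩)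
  have r_lt_z : r < z := hr.2.lt_of_ne fun heq => hχ.not_ge (heq ▸ chi_r_nonneg)
  have chi_r : chi b c h κ r = 0 := by
    obtain ⟨x, hx, chi_x⟩ := intermediate_value_Icc' r_lt_z.le
      (hcont.mono (Icc_subset_Icc_left hr.1)) ⟨hχ.le, chi_r_nonneg⟩
    have x_le_r : x ≤ r := r_greatest ⟨⟨hr.1.trans hx.1, hx.2⟩, chi_x.ge⟩
    rwa [← le_antisymm x_le_r hx.1]
  have r_pos : 0 < r := hr.1.lt_of_ne fun heq => chi_zero_pos.ne' (heq ▸ chi_r)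
  have r_lt_min : r < min z (2 * r) := lt_min r_lt_z (by linarith)
  exact ⟨r, min z (2 * r), r_pos, r_lt_min, min_le_right _ _, chi_r,
    chi_neg _ r_lt_min (min_le_left _ _)⟩

lemma StepParams.of_le_one (H : StepParams b c h θ 1) (hκ0 : 0 < κ) (hκ1 : κ ≤ 1) :
    StepParams b c h θ κ :=
  { H with
    κ_pos := hκ0
    κ_le_one := hκ1
    κ_mul_exp_le := (mul_le_mul_of_nonneg_right hκ1 (exp_pos _).le).trans H.κ_mul_exp_le }

lemma exists_isIntegralFront_of_lt_one (H : StepParams b c h θ 1) (hκ0 : 0 < κ) (hκ1 : κ < 1)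
    {z : ℝ} (hz : 0 < z) (hχ : chi b c h 1 z = 0) :
    ∃ φ, IsIntegralFront b c h θ κ φ := by
  have chi_neg : chi b c h κ z < 0 := by
    have := div_lt_div_of_pos_right hκ1 (sub_pos.2 (H.mul_exp_lt_one hz.le))
    unfold chi at hχ ⊢
    linarith
  obtain ⟨r, m, hr, hrm, hm, hχr, hχm⟩ :=
    exists_chi_eq_zero_and_neg H.b_nonneg H.b_lt_one H.h_nonneg hκ0 hz chi_neg
  exact exists_isIntegralFront_of_chi_neg (H.of_le_one hκ0 hκ1.le) hr hrm hm hχr hχm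

end

lemma cauchySeq_of_lipschitz_of_rat {Φ : ℕ → ℝ → ℝ} {L : ℝ}
    (hL : ∀ n t s, |Φ n t - Φ n s| ≤ L * |t - s|) (hq : ∀ q : ℚ, CauchySeq fun n => Φ n q)
    (t : ℝ) : CauchySeq fun n => Φ n t := by
  have L_nonneg : 0 ≤ L := by simpa using (abs_nonneg _).trans (hL 0 1 0)
  refine Metric.cauchySeq_iff'.2 fun ε hε => ?_
  have δ_pos : 0 < ε / (4 * (L + 1)) := by positivity
  obtain ⟨q, t_lt_q, q_lt⟩ := exists_rat_btwn (lt_add_of_pos_right t δ_pos)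
  have close : L * |t - q| ≤ ε / 4 :=
    calc L * |t - q| ≤ (L + 1) * (ε / (4 * (L + 1))) :=
          mul_le_mul (by linarith) (by rw [abs_of_neg (by linarith)]; linarith) (abs_nonneg _)
            (by linarith)
      _ = ε / 4 := by field_simp
  obtain ⟨N, hN⟩ := Metric.cauchySeq_iff'.1 (hq q) (ε / 4) (by positivity)
  refine ⟨N, fun n hn => ?_⟩
  have at_q := hN n hn
  have near_n := abs_le.1 ((hL n t q).trans close)
  have near_N := abs_le.1 ((hL N t q).trans close)
  rw [Real.dist_eq, abs_lt] at at_q ⊢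
  constructor <;> linarith

theorem exists_subseq_tendsto_of_lipschitz {Φ : ℕ → ℝ → ℝ} {L : ℝ} (hΦ0 : ∀ n t, 0 ≤ Φ n t)
    (hΦ1 : ∀ n t, Φ n t ≤ 1) (hL : ∀ n t s, |Φ n t - Φ n s| ≤ L * |t - s|) :
    ∃ (k : ℕ → ℕ) (φ : ℝ → ℝ), StrictMono k ∧
      ∀ t, Tendsto (fun n => Φ (k n) t) atTop (𝓝 (φ t)) := by
  have cube_compact : IsCompact (univ.pi fun _ : ℚ => Icc (0 : ℝ) 1) :=
    isCompact_univ_pi fun _ => isCompact_Icc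
  obtain ⟨ψ, -, k, hk, hψ⟩ := cube_compact.tendsto_subseq (x := fun n (q : ℚ) => Φ n q)
    fun n q _ => ⟨hΦ0 n q, hΦ1 n q⟩
  have cauchy := cauchySeq_of_lipschitz_of_rat (fun n => hL (k n))
    fun q => (tendsto_pi_nhds.1 hψ q).cauchySeq
  choose φ hφ using fun t => cauchySeq_tendsto_of_complete (cauchy t)
  exact ⟨k, φ, hk, hφ⟩

theorem exists_isIntegralFront {b c h θ z : ℝ} (H : StepParams b c h θ 1) (hz : 0 < z)
    (hχ : chi b c h 1 z = 0) : ∃ φ, IsIntegralFront b c h θ 1 φ := by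
  obtain ⟨K, -, hK, K_tendsto⟩ := exists_seq_strictMono_tendsto' (zero_lt_one (α := ℝ))
  have HK : ∀ n, StepParams b c h θ (K n) := fun n => H.of_le_one (hK n).1 (hK n).2.le
  have approximate : ∀ n, ∃ φ, IsIntegralFront b c h θ (K n) φ ∧ φ 0 = 1 / 2 := fun n => by
    obtain ⟨φ, hφ⟩ := exists_isIntegralFront_of_lt_one H (hK n).1 (hK n).2 hz hχ
    obtain ⟨t, ht⟩ := hφ.exists_eq_half
    exact ⟨fun s => φ (s + t), hφ.comp_add t, (congrArg φ (zero_add t)).trans ht⟩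
  choose Φ hΦ Φ_zero using approximate
  obtain ⟨k, φ, hk, hlim⟩ := exists_subseq_tendsto_of_lipschitz (fun n => (hΦ n).unit.nonneg)
    (fun n => (hΦ n).unit.le_one) fun n => (hΦ n).toIsMonotoneSolution.abs_sub_le (HK n)
  have hφ : IsMonotoneSolution b c h θ 1 φ :=
    .of_tendsto (fun n => HK (k n)) (fun n => (hΦ (k n)).toIsMonotoneSolution)
      (K_tendsto.comp hk.tendsto_atTop) hlim
  have φ_zero : φ 0 = 1 / 2 :=
    tendsto_nhds_unique (hlim 0) (by simp only [Φ_zero]; exact tendsto_const_nhds)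
  exact ⟨φ, hφ.isIntegralFront H (s := 0) (t := 0) (by norm_num [φ_zero]) (by norm_num [φ_zero])⟩

/-! ### Wave profiles -/

/-- The profiles `φ` of monotone travelling fronts, where `h = c τ`. -/
structure IsProfile (b c h : ℝ) (φ : ℝ → ℝ) : Prop where
  mono : Monotone φ
  bot : Tendsto φ atBot (𝓝 0)
  top : Tendsto φ atTop (𝓝 1)
  contDiff : ContDiff ℝ 2 fun r => φ r - b * φ (r - h)
  eq : ∀ r, deriv (deriv fun r => φ r - b * φ (r - h)) r
    - c * deriv (fun r => φ r - b * φ (r - h)) r + φ r * (1 - φ (r - h)) = 0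

lemma isMonotoneTravelingFront_iff (b τ c : ℝ) (u : ℝ → ℝ → ℝ) :
    IsMonotoneTravelingFront b τ c u ↔
      ∃ φ, IsProfile b c (c * τ) φ ∧ ∀ t x, u t x = φ (x + c * t) := by
  constructor
  · rintro ⟨hsol, φ, hu, hmono, hcd, hbot, htop⟩
    obtain rfl : u = fun t x => φ (x + c * t) := funext₂ hu
    exact ⟨φ, ⟨hmono, hbot, htop, hcd,
      (isNeutralKPPFisherSolution_iff_profile b τ c φ hcd).1 hsol⟩, hu⟩
  · rintro ⟨φ, hφ, hu⟩
    obtain rfl : u = fun t x => φ (x + c * t) := funext₂ hu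
    exact ⟨(isNeutralKPPFisherSolution_iff_profile b τ c φ hφ.contDiff).2 hφ.eq, φ, hu,
      hφ.mono, hφ.contDiff, hφ.bot, hφ.top⟩

lemma contDiff_two_of_hasDerivAt {v v' v'' : ℝ → ℝ} (hv : ∀ t, HasDerivAt v (v' t) t)
    (hv' : ∀ t, HasDerivAt v' (v'' t) t) (hcont : Continuous v'') : ContDiff ℝ 2 v := by
  have hdv : deriv v = v' := funext fun t => (hv t).deriv
  have hdv' : deriv v' = v'' := funext fun t => (hv' t).deriv
  rw [show (2 : WithTop ℕ∞) = 1 + 1 by norm_num, contDiff_succ_iff_deriv, hdv,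
    contDiff_one_iff_deriv, hdv']
  exact ⟨fun t => (hv t).differentiableAt, by simp, fun t => (hv' t).differentiableAt, hcont⟩

lemma IsIntegralFront.isProfile {b c h θ : ℝ} {φ : ℝ → ℝ} (H : StepParams b c h θ 1)
    (hφ : IsIntegralFront b c h θ 1 φ) : IsProfile b c h φ := by
  set w := fwdResolvent (c + θ) (source b c h θ 1 φ)
  set v := green b c h θ 1 φ
  have hv_eq : (fun r => φ r - b * φ (r - h)) = v := funext hφ.eq
  have hv : ∀ t, HasDerivAt v (w t - θ * v t) t := hasDerivAt_green H hφ.unit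
  have hv' : ∀ t, HasDerivAt (fun t => w t - θ * v t)
      (((c + θ) * w t - source b c h θ 1 φ t) - θ * (w t - θ * v t)) t := fun t =>
    (hasDerivAt_fwdResolvent_source H hφ.unit t).sub ((hv t).const_mul θ)
  have hw_cont : Continuous w := continuous_fwdResolvent_source H hφ.unit
  have hv_cont : Continuous v := continuous_green H hφ.unit
  have hsource_cont : Continuous (source b c h θ 1 φ) := continuous_source hφ.unit
  refine ⟨hφ.mono, hφ.bot, hφ.top, ?_, fun r => ?_⟩
  · rw [hv_eq]
    exact contDiff_two_of_hasDerivAt hv hv' (by fun_prop)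
  · rw [hv_eq, funext fun t => (hv t).deriv, (hv' r).deriv, source]
    linear_combination -(θ * (c + θ)) * hφ.eq r

lemma IsProfile.comp_add {b c h : ℝ} {φ : ℝ → ℝ} (hφ : IsProfile b c h φ) (s : ℝ) :
    IsProfile b c h fun t => φ (t + s) := by
  set v := fun r => φ r - b * φ (r - h) with hv
  have hv_eq : (fun r => φ (r + s) - b * φ (r - h + s)) = fun r => v (r + s) := by
    simp only [hv, sub_add_eq_add_sub]
  have hdv : deriv (fun r => v (r + s)) = fun r => deriv v (r + s) :=
    funext fun r => deriv_comp_add_const v s r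
  refine ⟨fun x y hxy => hφ.mono (by gcongr), hφ.bot.comp (tendsto_atBot_add_const_right _ s
    tendsto_id), hφ.top.comp (tendsto_atTop_add_const_right _ s tendsto_id), ?_, fun r => ?_⟩
  · rw [hv_eq]
    exact hφ.contDiff.comp (contDiff_id.add contDiff_const)
  · rw [hv_eq, hdv, deriv_comp_add_const, sub_add_eq_add_sub r h s]
    exact hφ.eq (r + s)

/-! ### Solutions of second order differential inequalities -/

lemma nonneg_of_hasDerivAt_le_of_le {f f' : ℝ → ℝ} {t m C : ℝ}
    (hf : ∀ s, t ≤ s → HasDerivAt f (f' s) s) (hm : ∀ s, t ≤ s → f' s ≤ m)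
    (hC : ∀ s, t ≤ s → C ≤ f s) : 0 ≤ m := by
  by_contra! hneg
  have hanti : AntitoneOn (fun s => f s - m * s) (Ici t) :=
    antitoneOn_of_hasDerivAt_nonpos (convex_Ici t)
      (fun s hs => (hf s hs).sub ((hasDerivAt_id s).const_mul m))
      fun s hs => by linarith [hm s hs]
  have hpos : 0 ≤ (f t - C + 1) / (-m) :=
    div_nonneg (by linarith [hC t le_rfl]) (neg_nonneg.2 hneg.le)
  set s := t + (f t - C + 1) / (-m) with hs
  have hts : t ≤ s := le_add_of_nonneg_right hpos
  have hms : m * s = m * t - (f t - C + 1) := by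
    rw [hs]
    field_simp [hneg.ne]
    ring
  have := hanti self_mem_Ici (mem_Ici.2 hts) hts
  dsimp only at this
  linarith [hC s hts]

lemma nonpos_of_le_hasDerivAt_of_le {f f' : ℝ → ℝ} {t m C : ℝ}
    (hf : ∀ s, s ≤ t → HasDerivAt f (f' s) s) (hm : ∀ s, s ≤ t → m ≤ f' s)
    (hC : ∀ s, s ≤ t → C ≤ f s) : m ≤ 0 := by
  have hneg : ∀ s, -t ≤ s → -s ≤ t := fun s hs => neg_le.1 hs
  refine neg_nonneg.1 (nonneg_of_hasDerivAt_le_of_le (f := fun s => f (-s)) (t := -t) (C := C)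
    (fun s hs => ?_) (fun s hs => neg_le_neg (hm _ (hneg s hs))) fun s hs => hC _ (hneg s hs))
  simpa [Function.comp_def] using (hf _ (hneg s hs)).scomp s (hasDerivAt_neg s)

section
variable {v v' v'' : ℝ → ℝ} {c : ℝ}

lemma nonneg_deriv_of_deriv2_le {C : ℝ} (hc : 0 ≤ c) (hv : ∀ t, HasDerivAt v (v' t) t)
    (hv' : ∀ t, HasDerivAt v' (v'' t) t) (hle : ∀ t, v'' t ≤ c * v' t) (hC : ∀ t, C ≤ v t)
    (t : ℝ) : 0 ≤ v' t := by
  by_contra! hneg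
  have hanti : Antitone fun s => exp (-c * s) * v' s :=
    antitone_of_hasDerivAt_nonpos (fun s => hasDerivAt_exp_mul_mul (-c) (hv' s)) fun s =>
      mul_nonpos_of_nonneg_of_nonpos (exp_pos _).le (by linarith [hle s])
  refine hneg.not_ge (nonneg_of_hasDerivAt_le_of_le (t := t) (fun s _ => hv s) (fun s hs => ?_)
    fun s _ => hC s)
  refine le_of_mul_le_mul_left ?_ (exp_pos (-c * s))
  calc exp (-c * s) * v' s ≤ exp (-c * t) * v' t := hanti hs
    _ ≤ exp (-c * s) * v' t :=
      mul_le_mul_of_nonpos_right (exp_le_exp.2 (by nlinarith)) hneg.le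

lemma deriv_le_mul_of_deriv2_le (hc : 0 ≤ c) (hv : ∀ t, HasDerivAt v (v' t) t)
    (hv' : ∀ t, HasDerivAt v' (v'' t) t) (hle : ∀ t, v'' t ≤ c * v' t) (hv0 : ∀ t, 0 ≤ v t)
    (t : ℝ) : v' t ≤ c * v t := by
  have hanti : Antitone fun s => v' s - c * v s :=
    antitone_of_hasDerivAt_nonpos (fun s => (hv' s).sub ((hv s).const_mul c)) fun s =>
      sub_nonpos.2 (hle s)
  refine sub_nonpos.1 (nonpos_of_le_hasDerivAt_of_le (t := t) (fun s _ => hv s) (fun s hs => ?_)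
    fun s _ => hv0 s)
  calc v' t - c * v t ≤ v' s - c * v s := hanti hs
    _ ≤ v' s := sub_le_self _ (mul_nonneg hc (hv0 s))

lemma pos_of_deriv_le_mul (hv : ∀ t, HasDerivAt v (v' t) t) (hle : ∀ t, v' t ≤ c * v t)
    {s t : ℝ} (hst : t ≤ s) (hs : 0 < v s) : 0 < v t := by
  have hanti : Antitone fun s => exp (-c * s) * v s :=
    antitone_of_hasDerivAt_nonpos (fun s => hasDerivAt_exp_mul_mul (-c) (hv s)) fun s =>
      mul_nonpos_of_nonneg_of_nonpos (exp_pos _).le (by linarith [hle s])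
  exact pos_of_mul_pos_right ((mul_pos (exp_pos _) hs).trans_le (hanti hst)) (exp_pos _).le

end

/-! ### Basic properties of fronts -/

/-- A profile bundled with the standing assumptions on the parameters. -/
structure Front (b c h : ℝ) where
  φ : ℝ → ℝ
  isProfile : IsProfile b c h φ
  b_nonneg : 0 ≤ b
  b_lt_one : b < 1
  c_pos : 0 < c
  h_nonneg : 0 ≤ h

namespace Front
variable {b c h : ℝ}

/-- The neutral part of the profile. -/
def v (F : Front b c h) (t : ℝ) : ℝ := F.φ t - b * F.φ (t - h)

/-- The derivative of the neutral part. -/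
def v' (F : Front b c h) : ℝ → ℝ := deriv F.v

/-- The derivative of the profile. -/
def φ' (F : Front b c h) : ℝ → ℝ := deriv F.φ

variable (F : Front b c h)
include F

lemma one_sub_b_pos : 0 < 1 - b := sub_pos.2 F.b_lt_one

lemma v_eq (t : ℝ) : F.v t = F.φ t - b * F.φ (t - h) := rfl

lemma nonneg (t : ℝ) : 0 ≤ F.φ t := F.isProfile.mono.le_of_tendsto F.isProfile.bot t

lemma le_one (t : ℝ) : F.φ t ≤ 1 := F.isProfile.mono.ge_of_tendsto F.isProfile.top t

lemma abs_φ_le_one (t : ℝ) : |F.φ t| ≤ 1 := by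
  rw [abs_of_nonneg (F.nonneg t)]
  exact F.le_one t

lemma shift_le (t : ℝ) : F.φ (t - h) ≤ F.φ t := F.isProfile.mono (sub_le_self t F.h_nonneg)

lemma reaction_nonneg (t : ℝ) : 0 ≤ F.φ t * (1 - F.φ (t - h)) :=
  mul_nonneg (F.nonneg t) (sub_nonneg.2 (F.le_one _))

lemma mul_le_v (t : ℝ) : (1 - b) * F.φ t ≤ F.v t := by
  rw [F.v_eq]
  linarith [mul_le_mul_of_nonneg_left (F.shift_le t) F.b_nonneg]

lemma v_le (t : ℝ) : F.v t ≤ F.φ t := by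
  rw [F.v_eq]
  linarith [mul_nonneg F.b_nonneg (F.nonneg (t - h))]

lemma v_nonneg (t : ℝ) : 0 ≤ F.v t :=
  (mul_nonneg F.one_sub_b_pos.le (F.nonneg t)).trans (F.mul_le_v t)

lemma v_le_one (t : ℝ) : F.v t ≤ 1 := (F.v_le t).trans (F.le_one t)

lemma φ_le (t : ℝ) : F.φ t ≤ F.v t / (1 - b) := by
  rw [le_div_iff₀' F.one_sub_b_pos]
  exact F.mul_le_v t

lemma hasDerivAt_v (t : ℝ) : HasDerivAt F.v (F.v' t) t :=
  (F.isProfile.contDiff.differentiable (by norm_num) t).hasDerivAt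

lemma hasDerivAt_v' (t : ℝ) :
    HasDerivAt F.v' (c * F.v' t - F.φ t * (1 - F.φ (t - h))) t := by
  have hcd : ContDiff ℝ 2 F.v := F.isProfile.contDiff
  rw [show (2 : WithTop ℕ∞) = 1 + 1 by norm_num, contDiff_succ_iff_deriv] at hcd
  refine (hcd.2.2.differentiable (by norm_num) t).hasDerivAt.congr_deriv ?_
  have : deriv (deriv F.v) t - c * F.v' t + F.φ t * (1 - F.φ (t - h)) = 0 := F.isProfile.eq t
  linarith

lemma v'_nonneg (t : ℝ) : 0 ≤ F.v' t :=
  nonneg_deriv_of_deriv2_le F.c_pos.le F.hasDerivAt_v F.hasDerivAt_v'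
    (fun s => sub_le_self _ (F.reaction_nonneg s)) F.v_nonneg t

lemma v'_le (t : ℝ) : F.v' t ≤ c * F.v t :=
  deriv_le_mul_of_deriv2_le F.c_pos.le F.hasDerivAt_v F.hasDerivAt_v'
    (fun s => sub_le_self _ (F.reaction_nonneg s)) F.v_nonneg t

lemma v_pos (t : ℝ) : 0 < F.v t := by
  obtain ⟨s, hs_pos, hts⟩ := ((F.isProfile.top.eventually (lt_mem_nhds zero_lt_one)).and
    (eventually_ge_atTop t)).exists
  exact pos_of_deriv_le_mul F.hasDerivAt_v F.v'_le hts
    ((mul_pos F.one_sub_b_pos hs_pos).trans_le (F.mul_le_v s))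

lemma pos (t : ℝ) : 0 < F.φ t := (F.v_pos t).trans_le (F.v_le t)

lemma abs_v_le_one (t : ℝ) : |F.v t| ≤ 1 := by
  rw [abs_of_pos (F.v_pos t)]
  exact F.v_le_one t

lemma abs_v'_le (t : ℝ) : |F.v' t| ≤ c := by
  rw [abs_of_nonneg (F.v'_nonneg t)]
  exact (F.v'_le t).trans (mul_le_of_le_one_right F.c_pos.le (F.v_le_one t))

lemma hasDerivAt_neumannSeries_v' (t : ℝ) : HasDerivAt F.φ (neumannSeries b h F.v' t) t := by
  have hφ : F.φ = neumannSeries b h F.v :=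
    eq_neumannSeries F.b_nonneg F.b_lt_one F.abs_φ_le_one fun t => (F.v_eq t).symm
  have := hasDerivAt_neumannSeries (h := h) F.b_nonneg F.b_lt_one F.abs_v_le_one F.abs_v'_le
    F.hasDerivAt_v t
  rwa [← hφ] at this

lemma hasDerivAt_φ (t : ℝ) : HasDerivAt F.φ (F.φ' t) t :=
  (F.hasDerivAt_neumannSeries_v' t).differentiableAt.hasDerivAt

lemma φ'_eq_neumannSeries : F.φ' = neumannSeries b h F.v' :=
  funext fun t => (F.hasDerivAt_neumannSeries_v' t).deriv

lemma v'_eq (t : ℝ) : F.v' t = F.φ' t - b * F.φ' (t - h) := by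
  rw [F.φ'_eq_neumannSeries, neumannSeries_sub_shift F.b_nonneg F.b_lt_one F.abs_v'_le]

lemma φ'_nonneg (t : ℝ) : 0 ≤ F.φ' t := F.isProfile.mono.deriv_nonneg

lemma φ'_le {Λ : ℝ} (hΛ0 : 0 ≤ Λ) (hΛ : ∀ t, F.v' t ≤ Λ * F.v t) (t : ℝ) :
    F.φ' t ≤ Λ * F.φ t := by
  refine sub_nonneg.1 (nonneg_of_shift F.b_nonneg F.b_lt_one (h := h) (C := c / (1 - b))
    (D := fun t => Λ * F.φ t - F.φ' t) (fun s => ?_) (fun s => ?_) t)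
  · have : F.φ' s ≤ c / (1 - b) := by
      rw [F.φ'_eq_neumannSeries]
      exact le_of_abs_le (abs_neumannSeries_le F.b_nonneg F.b_lt_one F.abs_v'_le s)
    linarith [mul_nonneg hΛ0 (F.nonneg s)]
  · have := hΛ s
    rw [F.v_eq, F.v'_eq] at this
    linarith

lemma continuous : Continuous F.φ :=
  continuous_iff_continuousAt.2 fun t => (F.hasDerivAt_φ t).continuousAt

lemma continuous_v : Continuous F.v :=
  continuous_iff_continuousAt.2 fun t => (F.hasDerivAt_v t).continuousAt

lemma tendsto_v_atBot : Tendsto F.v atBot (𝓝 0) :=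
  squeeze_zero F.v_nonneg F.v_le F.isProfile.bot

end Front

lemma integral_exp_mul {k : ℝ} (hk : k ≠ 0) (x y : ℝ) :
    ∫ s in x..y, exp (k * s) = (exp (k * y) - exp (k * x)) / k := by
  rw [intervalIntegral.integral_comp_mul_left _ hk, integral_exp, smul_eq_mul, inv_mul_eq_div]

lemma tendsto_exp_neg_mul_mul_atTop {r C : ℝ} (hr : 0 < r) {f : ℝ → ℝ} (hf : ∀ t, |f t| ≤ C) :
    Tendsto (fun t => exp (-r * t) * f t) atTop (𝓝 0) :=
  (tendsto_exp_neg_mul_atTop hr).zero_mul_isBoundedUnder_le (isBoundedUnder_of ⟨C, hf⟩)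

lemma hasDerivAt_integral_sub_const {k : ℝ → ℝ} (hk : Continuous k) (h t : ℝ) :
    HasDerivAt (fun t => ∫ s in (t - h)..t, k s) (k t - k (t - h)) t := by
  have hsplit : (fun t => ∫ s in (t - h)..t, k s) =
      fun t => (∫ s in (0 : ℝ)..t, k s) - ∫ s in (0 : ℝ)..(t - h), k s := funext fun t =>
    (intervalIntegral.integral_interval_sub_left (hk.intervalIntegrable _ _)
      (hk.intervalIntegrable _ _)).symm
  rw [hsplit]
  exact (hk.integral_hasStrictDerivAt 0 t).hasDerivAt.sub
    ((hk.integral_hasStrictDerivAt 0 (t - h)).hasDerivAt.comp_sub_const t h)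

section
variable {k : ℝ → ℝ} {h t M : ℝ}

lemma integral_sub_const_le (hk : Continuous k) (hh : 0 ≤ h)
    (hM : ∀ s, t - h ≤ s → s ≤ t → k s ≤ M) : ∫ s in (t - h)..t, k s ≤ h * M := by
  have := intervalIntegral.integral_mono_on (μ := volume) (f := k) (g := fun _ => M)
    (sub_le_self t hh) (hk.intervalIntegrable _ _) (by simp) fun s hs => hM s hs.1 hs.2
  simpa using this

lemma le_integral_sub_const (hk : Continuous k) (hh : 0 ≤ h)
    (hM : ∀ s, t - h ≤ s → s ≤ t → M ≤ k s) : h * M ≤ ∫ s in (t - h)..t, k s := by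
  have := integral_sub_const_le (k := fun s => -k s) (M := -M) hk.neg hh
    fun s hs hst => neg_le_neg (hM s hs hst)
  rw [intervalIntegral.integral_neg] at this
  linarith

end

lemma one_div_midpoint_le {A B : ℝ} (hA : 0 < A) (hB : 0 < B) :
    1 / ((A + B) / 2) ≤ (1 / A + 1 / B) / 2 := by
  rw [div_add_div _ _ hA.ne' hB.ne', div_div, div_le_div_iff₀ (by linarith) (by positivity)]
  nlinarith [sq_nonneg (A - B)]

lemma chi_midpoint_lt {b c h x y : ℝ} (hb0 : 0 ≤ b) (hx : 0 < 1 - b * exp (-(x * h)))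
    (hy : 0 < 1 - b * exp (-(y * h))) (hxy : x ≠ y) :
    chi b c h 1 ((x + y) / 2) < (chi b c h 1 x + chi b c h 1 y) / 2 := by
  have hexp : exp (-((x + y) / 2 * h)) ≤ (exp (-(x * h)) + exp (-(y * h))) / 2 := by
    have := convexOn_exp.2 (mem_univ (-(x * h))) (mem_univ (-(y * h)))
      (by norm_num : (0 : ℝ) ≤ 1 / 2) (by norm_num : (0 : ℝ) ≤ 1 / 2) (by norm_num)
    simp only [smul_eq_mul] at this
    rw [show -((x + y) / 2 * h) = 1 / 2 * -(x * h) + 1 / 2 * -(y * h) by ring]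
    linarith
  have hdiv : 1 / (1 - b * exp (-((x + y) / 2 * h))) ≤
      (1 / (1 - b * exp (-(x * h))) + 1 / (1 - b * exp (-(y * h)))) / 2 :=
    (one_div_le_one_div_of_le (by linarith)
      (by linarith [mul_le_mul_of_nonneg_left hexp hb0])).trans (one_div_midpoint_le hx hy)
  have hsq : 0 < (x - y) ^ 2 := sq_pos_of_ne_zero (sub_ne_zero.2 hxy)
  unfold chi
  nlinarith

/-! ### The flux and the growth rate of a front -/

/-- The weight of the delayed term in `Front.flux`. -/
def shiftRatio (b h r : ℝ) : ℝ := b * exp (-(r * h)) / (1 - b * exp (-(r * h)))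

/-- The integral of `e^{-k s}` over `[0, h]`. -/
def expWindow (h k : ℝ) : ℝ := (1 - exp (-(k * h))) / k

lemma expWindow_nonneg {h k : ℝ} (hh : 0 ≤ h) (hk : 0 < k) : 0 ≤ expWindow h k :=
  div_nonneg (sub_nonneg.2 (exp_le_one_iff.2 (neg_nonpos.2 (mul_nonneg hk.le hh)))) hk.le

lemma chi_sub_chi {b c h r Λ : ℝ} (hΛ : 1 - b * exp (-(Λ * h)) ≠ 0)
    (hr : 1 - b * exp (-(r * h)) ≠ 0) (hne : Λ - r ≠ 0) :
    chi b c h 1 Λ - chi b c h 1 r = (Λ - r) *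
      (Λ - (c - r) - shiftRatio b h r * expWindow h (Λ - r) / (1 - b * exp (-(Λ * h)))) := by
  have hexp : exp (-((Λ - r) * h)) * exp (-(r * h)) = exp (-(Λ * h)) := by
    rw [← exp_add]; ring_nf
  unfold chi shiftRatio expWindow
  generalize exp (-(Λ * h)) = β at *
  generalize exp (-(r * h)) = β' at *
  generalize exp (-((Λ - r) * h)) = E at *
  field_simp
  linear_combination (-b) * hexp

namespace Front
variable {b c h : ℝ}

/-- The integral of the profile equation tested with `e^{-r t}`. Its derivative consists of the
quadratic term alone when `r` is a zero of the characteristic function. -/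
def flux (F : Front b c h) (r t : ℝ) : ℝ :=
  exp (-r * t) * (F.v' t - (c - r) * F.v t) -
    shiftRatio b h r * ∫ s in (t - h)..t, exp (-r * s) * F.φ s

variable (F : Front b c h) {r : ℝ}
include F

lemma one_sub_mul_exp_pos (hr : 0 ≤ r) : 0 < 1 - b * exp (-(r * h)) := by
  have : exp (-(r * h)) ≤ 1 := exp_le_one_iff.2 (neg_nonpos.2 (mul_nonneg hr F.h_nonneg))
  linarith [mul_le_of_le_one_right F.b_nonneg this, F.b_lt_one]

lemma shiftRatio_nonneg (hr : 0 ≤ r) : 0 ≤ shiftRatio b h r :=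
  div_nonneg (mul_nonneg F.b_nonneg (exp_pos _).le) (F.one_sub_mul_exp_pos hr).le

lemma continuous_exp_mul_φ (r : ℝ) : Continuous fun s => exp (-r * s) * F.φ s := by
  have := F.continuous
  fun_prop

lemma hasDerivAt_flux (hr : 0 ≤ r) (t : ℝ) :
    HasDerivAt (F.flux r)
      (exp (-r * t) * (F.φ t * F.φ (t - h) - chi b c h 1 r * F.v t)) t := by
  have ha := (F.one_sub_mul_exp_pos hr).ne'
  refine ((hasDerivAt_exp_mul_mul (-r) ((F.hasDerivAt_v' t).sub
    ((F.hasDerivAt_v t).const_mul (c - r)))).sub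
    ((hasDerivAt_integral_sub_const (F.continuous_exp_mul_φ r) h t).const_mul _)).congr_deriv ?_
  have hexp : exp (-r * (t - h)) * exp (-(r * h)) = exp (-r * t) := by rw [← exp_add]; ring_nf
  have hv : b * F.φ (t - h) = F.φ t - F.v t := by rw [F.v_eq]; ring
  have hdelay : shiftRatio b h r * (exp (-r * t) * F.φ t - exp (-r * (t - h)) * F.φ (t - h)) =
      exp (-r * t) * (F.v t / (1 - b * exp (-(r * h))) - F.φ t) := by
    rw [shiftRatio]
    generalize exp (-(r * h)) = β at *
    generalize exp (-r * (t - h)) = E' at *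
    generalize exp (-r * t) = E at *
    field_simp
    linear_combination (-b * F.φ (t - h)) * hexp - E * hv
  rw [hdelay]
  simp only [Pi.sub_apply, chi]
  ring

lemma tendsto_flux (hr : 0 < r) : Tendsto (F.flux r) atTop (𝓝 0) := by
  have hlocal : ∀ t, |F.v' t - (c - r) * F.v t| ≤ c + |c - r| := fun t =>
    calc |F.v' t - (c - r) * F.v t| ≤ |F.v' t| + |(c - r) * F.v t| := abs_sub _ _
      _ ≤ c + |c - r| := by
        rw [abs_mul]
        exact add_le_add (F.abs_v'_le t)
          (mul_le_of_le_one_right (abs_nonneg _) (F.abs_v_le_one t))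
  have hwindow : ∀ t, ∫ s in (t - h)..t, exp (-r * s) * F.φ s ≤
      exp (-r * t) * (h * exp (r * h)) := fun t => by
    have hle : ∀ s, t - h ≤ s → s ≤ t → exp (-r * s) * F.φ s ≤ exp (-r * t) * exp (r * h) :=
      fun s hs _ => by
        rw [← exp_add]
        exact (mul_le_of_le_one_right (exp_pos _).le (F.le_one s)).trans
          (exp_le_exp.2 (by nlinarith))
    linarith [integral_sub_const_le (F.continuous_exp_mul_φ r) F.h_nonneg hle]
  have hwindow_lim : Tendsto (fun t => ∫ s in (t - h)..t, exp (-r * s) * F.φ s) atTop (𝓝 0) :=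
    squeeze_zero
      (fun t => intervalIntegral.integral_nonneg (sub_le_self t F.h_nonneg)
        fun s _ => mul_nonneg (exp_pos _).le (F.nonneg s)) hwindow
      (by simpa using (tendsto_exp_neg_mul_atTop hr).mul_const (h * exp (r * h)))
  have hsub := (tendsto_exp_neg_mul_mul_atTop hr hlocal).sub
    (hwindow_lim.const_mul (shiftRatio b h r))
  rwa [mul_zero, sub_zero] at hsub

lemma monotone_flux (hr : 0 ≤ r) (hχ : chi b c h 1 r ≤ 0) : Monotone (F.flux r) := by
  refine monotone_of_hasDerivAt_nonneg (F.hasDerivAt_flux hr) fun t =>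
    mul_nonneg (exp_pos _).le ?_
  linarith [mul_nonneg (F.nonneg t) (F.nonneg (t - h)),
    mul_nonneg (neg_nonneg.2 hχ) (F.v_pos t).le]

lemma flux_nonpos (hr : 0 < r) (hχ : chi b c h 1 r ≤ 0) (t : ℝ) : F.flux r t ≤ 0 :=
  (F.monotone_flux hr.le hχ).ge_of_tendsto (F.tendsto_flux hr) t

/-- `Λ` bounds the logarithmic derivative of the neutral part. -/
def GrowthBound (F : Front b c h) (Λ : ℝ) : Prop := ∀ t, F.v' t ≤ Λ * F.v t

/-- The amount by which the neutral part grows more slowly than `e^{Λ t}`. -/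
def vDefect (F : Front b c h) (Λ t : ℝ) : ℝ := Λ * F.v t - F.v' t

/-- The amount by which the profile grows more slowly than `e^{Λ t}`. -/
def φDefect (F : Front b c h) (Λ t : ℝ) : ℝ := Λ * F.φ t - F.φ' t

lemma vDefect_eq (Λ t : ℝ) : F.vDefect Λ t = F.φDefect Λ t - b * F.φDefect Λ (t - h) := by
  simp only [vDefect, φDefect, F.v_eq, F.v'_eq]
  ring

lemma hasDerivAt_vDefect (Λ t : ℝ) :
    HasDerivAt (F.vDefect Λ) ((Λ - c) * F.v' t + F.φ t * (1 - F.φ (t - h))) t :=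
  (((F.hasDerivAt_v t).const_mul Λ).sub (F.hasDerivAt_v' t)).congr_deriv (by ring)

lemma abs_deriv_vDefect_le (Λ t : ℝ) :
    |(Λ - c) * F.v' t + F.φ t * (1 - F.φ (t - h))| ≤ |Λ - c| * c + 1 := by
  refine (abs_add_le _ _).trans (add_le_add ?_ ?_)
  · rw [abs_mul]
    exact mul_le_mul_of_nonneg_left (F.abs_v'_le t) (abs_nonneg _)
  · rw [abs_of_nonneg (F.reaction_nonneg t)]
    exact mul_le_one₀ (F.le_one t) (sub_nonneg.2 (F.le_one _)) (sub_le_self 1 (F.nonneg _))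

section
variable {F} {Λ : ℝ} (hΛ : F.GrowthBound Λ)

namespace GrowthBound
include hΛ

lemma nonneg : 0 ≤ Λ :=
  nonneg_of_mul_nonneg_left ((F.v'_nonneg 0).trans (hΛ 0)) (F.v_pos 0)

lemma vDefect_nonneg (t : ℝ) : 0 ≤ F.vDefect Λ t := sub_nonneg.2 (hΛ t)

lemma φDefect_nonneg (t : ℝ) : 0 ≤ F.φDefect Λ t := sub_nonneg.2 (F.φ'_le hΛ.nonneg hΛ t)

lemma φDefect_le_const (t : ℝ) : F.φDefect Λ t ≤ Λ :=
  (sub_le_self _ (F.φ'_nonneg t)).trans (mul_le_of_le_one_right hΛ.nonneg (F.le_one t))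

/-- Up to the weight `e^{c t}` this derivative is nonincreasing and bounded. -/
lemma deriv_vDefect_nonneg (t : ℝ) : 0 ≤ (Λ - c) * F.v' t + F.φ t * (1 - F.φ (t - h)) := by
  have hderiv : ∀ t, HasDerivAt (fun t => (Λ - c) * F.v' t + F.φ t * (1 - F.φ (t - h)))
      ((Λ - c) * (c * F.v' t - F.φ t * (1 - F.φ (t - h))) +
        (F.φ' t * (1 - F.φ (t - h)) + F.φ t * (-F.φ' (t - h)))) t := fun t =>
    ((F.hasDerivAt_v' t).const_mul _).add ((F.hasDerivAt_φ t).mul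
      (((F.hasDerivAt_φ (t - h)).comp_sub_const t h).const_sub 1))
  have hanti : Antitone fun t =>
      exp (-c * t) * ((Λ - c) * F.v' t + F.φ t * (1 - F.φ (t - h))) := by
    refine antitone_of_hasDerivAt_nonpos (fun t => hasDerivAt_exp_mul_mul (-c) (hderiv t))
      fun t => mul_nonpos_of_nonneg_of_nonpos (exp_pos _).le ?_
    have hloss : 0 ≤ F.φDefect Λ t * (1 - F.φ (t - h)) :=
      mul_nonneg (hΛ.φDefect_nonneg t) (sub_nonneg.2 (F.le_one _))
    have hdelay : 0 ≤ F.φ t * F.φ' (t - h) := mul_nonneg (F.nonneg t) (F.φ'_nonneg _)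
    rw [φDefect] at hloss
    linarith
  exact nonneg_of_mul_nonneg_right (hanti.le_of_tendsto
    (tendsto_exp_neg_mul_mul_atTop F.c_pos (F.abs_deriv_vDefect_le Λ)) t) (exp_pos _)

lemma monotone_vDefect : Monotone (F.vDefect Λ) :=
  monotone_of_hasDerivAt_nonneg (F.hasDerivAt_vDefect Λ) hΛ.deriv_vDefect_nonneg

lemma monotone_φDefect : Monotone (F.φDefect Λ) := by
  intro t₀ t₁ ht
  have := nonneg_of_shift F.b_nonneg F.b_lt_one (h := h) (C := Λ)
    (D := fun t => F.φDefect Λ (t + (t₁ - t₀)) - F.φDefect Λ t) (fun t => ?_) (fun t => ?_) t₀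
  · rw [add_sub_cancel] at this
    exact sub_nonneg.1 this
  · linarith [hΛ.φDefect_nonneg (t + (t₁ - t₀)), hΛ.φDefect_le_const t]
  · have hmono : F.vDefect Λ t ≤ F.vDefect Λ (t + (t₁ - t₀)) := hΛ.monotone_vDefect (by linarith)
    rw [F.vDefect_eq, F.vDefect_eq] at hmono
    rw [← add_sub_right_comm]
    linarith

lemma φDefect_le (t : ℝ) : F.φDefect Λ t ≤ F.vDefect Λ t / (1 - b) := by
  have := mul_le_mul_of_nonneg_left
    (hΛ.monotone_φDefect (sub_le_self t F.h_nonneg)) F.b_nonneg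
  rw [le_div_iff₀ F.one_sub_b_pos, F.vDefect_eq]
  linarith

lemma φ_le_exp_mul_add {s t : ℝ} (hst : s ≤ t) :
    F.φ s ≤ exp (-(Λ * (t - s))) * F.φ t + (t - s) * F.φDefect Λ t := by
  have hmono : MonotoneOn
      (fun r => exp (-Λ * r) * F.φ r + exp (-Λ * s) * F.φDefect Λ t * r) (Icc s t) := by
    refine monotoneOn_of_hasDerivAt_nonneg (convex_Icc s t) (fun r _ =>
      (hasDerivAt_exp_mul_mul (-Λ) (F.hasDerivAt_φ r)).add ((hasDerivAt_id r).const_mul _))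
      fun r hr => ?_
    have := mul_le_mul (exp_le_exp.2 (by nlinarith [hr.1, hΛ.nonneg] : -Λ * r ≤ -Λ * s))
      (hΛ.monotone_φDefect hr.2) (hΛ.φDefect_nonneg r) (exp_pos _).le
    rw [φDefect] at this
    linarith
  have hst' := hmono (left_mem_Icc.2 hst) (right_mem_Icc.2 hst) hst
  dsimp only at hst'
  have hexp : exp (-Λ * t) = exp (-Λ * s) * exp (-(Λ * (t - s))) := by rw [← exp_add]; ring_nf
  rw [hexp] at hst'
  refine le_of_mul_le_mul_left ?_ (exp_pos (-Λ * s))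
  linarith

lemma φ_le_v_add_vDefect (t : ℝ) : F.φ t ≤ F.v t / (1 - b * exp (-(Λ * h))) +
    b * h / ((1 - b) * (1 - b * exp (-(Λ * h)))) * F.vDefect Λ t := by
  have ha := F.one_sub_mul_exp_pos hΛ.nonneg
  have hb := F.one_sub_b_pos
  have hshift := hΛ.φ_le_exp_mul_add (sub_le_self t F.h_nonneg)
  rw [sub_sub_cancel] at hshift
  have hφ : (1 - b * exp (-(Λ * h))) * F.φ t ≤ F.v t + b * h * (F.vDefect Λ t / (1 - b)) := by
    have := mul_le_mul_of_nonneg_left hshift F.b_nonneg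
    have := mul_le_mul_of_nonneg_left (hΛ.φDefect_le t) (mul_nonneg F.b_nonneg F.h_nonneg)
    rw [F.v_eq]
    linarith
  calc F.φ t ≤ (F.v t + b * h * (F.vDefect Λ t / (1 - b))) / (1 - b * exp (-(Λ * h))) :=
        (le_div_iff₀' ha).2 hφ
    _ = _ := by field_simp

lemma exists_neg_chi_mul_le :
    ∃ C, 0 < C ∧ ∀ t, -chi b c h 1 Λ * F.v t ≤ C * F.vDefect Λ t := by
  have ha := F.one_sub_mul_exp_pos hΛ.nonneg
  have hb := F.one_sub_b_pos
  have hbh := mul_nonneg F.b_nonneg F.h_nonneg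
  refine ⟨c + b * h / ((1 - b) * (1 - b * exp (-(Λ * h)))),
    add_pos_of_pos_of_nonneg F.c_pos (by positivity), fun t => ?_⟩
  have hderiv := hΛ.deriv_vDefect_nonneg t
  have hφ := hΛ.φ_le_v_add_vDefect t
  have hquad : 0 ≤ F.φ t * F.φ (t - h) := mul_nonneg (F.nonneg _) (F.nonneg _)
  have hΛu : 0 ≤ Λ * F.vDefect Λ t := mul_nonneg hΛ.nonneg (hΛ.vDefect_nonneg t)
  have hlin : (Λ - c) * F.v' t = (Λ ^ 2 - c * Λ) * F.v t + (c - Λ) * F.vDefect Λ t := by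
    rw [vDefect]
    ring
  have hχ : chi b c h 1 Λ * F.v t =
      (Λ ^ 2 - c * Λ) * F.v t + F.v t / (1 - b * exp (-(Λ * h))) := by
    rw [chi]
    ring
  linarith

lemma exp_mul_φ_le {r s t : ℝ} (hr : 0 ≤ r) (hst : s ∈ Icc (t - h) t) :
    exp (-r * s) * F.φ s ≤ exp (-(Λ * t)) * F.φ t * exp ((Λ - r) * s) +
      exp (-r * t) * (h * exp (r * h) * F.φDefect Λ t) := by
  have hdefect : (t - s) * F.φDefect Λ t ≤ h * F.φDefect Λ t :=
    mul_le_mul_of_nonneg_right (by linarith [hst.1]) (hΛ.φDefect_nonneg t)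
  have hexp : exp (-r * s) ≤ exp (-r * t) * exp (r * h) := by
    rw [← exp_add, exp_le_exp]
    nlinarith [hst.1]
  have hsplit : exp (-r * s) * exp (-(Λ * (t - s))) = exp (-(Λ * t)) * exp ((Λ - r) * s) := by
    rw [← exp_add, ← exp_add]
    ring_nf
  calc exp (-r * s) * F.φ s
      ≤ exp (-r * s) * (exp (-(Λ * (t - s))) * F.φ t + h * F.φDefect Λ t) :=
        mul_le_mul_of_nonneg_left ((hΛ.φ_le_exp_mul_add hst.2).trans (by linarith))
          (exp_pos _).le
    _ = exp (-(Λ * t)) * F.φ t * exp ((Λ - r) * s) + exp (-r * s) * (h * F.φDefect Λ t) := by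
        rw [mul_right_comm, ← hsplit]; ring
    _ ≤ exp (-(Λ * t)) * F.φ t * exp ((Λ - r) * s) +
          exp (-r * t) * exp (r * h) * (h * F.φDefect Λ t) := by
        have := mul_le_mul_of_nonneg_right hexp (mul_nonneg F.h_nonneg (hΛ.φDefect_nonneg t))
        linarith
    _ = _ := by ring

lemma integral_exp_mul_φ_le {r : ℝ} (hr : 0 ≤ r) (hrΛ : r < Λ) (t : ℝ) :
    ∫ s in (t - h)..t, exp (-r * s) * F.φ s ≤
      exp (-r * t) * (expWindow h (Λ - r) * F.φ t + h * h * exp (r * h) * F.φDefect Λ t) := by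
  have hcont : Continuous fun s => exp (-(Λ * t)) * F.φ t * exp ((Λ - r) * s) := by fun_prop
  refine (intervalIntegral.integral_mono_on (μ := volume) (sub_le_self t F.h_nonneg)
    ((F.continuous_exp_mul_φ r).intervalIntegrable _ _)
    ((hcont.add continuous_const).intervalIntegrable _ _) fun s hs =>
      hΛ.exp_mul_φ_le hr hs).trans_eq ?_
  have hexp : exp ((Λ - r) * (t - h)) = exp (-((Λ - r) * h)) * exp ((Λ - r) * t) := by
    rw [← exp_add]; ring_nf
  have hexp_t : exp (-r * t) = exp (-(Λ * t)) * exp ((Λ - r) * t) := by rw [← exp_add]; ring_nf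
  simp only [Pi.add_apply]
  rw [intervalIntegral.integral_add (hcont.intervalIntegrable _ _) (by simp),
    intervalIntegral.integral_const_mul, integral_exp_mul (sub_pos.2 hrΛ).ne',
    intervalIntegral.integral_const, sub_sub_cancel, smul_eq_mul, expWindow, hexp, hexp_t]
  ring

lemma v'_sub_le {r : ℝ} (hr : 0 < r) (hrΛ : r < Λ) (hχ : chi b c h 1 r ≤ 0) (t : ℝ) :
    F.v' t - (c - r) * F.v t ≤ shiftRatio b h r *
      (expWindow h (Λ - r) * F.φ t + h * h * exp (r * h) * F.φDefect Λ t) := by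
  have hflux := F.flux_nonpos hr hχ t
  have := mul_le_mul_of_nonneg_left (hΛ.integral_exp_mul_φ_le hr.le hrΛ t)
    (F.shiftRatio_nonneg hr.le)
  rw [flux] at hflux
  refine le_of_mul_le_mul_left ?_ (exp_pos (-r * t))
  linarith

lemma exists_chi_sub_mul_le {r : ℝ} (hr : 0 < r) (hrΛ : r < Λ) (hχ : chi b c h 1 r ≤ 0) :
    ∃ C, 0 < C ∧ ∀ t, (chi b c h 1 Λ - chi b c h 1 r) * F.v t ≤ C * F.vDefect Λ t := by
  have ha := F.one_sub_mul_exp_pos hΛ.nonneg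
  have hb := F.one_sub_b_pos
  have hb0 := F.b_nonneg
  have hh := F.h_nonneg
  have hd := sub_pos.2 hrΛ
  have hα := F.shiftRatio_nonneg hr.le
  have hD := expWindow_nonneg hh hd
  rw [chi_sub_chi ha.ne' (F.one_sub_mul_exp_pos hr.le).ne' hd.ne']
  refine ⟨(Λ - r) * (shiftRatio b h r * (h * h * exp (r * h)) / (1 - b) + shiftRatio b h r *
    expWindow h (Λ - r) * (b * h / ((1 - b) * (1 - b * exp (-(Λ * h))))) + 1), by positivity,
    fun t => ?_⟩
  rw [mul_assoc, mul_assoc]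
  refine mul_le_mul_of_nonneg_left ?_ hd.le
  have hv' := hΛ.v'_sub_le hr hrΛ hχ t
  have hdefect := mul_le_mul_of_nonneg_left (hΛ.φDefect_le t)
    (by positivity : 0 ≤ shiftRatio b h r * (h * h * exp (r * h)))
  have hφ := mul_le_mul_of_nonneg_left (hΛ.φ_le_v_add_vDefect t) (mul_nonneg hα hD)
  have hv'_eq : F.v' t = Λ * F.v t - F.vDefect Λ t := by rw [vDefect]; ring
  rw [hv'_eq] at hv'
  simp only [div_eq_mul_inv] at *
  linarith

end GrowthBound
end

lemma exists_least_growthBound : ∃ Λ, F.GrowthBound Λ ∧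
    ∀ ε C : ℝ, 0 < ε → 0 < C → ¬∀ t, ε * F.v t ≤ C * F.vDefect Λ t := by
  have hbdd : BddBelow {Λ | F.GrowthBound Λ} := ⟨0, fun Λ hΛ => GrowthBound.nonneg hΛ⟩
  refine ⟨sInf {Λ | F.GrowthBound Λ}, fun t => ?_, fun ε C hε hC hle => ?_⟩
  · rw [← div_le_iff₀ (F.v_pos t)]
    exact le_csInf ⟨c, F.v'_le⟩ fun x hx => (div_le_iff₀ (F.v_pos t)).2 (hx t)
  · have hmem : F.GrowthBound (sInf {Λ | F.GrowthBound Λ} - ε / C) := fun t => by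
      have := (div_le_iff₀' hC).2 (hle t)
      rw [vDefect, mul_div_right_comm] at this
      linarith
    linarith [csInf_le hbdd hmem, div_pos hε hC]

lemma growthBound_of_chi_eq_zero (hr : 0 < r) (hχ : chi b c h 1 r = 0) : F.GrowthBound r := by
  obtain ⟨Λ, hΛ, hleast⟩ := F.exists_least_growthBound
  suffices hle : Λ ≤ r from
    fun t => (hΛ t).trans (mul_le_mul_of_nonneg_right hle (F.v_pos t).le)
  by_contra! hlt
  have hχΛ : 0 ≤ chi b c h 1 Λ := by
    by_contra! hneg
    obtain ⟨C, hC, hle⟩ := hΛ.exists_neg_chi_mul_le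
    exact hleast _ C (neg_pos.2 hneg) hC hle
  have hmin : ∀ s, 0 < s → s < Λ → chi b c h 1 s ≤ 0 → chi b c h 1 Λ ≤ chi b c h 1 s := by
    intro s hs hsΛ hχs
    by_contra! hneg
    obtain ⟨C, hC, hle⟩ := hΛ.exists_chi_sub_mul_le hs hsΛ hχs
    exact hleast _ C (sub_pos.2 hneg) hC hle
  have hχr := hmin r hr hlt hχ.le
  -- at a second zero `Λ`, strict convexity makes `chi` negative in between
  have hmid := chi_midpoint_lt (c := c) F.b_nonneg (F.one_sub_mul_exp_pos hr.le)
    (F.one_sub_mul_exp_pos hΛ.nonneg) hlt.ne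
  linarith [hmin ((r + Λ) / 2) (by linarith) (by linarith) (by linarith)]

end Front

/-! ### Asymptotics at minus infinity -/

section
variable {f f' : ℝ → ℝ} {A δ t : ℝ} (hδ : 0 < δ) (hA : 0 ≤ A)
  (hf : ∀ x ≤ t, HasDerivAt f (f' x) x) (hf' : ∀ x ≤ t, f' x ≤ A * exp (δ * x))
include hδ hA hf hf'

lemma sub_le_of_hasDerivAt_le_exp_mul {s : ℝ} (hst : s ≤ t) :
    f t - f s ≤ A / δ * exp (δ * t) := by
  have hanti : AntitoneOn (fun x => f x - A / δ * exp (δ * x)) (Iic t) :=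
    antitoneOn_of_hasDerivAt_nonpos (convex_Iic t)
      (fun x hx => (hf x hx).sub ((hasDerivAt_exp_mul δ x).const_mul _)) fun x hx => by
        have hcancel : A / δ * (δ * exp (δ * x)) = A * exp (δ * x) := by field_simp
        rw [hcancel]
        exact sub_nonpos.2 (hf' x hx)
  have hst' := hanti (mem_Iic.2 hst) self_mem_Iic hst
  have hpos : 0 ≤ A / δ * exp (δ * s) := by positivity
  dsimp only at hst'
  linarith

lemma le_add_of_hasDerivAt_le_exp_mul {l : ℝ} (hl : Tendsto f atBot (𝓝 l)) :
    f t ≤ l + A / δ * exp (δ * t) :=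
  ge_of_tendsto (hl.add_const _) ((eventually_le_atBot t).mono fun _ hs =>
    sub_le_iff_le_add'.1 (sub_le_of_hasDerivAt_le_exp_mul hδ hA hf hf' hs))

end

lemma exists_first_zero {f : ℝ → ℝ} {x₀ x₁ : ℝ} (hx : x₀ ≤ x₁) (hf : ContinuousOn f (Icc x₀ x₁))
    (h₀ : 0 < f x₀) (h₁ : f x₁ ≤ 0) :
    ∃ r, x₀ < r ∧ r ≤ x₁ ∧ f r = 0 ∧ ∀ x, x₀ ≤ x → x < r → 0 < f x := by
  have hcomp : IsCompact (Icc x₀ x₁ ∩ f ⁻¹' Iic 0) :=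
    isCompact_Icc.of_isClosed_subset (hf.preimage_isClosed_of_isClosed isClosed_Icc isClosed_Iic)
      inter_subset_left
  obtain ⟨r, ⟨hr, hfr⟩, hmin⟩ := hcomp.exists_isLeast ⟨x₁, ⟨hx, le_rfl⟩, h₁⟩
  rw [mem_preimage, mem_Iic] at hfr
  refine ⟨r, lt_of_le_of_ne hr.1 fun heq => ?_, hr.2, ?_, fun x hx₀ hxr => ?_⟩
  · subst heq
    exact hfr.not_gt h₀
  · obtain ⟨x, hx, hfx⟩ := intermediate_value_Icc' hr.1
      (hf.mono (Icc_subset_Icc_right hr.2)) ⟨hfr, h₀.le⟩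
    have hrx : r ≤ x := hmin ⟨⟨hx.1, hx.2.trans hr.2⟩, hfx.le⟩
    rw [← le_antisymm hx.2 hrx, hfx]
  · by_contra! hfx
    exact (hmin ⟨⟨hx₀, hxr.le.trans hr.2⟩, hfx⟩).not_gt hxr

/-- Minus the derivative of the characteristic function `chi b c h 1`. -/
def chiSlope (b c h r : ℝ) : ℝ :=
  c - 2 * r + h * (b * exp (-(r * h))) / (1 - b * exp (-(r * h))) ^ 2

lemma hasDerivAt_chi {b c h r : ℝ} (hr : 1 - b * exp (-(r * h)) ≠ 0) :
    HasDerivAt (chi b c h 1) (-chiSlope b c h r) r := by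
  have hexp : HasDerivAt (fun z => exp (-(z * h))) (exp (-(r * h)) * -h) r := by
    simpa using ((hasDerivAt_id r).mul_const h).neg.exp
  refine ((((hasDerivAt_id r).pow 2).sub ((hasDerivAt_id r).const_mul c)).add
    ((hasDerivAt_const r (1 : ℝ)).div ((hexp.const_mul b).const_sub 1) hr)).congr_deriv ?_
  simp only [chiSlope, id]
  field_simp
  push_cast
  ring

/-- A positive zero of the characteristic function at which it does not increase, such as its
smallest positive zero. A front behaves like `e^{r t}` at minus infinity, up to a factor `|t|` if
the slope vanishes. -/
structure IsLeadingRoot (b c h r : ℝ) : Prop where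
  pos : 0 < r
  chi_eq_zero : chi b c h 1 r = 0
  chiSlope_nonneg : 0 ≤ chiSlope b c h r

lemma exists_isLeadingRoot {b c h z : ℝ} (hb0 : 0 ≤ b) (hb1 : b < 1) (hh : 0 ≤ h) (hz : 0 < z)
    (hχ : chi b c h 1 z = 0) : ∃ r, IsLeadingRoot b c h r := by
  have hχ0 : 0 < chi b c h 1 0 := by
    have : 0 < 1 / (1 - b) := one_div_pos.2 (sub_pos.2 hb1)
    simpa [chi] using this
  obtain ⟨r, hr, -, hzero, hpos⟩ := exists_first_zero hz.le
    ((continuousOn_chi hb0 hb1 hh).mono Icc_subset_Ici_self) hχ0 hχ.le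
  have hden : 0 < 1 - b * exp (-(r * h)) := by
    have hexp : exp (-(r * h)) ≤ 1 := exp_le_one_iff.2 (neg_nonpos.2 (mul_nonneg hr.le hh))
    linarith [mul_le_of_le_one_right hb0 hexp]
  have hslope := (hasDerivWithinAt_iff_tendsto_slope' (s := Iio r) (by simp)).1
    (hasDerivAt_chi (c := c) hden.ne').hasDerivWithinAt
  refine ⟨r, hr, hzero, neg_nonpos.1 (le_of_tendsto hslope ?_)⟩
  filter_upwards [Ioo_mem_nhdsLT hr] with x hx
  rw [slope_def_field, hzero]
  exact div_nonpos_of_nonneg_of_nonpos (by linarith [hpos x hx.1.le hx.2]) (by linarith [hx.2])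

namespace Front
variable {b c h r : ℝ} {F : Front b c h}

namespace GrowthBound
variable {Λ : ℝ} (hΛ : F.GrowthBound Λ)
include hΛ

lemma antitone_exp_mul_φ : Antitone fun t => exp (-Λ * t) * F.φ t :=
  antitone_of_hasDerivAt_nonpos (fun t => hasDerivAt_exp_mul_mul (-Λ) (F.hasDerivAt_φ t))
    fun t => mul_nonpos_of_nonneg_of_nonpos (exp_pos _).le
      (by linarith [F.φ'_le hΛ.nonneg hΛ t])

lemma exp_mul_le_shift (t : ℝ) : exp (-(Λ * h)) * F.φ t ≤ F.φ (t - h) := by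
  have hanti : exp (-Λ * t) * F.φ t ≤ exp (-Λ * (t - h)) * F.φ (t - h) :=
    hΛ.antitone_exp_mul_φ (sub_le_self t F.h_nonneg)
  have hexp : exp (-(Λ * h)) * exp (-Λ * (t - h)) = exp (-Λ * t) := by rw [← exp_add]; ring_nf
  rw [← hexp] at hanti
  refine le_of_mul_le_mul_left ?_ (exp_pos (-Λ * (t - h)))
  linarith

lemma vDefect_add_chiSlope_mul_le (t : ℝ) :
    exp (-Λ * t) * F.vDefect Λ t + chiSlope b c h Λ * (exp (-Λ * t) * F.v t) ≤
      -F.flux Λ t := by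
  have ha := F.one_sub_mul_exp_pos hΛ.nonneg
  have hh := F.h_nonneg
  have hwindow : h * (exp (-Λ * t) * F.φ t) ≤ ∫ s in (t - h)..t, exp (-Λ * s) * F.φ s :=
    le_integral_sub_const (F.continuous_exp_mul_φ Λ) hh fun _ _ hs => hΛ.antitone_exp_mul_φ hs
  have hφ : F.v t / (1 - b * exp (-(Λ * h))) ≤ F.φ t := by
    rw [div_le_iff₀ ha, F.v_eq]
    linarith [mul_le_mul_of_nonneg_left (hΛ.exp_mul_le_shift t) F.b_nonneg]
  have hdelay : h * (b * exp (-(Λ * h))) / (1 - b * exp (-(Λ * h))) ^ 2 *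
      (exp (-Λ * t) * F.v t) ≤
        shiftRatio b h Λ * ∫ s in (t - h)..t, exp (-Λ * s) * F.φ s := by
    calc _ = shiftRatio b h Λ *
          (h * (exp (-Λ * t) * (F.v t / (1 - b * exp (-(Λ * h)))))) := by
          rw [shiftRatio]
          field_simp
      _ ≤ shiftRatio b h Λ * (h * (exp (-Λ * t) * F.φ t)) := by
          have := F.shiftRatio_nonneg hΛ.nonneg
          gcongr
      _ ≤ _ := mul_le_mul_of_nonneg_left hwindow (F.shiftRatio_nonneg hΛ.nonneg)
  unfold flux vDefect chiSlope
  linarith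

end GrowthBound

variable (F)
include F

lemma hasDerivAt_flux_of_chi_eq_zero (hr : 0 ≤ r) (hχ : chi b c h 1 r = 0) (t : ℝ) :
    HasDerivAt (F.flux r) (exp (-r * t) * (F.φ t * F.φ (t - h))) t := by
  have := F.hasDerivAt_flux hr t
  rwa [hχ, zero_mul, sub_zero] at this

lemma eventually_φ_mul_φ_le {ε : ℝ} (hε : 0 < ε) :
    ∀ᶠ t in atBot, F.φ t * F.φ (t - h) ≤ ε * F.v t := by
  have hlim : Tendsto (fun t => F.v t / (1 - b) ^ 2) atBot (𝓝 0) := by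
    simpa using F.tendsto_v_atBot.div_const ((1 - b) ^ 2)
  filter_upwards [hlim.eventually_lt_const hε] with t ht
  calc F.φ t * F.φ (t - h) ≤ (F.v t / (1 - b)) * (F.v t / (1 - b)) :=
        mul_le_mul (F.φ_le t) ((F.shift_le t).trans (F.φ_le t)) (F.nonneg _)
          (div_nonneg (F.v_pos t).le F.one_sub_b_pos.le)
    _ = F.v t / (1 - b) ^ 2 * F.v t := by
        have := F.one_sub_b_pos.ne'
        field_simp
    _ ≤ ε * F.v t := mul_le_mul_of_nonneg_right ht.le (F.v_pos t).le

lemma exists_monotoneOn_exp_mul_sub_flux (hr : IsLeadingRoot b c h r) {a : ℝ} (ha : 0 < a) :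
    ∃ T, MonotoneOn (fun t => exp (a * t) * (exp (-r * t) * F.v t + -F.flux r t / a))
      (Iic T) := by
  obtain ⟨T, hT⟩ := eventually_atBot.1 (F.eventually_φ_mul_φ_le (sq_pos_of_pos ha))
  refine ⟨T, monotoneOn_of_hasDerivAt_nonneg (convex_Iic T) (fun t _ =>
    hasDerivAt_exp_mul_mul a ((hasDerivAt_exp_mul_mul (-r) (F.hasDerivAt_v t)).add
      ((F.hasDerivAt_flux_of_chi_eq_zero hr.pos.le hr.chi_eq_zero t).neg.div_const a)))
    fun t ht => mul_nonneg (exp_pos _).le ?_⟩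
  have hflux := (F.growthBound_of_chi_eq_zero hr.pos hr.chi_eq_zero).vDefect_add_chiSlope_mul_le t
  have hslope := mul_nonneg hr.chiSlope_nonneg (mul_nonneg (exp_pos (-r * t)).le (F.v_pos t).le)
  have hquad : exp (-r * t) * (F.φ t * F.φ (t - h)) / a ≤ a * (exp (-r * t) * F.v t) := by
    rw [div_le_iff₀ ha]
    linarith [mul_le_mul_of_nonneg_left (hT t ht) (exp_pos (-r * t)).le]
  have hcancel : a * (-F.flux r t / a) = -F.flux r t := mul_div_cancel₀ _ ha.ne'
  rw [vDefect] at hflux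
  simp only [neg_div] at *
  linarith

lemma exists_φ_le_exp_mul (hr : IsLeadingRoot b c h r) :
    ∃ C, 0 < C ∧ ∀ t, F.φ t ≤ C * exp (3 / 4 * r * t) := by
  have hr0 := hr.pos
  obtain ⟨T, hT⟩ := F.exists_monotoneOn_exp_mul_sub_flux hr (a := r / 4) (by positivity)
  have hflux : ∀ t, 0 ≤ -F.flux r t / (r / 4) := fun t =>
    div_nonneg (neg_nonneg.2 (F.flux_nonpos hr0 hr.chi_eq_zero.le t)) (by positivity)
  set W := exp (r / 4 * T) * (exp (-r * T) * F.v T + -F.flux r T / (r / 4))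
  have hW : 0 ≤ W := mul_nonneg (exp_pos _).le
    (add_nonneg (mul_nonneg (exp_pos _).le (F.v_nonneg T)) (hflux T))
  have hv : ∀ t ≤ T, F.v t ≤ W * exp (3 / 4 * r * t) := fun t ht => by
    have hexp : exp (3 / 4 * r * t) * (exp (r / 4 * t) * exp (-r * t)) = 1 := by
      rw [← exp_add, ← exp_add, exp_eq_one_iff]
      ring
    have hWt : exp (r / 4 * t) * (exp (-r * t) * F.v t) ≤ W :=
      (mul_le_mul_of_nonneg_left (le_add_of_nonneg_right (hflux t)) (exp_pos _).le).trans
        (hT ht self_mem_Iic ht)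
    calc F.v t = exp (r / 4 * t) * (exp (-r * t) * F.v t) * exp (3 / 4 * r * t) := by
          linear_combination (-F.v t) * hexp
      _ ≤ W * exp (3 / 4 * r * t) := mul_le_mul_of_nonneg_right hWt (exp_pos _).le
  have hb := F.one_sub_b_pos
  refine ⟨W / (1 - b) + exp (-(3 / 4 * r * T)), by positivity, fun t => ?_⟩
  rw [add_mul]
  rcases le_total t T with ht | ht
  · calc F.φ t ≤ F.v t / (1 - b) := F.φ_le t
      _ ≤ W * exp (3 / 4 * r * t) / (1 - b) := div_le_div_of_nonneg_right (hv t ht) hb.le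
      _ = W / (1 - b) * exp (3 / 4 * r * t) := by ring
      _ ≤ _ := le_add_of_nonneg_right (by positivity)
  · refine (F.le_one t).trans (le_add_of_nonneg_of_le (by positivity) ?_)
    rw [← exp_add]
    exact one_le_exp (by nlinarith)

lemma φ_mul_φ_le {C : ℝ} (hC : ∀ t, F.φ t ≤ C * exp (3 / 4 * r * t)) (t : ℝ) :
    F.φ t * F.φ (t - h) ≤ C ^ 2 * exp (3 / 2 * r * t) :=
  calc F.φ t * F.φ (t - h) ≤ (C * exp (3 / 4 * r * t)) * (C * exp (3 / 4 * r * t)) :=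
        mul_le_mul (hC t) ((F.shift_le t).trans (hC t)) (F.nonneg _) ((F.nonneg t).trans (hC t))
    _ = C ^ 2 * (exp (3 / 4 * r * t) * exp (3 / 4 * r * t)) := by ring
    _ = C ^ 2 * exp (3 / 2 * r * t) := by rw [← exp_add]; ring_nf

lemma exp_mul_φ_mul_φ_le {C : ℝ} (hC : ∀ t, F.φ t ≤ C * exp (3 / 4 * r * t)) (t : ℝ) :
    exp (-r * t) * (F.φ t * F.φ (t - h)) ≤ C ^ 2 * exp (r / 2 * t) := by
  have hexp : exp (-r * t) * exp (3 / 2 * r * t) = exp (r / 2 * t) := by rw [← exp_add]; ring_nf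
  calc exp (-r * t) * (F.φ t * F.φ (t - h))
      ≤ exp (-r * t) * (C ^ 2 * exp (3 / 2 * r * t)) :=
        mul_le_mul_of_nonneg_left (F.φ_mul_φ_le hC t) (exp_pos _).le
    _ = C ^ 2 * exp (r / 2 * t) := by rw [mul_left_comm, hexp]

/-- `L` is the limit of the flux at minus infinity, and `C` controls both the decay of the profile
and the distance of the flux from `L`. -/
structure FluxAsymptotics (F : Front b c h) (r L C : ℝ) : Prop where
  C_pos : 0 < C
  φ_le : ∀ t, F.φ t ≤ C * exp (3 / 4 * r * t)
  le_flux : ∀ t, L ≤ F.flux r t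
  flux_le : ∀ t, F.flux r t ≤ L + C * exp (r / 2 * t)

omit F in
lemma FluxAsymptotics.mono {F : Front b c h} {L C C' : ℝ} (hF : F.FluxAsymptotics r L C)
    (hC : C ≤ C') : F.FluxAsymptotics r L C' where
  C_pos := hF.C_pos.trans_le hC
  φ_le t := (hF.φ_le t).trans (mul_le_mul_of_nonneg_right hC (exp_pos _).le)
  le_flux := hF.le_flux
  flux_le t := (hF.flux_le t).trans
    (add_le_add_right (mul_le_mul_of_nonneg_right hC (exp_pos _).le) _)

omit F in
lemma FluxAsymptotics.tendsto_flux {F : Front b c h} {L C : ℝ} (hF : F.FluxAsymptotics r L C)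
    (hr : 0 < r) : Tendsto (F.flux r) atBot (𝓝 L) := by
  refine tendsto_of_tendsto_of_tendsto_of_le_of_le tendsto_const_nhds ?_ hF.le_flux hF.flux_le
  simpa using ((tendsto_exp_mul_atBot (half_pos hr)).const_mul C).const_add L

lemma exists_fluxAsymptotics (hr : IsLeadingRoot b c h r) :
    ∃ L C, L < 0 ∧ F.FluxAsymptotics r L C := by
  obtain ⟨C, hC, hφC⟩ := F.exists_φ_le_exp_mul hr
  have hr2 := half_pos hr.pos
  have hderiv := F.hasDerivAt_flux_of_chi_eq_zero hr.pos.le hr.chi_eq_zero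
  have hmono := F.monotone_flux hr.pos.le hr.chi_eq_zero.le
  have hbdd : BddBelow (range (F.flux r)) := by
    refine ⟨F.flux r 0 - C ^ 2 / (r / 2) * exp (r / 2 * 0), ?_⟩
    rintro _ ⟨t, rfl⟩
    have := sub_le_of_hasDerivAt_le_exp_mul hr2 (sq_nonneg C) (fun x _ => hderiv x)
      (fun x _ => F.exp_mul_φ_mul_φ_le hφC x) (min_le_right t 0)
    linarith [hmono (min_le_left t 0)]
  have hinf : ∀ t, ⨅ s, F.flux r s ≤ F.flux r t := ciInf_le hbdd
  have hstrict : F.flux r (-1) < F.flux r 0 :=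
    strictMono_of_deriv_pos (fun t => by
      rw [(hderiv t).deriv]
      exact mul_pos (exp_pos _) (mul_pos (F.pos _) (F.pos _))) (by norm_num)
  have hCr : 0 ≤ C ^ 2 / (r / 2) := by positivity
  refine ⟨_, C + C ^ 2 / (r / 2),
    (hinf (-1)).trans_lt (hstrict.trans_le (F.flux_nonpos hr.pos hr.chi_eq_zero.le 0)),
    by positivity, fun t => ?_, hinf, fun t => ?_⟩
  · exact (hφC t).trans
      (mul_le_mul_of_nonneg_right (le_add_of_nonneg_right hCr) (exp_pos _).le)
  · exact (le_add_of_hasDerivAt_le_exp_mul hr2 (sq_nonneg C) (fun x _ => hderiv x)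
      (fun x _ => F.exp_mul_φ_mul_φ_le hφC x) (tendsto_atBot_ciInf hmono hbdd)).trans
      (add_le_add_right
        (mul_le_mul_of_nonneg_right (le_add_of_nonneg_left hC.le) (exp_pos _).le) _)

/-- The front `t ↦ φ (t + s)`. -/
def translate (F : Front b c h) (s : ℝ) : Front b c h where
  φ t := F.φ (t + s)
  isProfile := F.isProfile.comp_add s
  b_nonneg := F.b_nonneg
  b_lt_one := F.b_lt_one
  c_pos := F.c_pos
  h_nonneg := F.h_nonneg

lemma translate_v (s t : ℝ) : (F.translate s).v t = F.v (t + s) := by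
  simp only [v_eq, translate, sub_add_eq_add_sub]

lemma translate_v' (s t : ℝ) : (F.translate s).v' t = F.v' (t + s) := by
  rw [v', funext (F.translate_v s), deriv_comp_add_const]
  rfl

lemma translate_flux (r s t : ℝ) :
    (F.translate s).flux r t = exp (r * s) * F.flux r (t + s) := by
  have hexp : ∀ x, exp (-r * x) = exp (r * s) * exp (-r * (x + s)) := fun x => by
    rw [← exp_add]; ring_nf
  have hint : ∫ x in (t - h)..t, exp (-r * x) * (F.translate s).φ x =
      exp (r * s) * ∫ x in (t + s - h)..(t + s), exp (-r * x) * F.φ x := by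
    rw [← sub_add_eq_add_sub,
      ← intervalIntegral.integral_comp_add_right (fun x => exp (-r * x) * F.φ x),
      ← intervalIntegral.integral_const_mul]
    refine intervalIntegral.integral_congr fun x _ => ?_
    dsimp only [translate]
    rw [hexp, mul_assoc]
  rw [flux, flux, hint, translate_v, translate_v', hexp t]
  ring

end Front

/-! ### Comparison of two fronts -/

lemma second_deriv_nonneg_of_isLocalMin {f f' : ℝ → ℝ} {d x : ℝ} (hmin : IsLocalMin f x)
    (hf : ∀ y, HasDerivAt f (f' y) y) (hf' : HasDerivAt f' d x) : 0 ≤ d := by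
  have hderiv : deriv f = f' := funext fun y => (hf y).deriv
  by_contra! hd
  have hmax : IsLocalMax f x := isLocalMax_of_deriv_deriv_neg (by rwa [hderiv, hf'.deriv])
    hmin.deriv_eq_zero (hf x).continuousAt
  have hconst : f =ᶠ[𝓝 x] fun _ => f x := by
    filter_upwards [hmin, hmax] with y hle hge using le_antisymm hge hle
  have hzero : deriv f' x = 0 := by
    rw [← hderiv, hconst.deriv.deriv_eq]
    simp
  exact hd.ne (hf'.deriv ▸ hzero)

/-- The difference of two functions with the weight `e^{-r t}`. -/
def wdiff (r : ℝ) (f g : ℝ → ℝ) (t : ℝ) : ℝ := exp (-r * t) * (f t - g t)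

lemma exp_mul_wdiff (r : ℝ) (f g : ℝ → ℝ) (t : ℝ) : exp (r * t) * wdiff r f g t = f t - g t := by
  rw [wdiff, ← mul_assoc, ← exp_add]
  simp

lemma wdiff_le_iff {r S t : ℝ} {f g : ℝ → ℝ} :
    wdiff r f g t ≤ S ↔ f t - g t ≤ S * exp (r * t) := by
  rw [← exp_mul_wdiff r f g t, mul_comm S]
  exact (mul_le_mul_iff_right₀ (exp_pos _)).symm

lemma wdiff_swap (r : ℝ) (f g : ℝ → ℝ) (t : ℝ) : wdiff r g f t = -wdiff r f g t := by
  unfold wdiff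
  ring

lemma hasDerivAt_wdiff {r t f' g' : ℝ} {f g : ℝ → ℝ} (hf : HasDerivAt f f' t)
    (hg : HasDerivAt g g' t) :
    HasDerivAt (wdiff r f g) (exp (-r * t) * (f' - g' + -r * (f t - g t))) t :=
  hasDerivAt_exp_mul_mul (-r) (hf.sub hg)

lemma continuous_wdiff {f g : ℝ → ℝ} (r : ℝ) (hf : Continuous f) (hg : Continuous g) :
    Continuous (wdiff r f g) := by
  unfold wdiff
  fun_prop

/-- The integral of `k` over the window `[t - h, t]` with an affine weight. -/
def momentWindow (α γ h : ℝ) (k : ℝ → ℝ) (t : ℝ) : ℝ :=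
  ∫ s in (t - h)..t, (α * (s - (t - h)) + γ) * k s

section
variable {α γ h : ℝ} {k : ℝ → ℝ} (hk : Continuous k)
include hk

lemma momentWindow_eq (t : ℝ) : momentWindow α γ h k t =
    α * ((∫ s in (t - h)..t, s * k s) - (t - h) * ∫ s in (t - h)..t, k s) +
      γ * ∫ s in (t - h)..t, k s := by
  have hint : ∀ f : ℝ → ℝ, Continuous f → IntervalIntegrable f volume (t - h) t :=
    fun f hf => hf.intervalIntegrable _ _
  rw [← intervalIntegral.integral_const_mul (t - h),
    ← intervalIntegral.integral_sub (hint _ (by fun_prop)) (hint _ (by fun_prop)),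
    ← intervalIntegral.integral_const_mul, ← intervalIntegral.integral_const_mul,
    ← intervalIntegral.integral_add (hint _ (by fun_prop)) (hint _ (by fun_prop))]
  exact intervalIntegral.integral_congr fun s _ => by ring

lemma hasDerivAt_momentWindow (t : ℝ) :
    HasDerivAt (momentWindow α γ h k)
      (α * (h * k t - ∫ s in (t - h)..t, k s) + γ * (k t - k (t - h))) t := by
  have hmoment := hasDerivAt_integral_sub_const (k := fun s => s * k s) (by fun_prop) h t
  have hmass := hasDerivAt_integral_sub_const hk h t
  rw [funext (momentWindow_eq hk)]
  refine (((hmoment.sub (((hasDerivAt_id t).sub_const h).mul hmass)).const_mul α).add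
    (hmass.const_mul γ)).congr_deriv ?_
  simp only [id]
  ring

variable {t : ℝ} (hα : 0 ≤ α) (hγ : 0 ≤ γ) (hh : 0 ≤ h) (hk0 : ∀ s, t - h ≤ s → s ≤ t → 0 ≤ k s)
include hα hγ hh hk0

omit hk in
lemma momentWindow_nonneg : 0 ≤ momentWindow α γ h k t :=
  intervalIntegral.integral_nonneg (sub_le_self t hh) fun s hs =>
    mul_nonneg (add_nonneg (mul_nonneg hα (sub_nonneg.2 hs.1)) hγ) (hk0 s hs.1 hs.2)

lemma momentWindow_le {K : ℝ} (hK : ∀ s, t - h ≤ s → s ≤ t → k s ≤ K) :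
    momentWindow α γ h k t ≤ h * ((α * h + γ) * K) := by
  refine integral_sub_const_le (by fun_prop) hh fun s hs hst =>
    mul_le_mul ?_ (hK s hs hst) (hk0 s hs hst) (by positivity)
  linarith [mul_le_mul_of_nonneg_left (by linarith : s - (t - h) ≤ h) hα]

end

namespace Front
variable {b c h : ℝ} (F G : Front b c h) {r S : ℝ}

lemma wdiff_v (r t : ℝ) : wdiff r F.v G.v t =
    wdiff r F.φ G.φ t - b * exp (-(r * h)) * wdiff r F.φ G.φ (t - h) := by
  have hexp : exp (-(r * h)) * exp (-r * (t - h)) = exp (-r * t) := by rw [← exp_add]; ring_nf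
  unfold wdiff
  rw [F.v_eq, G.v_eq]
  linear_combination b * (F.φ (t - h) - G.φ (t - h)) * hexp

lemma abs_wdiff_v_le (r t : ℝ) : |wdiff r F.v G.v t| ≤ exp (-r * t) := by
  rw [wdiff, abs_mul, abs_of_pos (exp_pos _)]
  refine mul_le_of_le_one_right (exp_pos _).le (abs_sub_le_iff.2 ⟨?_, ?_⟩)
  · linarith [F.v_le_one t, G.v_pos t]
  · linarith [G.v_le_one t, F.v_pos t]

lemma φ_sub_le (hr : 0 ≤ r) (hS : 0 ≤ S) (hv : ∀ t, F.v t - G.v t ≤ S * exp (r * t)) (t : ℝ) :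
    F.φ t - G.φ t ≤ S * (exp (r * t) / (1 - b * exp (-(r * h)))) := by
  have ha := F.one_sub_mul_exp_pos hr
  rw [← sub_nonneg]
  refine nonneg_of_shift F.b_nonneg F.b_lt_one (h := h) (C := 1)
    (D := fun t => S * (exp (r * t) / (1 - b * exp (-(r * h)))) - (F.φ t - G.φ t))
    (fun t => ?_) (fun t => ?_) t
  · have : 0 ≤ S * (exp (r * t) / (1 - b * exp (-(r * h)))) := by positivity
    linarith [F.le_one t, G.nonneg t]
  · have hvt := hv t
    rw [F.v_eq, G.v_eq, ← exp_div_sub_shift ha.ne'] at hvt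
    linarith

lemma wdiff_φ_le (hr : 0 ≤ r) (hS : 0 ≤ S) (hv : ∀ t, wdiff r F.v G.v t ≤ S) (t : ℝ) :
    wdiff r F.φ G.φ t ≤ S / (1 - b * exp (-(r * h))) := by
  rw [wdiff_le_iff, div_mul_eq_mul_div, ← mul_div_assoc']
  exact F.φ_sub_le G hr hS (fun t => wdiff_le_iff.1 (hv t)) t

lemma abs_wdiff_φ_le (hr : 0 ≤ r) (hv : ∀ t, |wdiff r F.v G.v t| ≤ S) (t : ℝ) :
    |wdiff r F.φ G.φ t| ≤ S / (1 - b * exp (-(r * h))) := by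
  have hS : 0 ≤ S := (abs_nonneg _).trans (hv 0)
  refine abs_le'.2 ⟨F.wdiff_φ_le G hr hS (fun t => (le_abs_self _).trans (hv t)) t, ?_⟩
  rw [← wdiff_swap]
  exact G.wdiff_φ_le F hr hS (fun t => by rw [wdiff_swap]; exact (neg_le_abs _).trans (hv t)) t

/-- `S` minus the weighted difference of the neutral parts, plus a weighted average of `K` minus
that of the profiles, so chosen that the delayed terms in its derivative combine to fluxes. -/
def gap (F G : Front b c h) (r S K t : ℝ) : ℝ :=
  S - wdiff r F.v G.v t +
    momentWindow (shiftRatio b h r) (h * shiftRatio b h r ^ 2) h (fun s => K - wdiff r F.φ G.φ s) t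

lemma integral_wdiff_φ (r K t : ℝ) : ∫ s in (t - h)..t, (K - wdiff r F.φ G.φ s) =
    h * K - ((∫ s in (t - h)..t, exp (-r * s) * F.φ s) -
      ∫ s in (t - h)..t, exp (-r * s) * G.φ s) := by
  rw [intervalIntegral.integral_sub (by simp)
    ((continuous_wdiff r F.continuous G.continuous).intervalIntegrable _ _),
    ← intervalIntegral.integral_sub ((F.continuous_exp_mul_φ r).intervalIntegrable _ _)
    ((G.continuous_exp_mul_φ r).intervalIntegrable _ _)]
  simp [wdiff, mul_sub]

lemma hasDerivAt_gap (hr : 0 ≤ r) (S K t : ℝ) : HasDerivAt (F.gap G r S K)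
    (-(F.flux r t - G.flux r t) - chiSlope b c h r * wdiff r F.v G.v t) t := by
  have hcont := continuous_wdiff r F.continuous G.continuous
  have ha := (F.one_sub_mul_exp_pos hr).ne'
  refine (((hasDerivAt_wdiff (r := r) (F.hasDerivAt_v t) (G.hasDerivAt_v t)).const_sub S).add
    (hasDerivAt_momentWindow (k := fun s => K - wdiff r F.φ G.φ s) (by fun_prop) t)).congr_deriv ?_
  have hpresent : h * shiftRatio b h r + h * shiftRatio b h r ^ 2 =
      h * (b * exp (-(r * h))) / (1 - b * exp (-(r * h))) ^ 2 := by
    rw [shiftRatio]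
    field_simp
    ring
  have hdelayed : h * shiftRatio b h r ^ 2 =
      h * (b * exp (-(r * h))) / (1 - b * exp (-(r * h))) ^ 2 * (b * exp (-(r * h))) := by
    rw [shiftRatio]
    field_simp
  have hwdiff : wdiff r F.v G.v t = exp (-r * t) * (F.v t - G.v t) := rfl
  rw [F.integral_wdiff_φ G]
  unfold flux chiSlope
  linear_combination (-wdiff r F.φ G.φ t) * hpresent + wdiff r F.φ G.φ (t - h) * hdelayed +
    (c - 2 * r) * hwdiff +
    h * (b * exp (-(r * h))) / (1 - b * exp (-(r * h))) ^ 2 * F.wdiff_v G r t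

end Front

/-- Two fronts with the same asymptotic flux. -/
structure FrontPair {b c h : ℝ} (F G : Front b c h) (r L C : ℝ) : Prop where
  isLeadingRoot : IsLeadingRoot b c h r
  fst : F.FluxAsymptotics r L C
  snd : G.FluxAsymptotics r L C

/-- The reaction terms at a point where the difference of the neutral parts touches its upper
barrier: primes denote delayed values, `A` and `ε * A` the barriers for the profiles. -/
lemma reaction_pos_of_touching {b ε A p p' q q' : ℝ} (hb : 0 ≤ b) (hε : 0 < 1 - b * ε)
    (hA : 0 < A) (hp : 0 < p) (hp' : 0 < p') (hq : 0 < q) (hq' : q' ≤ 1)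
    (hshift : ε * p ≤ p') (hle : p - q ≤ A) (hle' : q' - p' ≤ ε * A)
    (htouch : p - b * p' - (q - b * q') = A * (1 - b * ε)) :
    0 < A - (p - q) + (p * p' - q * q') := by
  rcases le_or_gt q' p' with h | h
  · have hbpq := mul_nonneg hb (sub_nonneg.2 h)
    have hpq : 0 < p - q := by linarith [mul_pos hA hε]
    linarith [mul_pos hpq hp', mul_nonneg hq.le (sub_nonneg.2 h)]
  · linarith [mul_nonneg (sub_nonneg.2 hle) (sub_nonneg.2 hq'),
      mul_nonneg hp.le (sub_nonneg.2 hle'), mul_pos hA (sub_pos.2 (hshift.trans_lt h))]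

namespace FrontPair
variable {b c h r L C : ℝ} {F G : Front b c h} (P : FrontPair F G r L C)
include P

lemma symm : FrontPair G F r L C := ⟨P.isLeadingRoot, P.snd, P.fst⟩

lemma r_pos : 0 < r := P.isLeadingRoot.pos

lemma one_sub_mul_exp_pos : 0 < 1 - b * exp (-(r * h)) := F.one_sub_mul_exp_pos P.r_pos.le

lemma growthBound : F.GrowthBound r :=
  F.growthBound_of_chi_eq_zero P.r_pos P.isLeadingRoot.chi_eq_zero

lemma sq_sub_mul : r ^ 2 - c * r = -(1 / (1 - b * exp (-(r * h)))) := by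
  have := P.isLeadingRoot.chi_eq_zero
  rw [chi] at this
  linarith

lemma r_lt_c : r < c := by
  nlinarith [P.r_pos, P.sq_sub_mul, one_div_pos.2 P.one_sub_mul_exp_pos]

lemma flux_sub_le (t : ℝ) : F.flux r t - G.flux r t ≤ C * exp (r / 2 * t) := by
  linarith [P.fst.flux_le t, P.snd.le_flux t]

lemma wdiff_v_lt {S : ℝ} (hS : 0 < S) (hv : ∀ t, |wdiff r F.v G.v t| ≤ S) (t : ℝ) :
    wdiff r F.v G.v t < S := by
  have hle : ∀ t, F.v t - G.v t ≤ S * exp (r * t) := fun t =>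
    wdiff_le_iff.1 ((le_abs_self _).trans (hv t))
  have hge : ∀ t, G.v t - F.v t ≤ S * exp (r * t) := fun t => wdiff_le_iff.1 (by
    rw [wdiff_swap]
    exact (neg_le_abs _).trans (hv t))
  refine lt_of_le_of_ne ((le_abs_self _).trans (hv t)) fun htouch => ?_
  have ha := P.one_sub_mul_exp_pos
  have htouch : F.v t - G.v t = S * exp (r * t) := by
    rw [← exp_mul_wdiff r, htouch, mul_comm]
  have hmin : IsLocalMin (fun t => S * exp (r * t) - (F.v t - G.v t)) t :=
    .of_forall fun s => by simpa [htouch] using hle s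
  have hderiv : ∀ t, HasDerivAt (fun t => S * exp (r * t) - (F.v t - G.v t))
      (S * (r * exp (r * t)) - (F.v' t - G.v' t)) t := fun t =>
    ((hasDerivAt_exp_mul r t).const_mul S).sub ((F.hasDerivAt_v t).sub (G.hasDerivAt_v t))
  have hfirst := hmin.hasDerivAt_eq_zero (hderiv t)
  have hsecond := second_deriv_nonneg_of_isLocalMin hmin hderiv
    ((((hasDerivAt_exp_mul r t).const_mul r).const_mul S).sub
      ((F.hasDerivAt_v' t).sub (G.hasDerivAt_v' t)))
  have hreaction := reaction_pos_of_touching F.b_nonneg ha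
    (by positivity : 0 < S * (exp (r * t) / (1 - b * exp (-(r * h)))))
    (F.pos t) (F.pos (t - h)) (G.pos t) (G.le_one (t - h)) (P.growthBound.exp_mul_le_shift t)
    (F.φ_sub_le G P.r_pos.le hS.le hle t)
    ((G.φ_sub_le F P.r_pos.le hS.le hge (t - h)).trans_eq (by rw [exp_mul_sub]; ring))
    (htouch.trans (by field_simp))
  have hcharacteristic : S * (r * (r * exp (r * t))) - c * (F.v' t - G.v' t) =
      -(S * (exp (r * t) / (1 - b * exp (-(r * h))))) := by
    linear_combination S * exp (r * t) * P.sq_sub_mul + c * hfirst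
  linarith

lemma exp_mul_φ_le_add {s t : ℝ} (hst : s ≤ t) :
    exp (-r * s) * F.φ s ≤ exp (-r * t) * F.φ t + -L / (1 - b) * (t - s) := by
  have hmono : Monotone fun t => exp (-r * t) * F.φ t + -L / (1 - b) * t := by
    refine monotone_of_hasDerivAt_nonneg (fun t => (hasDerivAt_exp_mul_mul (-r)
      (F.hasDerivAt_φ t)).add ((hasDerivAt_id t).const_mul _)) fun t => show 0 ≤ _ from ?_
    have hv : exp (-r * t) * F.vDefect r t ≤ -L := by
      linarith [P.growthBound.vDefect_add_chiSlope_mul_le t, P.fst.le_flux t,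
        mul_nonneg P.isLeadingRoot.chiSlope_nonneg
          (mul_nonneg (exp_pos (-r * t)).le (F.v_pos t).le)]
    have hφ : exp (-r * t) * F.φDefect r t ≤ -L / (1 - b) := by
      refine (mul_le_mul_of_nonneg_left (P.growthBound.φDefect_le t) (exp_pos _).le).trans ?_
      rw [← mul_div_assoc]
      exact div_le_div_of_nonneg_right hv F.one_sub_b_pos.le
    rw [Front.φDefect] at hφ
    linarith
  have hst' := hmono hst
  dsimp only at hst'
  linarith

lemma neg_div_nonneg : 0 ≤ -L / (1 - b) :=
  div_nonneg (neg_nonneg.2 ((P.fst.le_flux 0).trans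
    (F.flux_nonpos P.r_pos P.isLeadingRoot.chi_eq_zero.le 0))) F.one_sub_b_pos.le

lemma wdiff_φ_le_add {s t : ℝ} (hs : t - h ≤ s) (hst : s ≤ t) :
    wdiff r F.φ G.φ s ≤ wdiff r F.φ G.φ t + -L / (1 - b) * h := by
  have hG : exp (-r * t) * G.φ t ≤ exp (-r * s) * G.φ s :=
    P.symm.growthBound.antitone_exp_mul_φ hst
  have hlen : -L / (1 - b) * (t - s) ≤ -L / (1 - b) * h :=
    mul_le_mul_of_nonneg_left (by linarith) P.neg_div_nonneg
  unfold wdiff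
  linarith [P.exp_mul_φ_le_add hst]

lemma gap_le_of_chiSlope_eq_zero (hm : chiSlope b c h r = 0) {t : ℝ} (ht : t ≤ 0) :
    F.gap G r 0 0 t ≤ F.gap G r 0 0 0 + C / (r / 2) := by
  have := sub_le_of_hasDerivAt_le_exp_mul (half_pos P.r_pos) P.fst.C_pos.le
    (fun x _ => (F.hasDerivAt_gap G P.r_pos.le 0 0 x).neg)
    (fun x _ => by
      rw [hm]
      linarith [P.flux_sub_le x]) ht
  simp only [Pi.neg_apply, mul_zero, exp_zero, mul_one] at this
  linarith

lemma exists_neg_wdiff_φ_le (hm : chiSlope b c h r = 0) :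
    ∃ M, ∀ t ≤ 0, -wdiff r F.φ G.φ t ≤ M := by
  have ha := P.one_sub_mul_exp_pos
  have hh := F.h_nonneg
  set Q := -L / (1 - b) * h
  refine ⟨max Q ((F.gap G r 0 0 0 + C / (r / 2) + b * exp (-(r * h)) * Q) /
    (1 - b * exp (-(r * h)))), fun t ht => ?_⟩
  rcases le_or_gt (-wdiff r F.φ G.φ t) Q with hQ | hQ
  · exact hQ.trans (le_max_left _ _)
  refine le_trans ((le_div_iff₀ ha).2 ?_) (le_max_right _ _)
  have hwindow : 0 ≤ momentWindow (shiftRatio b h r) (h * shiftRatio b h r ^ 2) h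
      (fun s => 0 - wdiff r F.φ G.φ s) t :=
    momentWindow_nonneg (F.shiftRatio_nonneg P.r_pos.le) (by positivity) hh fun s hs hst => by
      linarith [P.wdiff_φ_le_add hs hst]
  have hgap := P.gap_le_of_chiSlope_eq_zero hm ht
  rw [Front.gap, F.wdiff_v] at hgap
  have hdelayed : wdiff r F.φ G.φ t ≤ wdiff r F.φ G.φ (t - h) + Q := by
    have := P.symm.wdiff_φ_le_add le_rfl (sub_le_self t hh)
    rw [wdiff_swap, wdiff_swap r F.φ] at this
    linarith
  linarith [mul_le_mul_of_nonneg_left hdelayed (mul_nonneg F.b_nonneg (exp_pos (-(r * h))).le)]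

lemma exists_abs_wdiff_v_le_of_chiSlope_eq_zero (hm : chiSlope b c h r = 0) :
    ∃ M, ∀ t, |wdiff r F.v G.v t| ≤ M := by
  obtain ⟨M₁, hM₁⟩ := P.exists_neg_wdiff_φ_le hm
  obtain ⟨M₂, hM₂⟩ := P.symm.exists_neg_wdiff_φ_le hm
  have hφ : ∀ t ≤ 0, |wdiff r F.φ G.φ t| ≤ max M₁ M₂ := fun t ht => by
    have hle := hM₂ t ht
    rw [wdiff_swap, neg_neg] at hle
    exact abs_le'.2 ⟨hle.trans (le_max_right _ _), (hM₁ t ht).trans (le_max_left _ _)⟩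
  refine ⟨max (2 * max M₁ M₂) 1, fun t => ?_⟩
  rcases le_total t 0 with ht | ht
  · refine le_trans ?_ (le_max_left _ _)
    have hdelayed := hφ (t - h) (by linarith [F.h_nonneg])
    have hβ : 0 ≤ b * exp (-(r * h)) := mul_nonneg F.b_nonneg (exp_pos _).le
    rw [F.wdiff_v]
    refine (abs_sub _ _).trans ?_
    rw [abs_mul, abs_of_nonneg hβ]
    have := mul_le_mul (by linarith [P.one_sub_mul_exp_pos] : b * exp (-(r * h)) ≤ 1) hdelayed
      (abs_nonneg _) zero_le_one
    linarith [hφ t ht]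
  · refine ((F.abs_wdiff_v_le G r t).trans (exp_le_one_iff.2 ?_)).trans (le_max_right _ _)
    linarith [mul_nonneg P.r_pos.le ht]

lemma exp_mul_v_le (hm : 0 < chiSlope b c h r) (t : ℝ) :
    exp (-r * t) * F.v t ≤ -L / chiSlope b c h r := by
  rw [le_div_iff₀ hm]
  linarith [P.growthBound.vDefect_add_chiSlope_mul_le t, P.fst.le_flux t,
    mul_nonneg (exp_pos (-r * t)).le (P.growthBound.vDefect_nonneg t)]

lemma exists_abs_wdiff_v_le : ∃ M, ∀ t, |wdiff r F.v G.v t| ≤ M := by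
  rcases P.isLeadingRoot.chiSlope_nonneg.eq_or_lt with hm | hm
  · exact P.exists_abs_wdiff_v_le_of_chiSlope_eq_zero hm.symm
  refine ⟨-L / chiSlope b c h r, fun t => ?_⟩
  have hF := mul_pos (exp_pos (-r * t)) (F.v_pos t)
  have hG := mul_pos (exp_pos (-r * t)) (G.v_pos t)
  rw [wdiff, mul_sub]
  exact abs_sub_le_iff.2 ⟨by linarith [P.exp_mul_v_le hm t], by linarith [P.symm.exp_mul_v_le hm t]⟩

end FrontPair

/-! ### The extremal gap near minus infinity -/

namespace Front
variable {b c h : ℝ} (F G : Front b c h) {r S ρ K : ℝ}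

/-- The distance of the difference of the neutral parts from the barrier `S e^{rt} + K e^{ρt}`. -/
def vBarrier (F G : Front b c h) (r S ρ K t : ℝ) : ℝ :=
  S * exp (r * t) - (F.v t - G.v t) + K * exp (ρ * t)

/-- The derivative of `vBarrier`. -/
def vBarrier' (F G : Front b c h) (r S ρ K t : ℝ) : ℝ :=
  S * (r * exp (r * t)) - (F.v' t - G.v' t) + K * (ρ * exp (ρ * t))

/-- The counterpart of `vBarrier` for the profiles, whose neutral difference is `vBarrier`. -/
def φBarrier (F G : Front b c h) (r S ρ K t : ℝ) : ℝ :=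
  S * (exp (r * t) / (1 - b * exp (-(r * h)))) - (F.φ t - G.φ t) +
    K * (exp (ρ * t) / (1 - b * exp (-(ρ * h))))

/-- The gap for the extremal value `S` of the weighted difference of the neutral parts, for which
the weighted difference of the profiles is at most `S / (1 - b e^{-rh})`. -/
def extremalGap (F G : Front b c h) (r S : ℝ) : ℝ → ℝ :=
  F.gap G r S (S / (1 - b * exp (-(r * h))))

lemma hasDerivAt_vBarrier (r S ρ K t : ℝ) :
    HasDerivAt (F.vBarrier G r S ρ K) (F.vBarrier' G r S ρ K t) t :=
  (((hasDerivAt_exp_mul r t).const_mul S).sub ((F.hasDerivAt_v t).sub (G.hasDerivAt_v t))).add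
    ((hasDerivAt_exp_mul ρ t).const_mul K)

lemma vBarrier_eq (r S ρ K t : ℝ) : F.vBarrier G r S ρ K t =
    exp (r * t) * (S - wdiff r F.v G.v t + K * exp ((ρ - r) * t)) := by
  have hexp : exp (r * t) * exp ((ρ - r) * t) = exp (ρ * t) := by rw [← exp_add]; ring_nf
  rw [vBarrier, ← exp_mul_wdiff r, ← hexp]
  ring

lemma φBarrier_sub_shift (hr : 0 ≤ r) (hρ : 0 ≤ ρ) (t : ℝ) :
    F.φBarrier G r S ρ K t - b * F.φBarrier G r S ρ K (t - h) = F.vBarrier G r S ρ K t := by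
  unfold φBarrier vBarrier
  rw [F.v_eq, G.v_eq]
  linear_combination S * exp_div_sub_shift (F.one_sub_mul_exp_pos hr).ne' t +
    K * exp_div_sub_shift (F.one_sub_mul_exp_pos hρ).ne' t

section
variable (hr : 0 ≤ r) (hv : ∀ t, |wdiff r F.v G.v t| ≤ S)
include hr hv

lemma sub_wdiff_φ_nonneg (t : ℝ) : 0 ≤ S / (1 - b * exp (-(r * h))) - wdiff r F.φ G.φ t :=
  sub_nonneg.2 ((le_abs_self _).trans (F.abs_wdiff_φ_le G hr hv t))

lemma sub_wdiff_v_le_extremalGap (t : ℝ) : S - wdiff r F.v G.v t ≤ F.extremalGap G r S t :=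
  le_add_of_nonneg_right (momentWindow_nonneg (F.shiftRatio_nonneg hr)
    (mul_nonneg F.h_nonneg (sq_nonneg _)) F.h_nonneg
      fun s _ _ => F.sub_wdiff_φ_nonneg G hr hv s)

variable (hρ : 0 ≤ ρ) (hK : 0 ≤ K)
include hρ hK

omit hr hv in
lemma exp_mul_sub_wdiff_φ_le_φBarrier (t : ℝ) :
    exp (r * t) * (S / (1 - b * exp (-(r * h))) - wdiff r F.φ G.φ t) ≤ F.φBarrier G r S ρ K t := by
  have ha := F.one_sub_mul_exp_pos hρ
  have hK' : 0 ≤ K * (exp (ρ * t) / (1 - b * exp (-(ρ * h)))) := by positivity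
  rw [mul_sub, exp_mul_wdiff, φBarrier, mul_div_left_comm]
  linarith

lemma φBarrier_nonneg (t : ℝ) : 0 ≤ F.φBarrier G r S ρ K t :=
  (mul_nonneg (exp_pos _).le (F.sub_wdiff_φ_nonneg G hr hv t)).trans
    (F.exp_mul_sub_wdiff_φ_le_φBarrier G hρ hK t)

lemma exists_φBarrier_le : ∃ M, ∀ t ≤ 0, F.φBarrier G r S ρ K t ≤ M := by
  have hS : 0 ≤ S := (abs_nonneg _).trans (hv 0)
  have har := F.one_sub_mul_exp_pos hr
  have haρ := F.one_sub_mul_exp_pos hρ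
  refine ⟨S * (1 / (1 - b * exp (-(r * h)))) + 1 + K * (1 / (1 - b * exp (-(ρ * h)))),
    fun t ht => add_le_add (sub_le_iff_le_add.2 ?_) ?_⟩
  · have hexp : exp (r * t) ≤ 1 := exp_le_one_iff.2 (mul_nonpos_of_nonneg_of_nonpos hr ht)
    have : S * (exp (r * t) / (1 - b * exp (-(r * h)))) ≤ S * (1 / (1 - b * exp (-(r * h)))) := by
      gcongr
    linarith [F.nonneg t, G.le_one t]
  · have hexp : exp (ρ * t) ≤ 1 := exp_le_one_iff.2 (mul_nonpos_of_nonneg_of_nonpos hρ ht)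
    gcongr

variable (hmono : MonotoneOn (F.vBarrier G r S ρ K) (Iic 0))
include hmono

lemma monotoneOn_φBarrier : MonotoneOn (F.φBarrier G r S ρ K) (Iic 0) := by
  intro s _ t ht hst
  obtain ⟨M, hM⟩ := F.exists_φBarrier_le G hr hv hρ hK
  have hd : 0 ≤ t - s := sub_nonneg.2 hst
  have hincrement := nonneg_of_mul_comp_le F.b_nonneg F.b_lt_one (T := (· - h)) (s := Iic 0)
    (fun x hx => (sub_le_self x F.h_nonneg).trans hx) (C := M)
    (D := fun x => F.φBarrier G r S ρ K x - F.φBarrier G r S ρ K (x - (t - s)))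
    (fun x hx => by
      have hx' : x - (t - s) ≤ 0 := (sub_le_self x hd).trans hx
      linarith [hM _ hx', F.φBarrier_nonneg G hr hv hρ hK x])
    (fun x hx => by
      have hx' : x - (t - s) ≤ 0 := (sub_le_self x hd).trans hx
      have hle := hmono hx' hx (sub_le_self x hd)
      rw [← F.φBarrier_sub_shift G hr hρ, ← F.φBarrier_sub_shift G hr hρ,
        sub_right_comm x (t - s)] at hle
      linarith) t ht
  simpa using hincrement

lemma φBarrier_le {t : ℝ} (ht : t ≤ 0) :
    F.φBarrier G r S ρ K t ≤ F.vBarrier G r S ρ K t / (1 - b) := by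
  have hdelayed : F.φBarrier G r S ρ K (t - h) ≤ F.φBarrier G r S ρ K t :=
    F.monotoneOn_φBarrier G hr hv hρ hK hmono ((sub_le_self t F.h_nonneg).trans ht) ht
      (sub_le_self t F.h_nonneg)
  rw [le_div_iff₀ F.one_sub_b_pos, ← F.φBarrier_sub_shift G hr hρ]
  linarith [mul_le_mul_of_nonneg_left hdelayed F.b_nonneg]

lemma sub_wdiff_φ_le {s t : ℝ} (hs : t - h ≤ s) (hst : s ≤ t) (ht : t ≤ 0) :
    S / (1 - b * exp (-(r * h))) - wdiff r F.φ G.φ s ≤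
      exp (r * h) / (1 - b) * (S - wdiff r F.v G.v t + K * exp ((ρ - r) * t)) := by
  set Q := S - wdiff r F.v G.v t + K * exp ((ρ - r) * t)
  have hQ : 0 ≤ Q := add_nonneg (sub_nonneg.2 ((le_abs_self _).trans (hv t))) (by positivity)
  have hb := F.one_sub_b_pos
  have hexp : exp (r * t) ≤ exp (r * s) * exp (r * h) := by
    rw [← exp_add, exp_le_exp, ← mul_add]
    exact mul_le_mul_of_nonneg_left (by linarith) hr
  refine le_of_mul_le_mul_left ?_ (exp_pos (r * s))
  calc exp (r * s) * (S / (1 - b * exp (-(r * h))) - wdiff r F.φ G.φ s)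
      ≤ F.φBarrier G r S ρ K s := F.exp_mul_sub_wdiff_φ_le_φBarrier G hρ hK s
    _ ≤ F.φBarrier G r S ρ K t :=
        F.monotoneOn_φBarrier G hr hv hρ hK hmono (hst.trans ht) ht hst
    _ ≤ F.vBarrier G r S ρ K t / (1 - b) := F.φBarrier_le G hr hv hρ hK hmono ht
    _ = exp (r * t) * Q / (1 - b) := by rw [F.vBarrier_eq]
    _ ≤ exp (r * s) * exp (r * h) * Q / (1 - b) := by gcongr
    _ = exp (r * s) * (exp (r * h) / (1 - b) * Q) := by ring

lemma exists_extremalGap_le_of_monotoneOn : ∃ A, 0 < A ∧ ∀ t ≤ 0,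
    F.extremalGap G r S t ≤ A * (S - wdiff r F.v G.v t + exp ((ρ - r) * t)) := by
  have hb := F.one_sub_b_pos
  have hh := F.h_nonneg
  have hα : 0 ≤ shiftRatio b h r := F.shiftRatio_nonneg hr
  set α := shiftRatio b h r
  set m := h * (α * h + h * α ^ 2) * (exp (r * h) / (1 - b))
  have hm : 0 ≤ m := by positivity
  refine ⟨1 + m * (1 + K), by positivity, fun t ht => ?_⟩
  have hcont := continuous_wdiff r F.continuous G.continuous
  have hwindow := momentWindow_le (α := α) (γ := h * α ^ 2)
    (k := fun s => S / (1 - b * exp (-(r * h))) - wdiff r F.φ G.φ s) (by fun_prop) hα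
    (by positivity) hh (fun s _ _ => F.sub_wdiff_φ_nonneg G hr hv s)
    fun s hs hst => F.sub_wdiff_φ_le G hr hv hρ hK hmono hs hst ht
  set Q := S - wdiff r F.v G.v t
  have hQ : 0 ≤ Q := sub_nonneg.2 ((le_abs_self _).trans (hv t))
  calc F.extremalGap G r S t ≤ Q + m * (Q + K * exp ((ρ - r) * t)) := by
        refine (add_le_add_right hwindow Q).trans_eq ?_
        ring
    _ ≤ (1 + m * (1 + K)) * (Q + exp ((ρ - r) * t)) := by
        have hexp := (exp_pos ((ρ - r) * t)).le
        linarith [mul_nonneg hm hexp, mul_nonneg (mul_nonneg hm hK) hQ]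

end

end Front

namespace FrontPair
variable {b c h r L C S : ℝ} {F G : Front b c h} (P : FrontPair F G r L C)
  (hv : ∀ t, |wdiff r F.v G.v t| ≤ S)
include P hv

lemma antitoneOn_exp_mul_vBarrier' {ρ : ℝ} (hρ0 : 0 < ρ) (hρr : ρ ≤ 3 / 2 * r) (hρc : ρ < c) :
    AntitoneOn (fun t => exp (-c * t) * F.vBarrier' G r S ρ (C ^ 2 / (ρ * (c - ρ))) t) (Iic 0) := by
  have hS : 0 ≤ S := (abs_nonneg _).trans (hv 0)
  set K := C ^ 2 / (ρ * (c - ρ))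
  refine antitoneOn_of_hasDerivAt_nonpos (convex_Iic 0) (fun t _ => hasDerivAt_exp_mul_mul (-c)
    (((((hasDerivAt_exp_mul r t).const_mul r).const_mul S).sub
      ((F.hasDerivAt_v' t).sub (G.hasDerivAt_v' t))).add
      (((hasDerivAt_exp_mul ρ t).const_mul ρ).const_mul K))) fun t ht => ?_
  refine mul_nonpos_of_nonneg_of_nonpos (exp_pos _).le ?_
  have hlinear := F.φ_sub_le G P.r_pos.le hS
    (fun t => wdiff_le_iff.1 ((le_abs_self _).trans (hv t))) t
  have hquad : G.φ t * G.φ (t - h) ≤ C ^ 2 * exp (ρ * t) :=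
    (G.φ_mul_φ_le P.snd.φ_le t).trans (mul_le_mul_of_nonneg_left
      (exp_le_exp.2 (mul_le_mul_of_nonpos_right hρr ht)) (sq_nonneg C))
  have hchar_r : S * (r * (r * exp (r * t))) - c * (S * (r * exp (r * t))) =
      -(S * (exp (r * t) / (1 - b * exp (-(r * h))))) := by
    linear_combination S * exp (r * t) * P.sq_sub_mul
  have hK : K * (ρ * (c - ρ)) = C ^ 2 :=
    div_mul_cancel₀ _ (mul_pos hρ0 (sub_pos.2 hρc)).ne'
  have hchar_ρ : K * (ρ * (ρ * exp (ρ * t))) - c * (K * (ρ * exp (ρ * t))) =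
      -(C ^ 2 * exp (ρ * t)) := by
    linear_combination -exp (ρ * t) * hK
  unfold Front.vBarrier'
  linarith [mul_nonneg (F.nonneg t) (F.nonneg (t - h))]

lemma exists_monotoneOn_vBarrier :
    ∃ ρ K, r < ρ ∧ 0 < K ∧ MonotoneOn (F.vBarrier G r S ρ K) (Iic 0) := by
  obtain ⟨ρ, hrρ, hρ⟩ := exists_between (lt_min (by linarith [P.r_pos] : r < 3 / 2 * r) P.r_lt_c)
  have hρ0 : 0 < ρ := P.r_pos.trans hrρ
  have hρc : ρ < c := hρ.trans_le (min_le_right _ _)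
  have hanti := P.antitoneOn_exp_mul_vBarrier' hv hρ0 (hρ.le.trans (min_le_left _ _)) hρc
  set K := C ^ 2 / (ρ * (c - ρ))
  have hK : 0 < K := div_pos (pow_pos P.fst.C_pos 2) (mul_pos hρ0 (sub_pos.2 hρc))
  set M := |F.vBarrier' G r S ρ K 0|
  refine ⟨ρ, K + M / ρ, hrρ, by positivity, monotoneOn_of_hasDerivAt_nonneg (convex_Iic 0)
    (fun t _ => F.hasDerivAt_vBarrier G r S ρ _ t) fun t ht => ?_⟩
  have hM : -M ≤ exp (-c * t) * F.vBarrier' G r S ρ K t := by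
    have := hanti ht self_mem_Iic ht
    dsimp only at this
    rw [mul_zero, exp_zero, one_mul] at this
    exact (neg_abs_le _).trans this
  have hexp : exp (c * t) ≤ exp (ρ * t) := exp_le_exp.2 (mul_le_mul_of_nonpos_right hρc.le ht)
  have hlower : -(M * exp (c * t)) ≤ F.vBarrier' G r S ρ K t :=
    calc -(M * exp (c * t)) = exp (c * t) * -M := by ring
      _ ≤ exp (c * t) * (exp (-c * t) * F.vBarrier' G r S ρ K t) :=
        mul_le_mul_of_nonneg_left hM (exp_pos _).le
      _ = F.vBarrier' G r S ρ K t := by rw [← mul_assoc, ← exp_add]; simp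
  have hadd : F.vBarrier' G r S ρ (K + M / ρ) t = F.vBarrier' G r S ρ K t + M * exp (ρ * t) := by
    unfold Front.vBarrier'
    field_simp
    ring
  rw [hadd]
  linarith [mul_le_mul_of_nonneg_left hexp (abs_nonneg (F.vBarrier' G r S ρ K 0))]

lemma exists_extremalGap_le : ∃ A δ, 0 < A ∧ 0 < δ ∧ ∀ t ≤ 0,
    F.extremalGap G r S t ≤ A * (S - wdiff r F.v G.v t + exp (δ * t)) := by
  obtain ⟨ρ, K, hrρ, hK, hmono⟩ := P.exists_monotoneOn_vBarrier hv
  obtain ⟨A, hA, hgap⟩ := F.exists_extremalGap_le_of_monotoneOn G P.r_pos.le hv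
    (P.r_pos.trans hrρ).le hK.le hmono
  exact ⟨A, ρ - r, hA, sub_pos.2 hrρ, hgap⟩

end FrontPair

/-! ### Uniqueness up to translation -/

lemma exists_exp_mul_le {δ κ : ℝ} (hδ : 0 < δ) (hκ : 0 < κ) :
    ∃ T ≤ 0, ∀ t ≤ T, exp (δ * t) ≤ κ := by
  obtain ⟨T, hT⟩ := eventually_atBot.1 ((tendsto_exp_mul_atBot hδ).eventually (gt_mem_nhds hκ))
  exact ⟨min T 0, min_le_right _ _, fun t ht => (hT t (ht.trans (min_le_left _ _))).le⟩

namespace FrontPair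
variable {b c h r L C S : ℝ} {F G : Front b c h} (P : FrontPair F G r L C)
  (hv : ∀ t, |wdiff r F.v G.v t| ≤ S)
include P hv

section
variable (hS : 0 < S) (hsup : ∀ ε, 0 < ε → ∃ t, S - ε < wdiff r F.v G.v t)
include hS hsup

lemma exists_le_sub_lt_wdiff (T : ℝ) {ε : ℝ} (hε : 0 < ε) :
    ∃ t ≤ T, S - ε < wdiff r F.v G.v t := by
  obtain ⟨T', hT'⟩ := eventually_atTop.1
    ((tendsto_exp_neg_mul_atTop P.r_pos).eventually (gt_mem_nhds (half_pos hS)))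
  obtain ⟨x, -, hx⟩ := isCompact_Icc.exists_isMaxOn (nonempty_Icc.2 (le_max_left T T'))
    (continuous_wdiff r F.continuous_v G.continuous_v).continuousOn
  have hxS : 0 < S - wdiff r F.v G.v x := sub_pos.2 (P.wdiff_v_lt hS hv x)
  obtain ⟨t, ht⟩ := hsup (min ε (min (S - wdiff r F.v G.v x) (S / 2)))
    (lt_min hε (lt_min hxS (half_pos hS)))
  rw [sub_lt_comm, lt_min_iff, lt_min_iff] at ht
  obtain ⟨htε, htx, htS⟩ := ht
  refine ⟨t, ?_, by linarith⟩
  by_contra! hlt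
  rcases le_total t (max T T') with hle | hge
  · have hmax : wdiff r F.v G.v t ≤ wdiff r F.v G.v x := hx ⟨hlt.le, hle⟩
    linarith
  · have hsmall := hT' t ((le_max_right _ _).trans hge)
    linarith [(le_abs_self _).trans (F.abs_wdiff_v_le G r t)]

lemma exists_extremalGap_le_of_pos (T : ℝ) {κ : ℝ} (hκ : 0 < κ) :
    ∃ t ≤ T, F.extremalGap G r S t ≤ κ := by
  obtain ⟨A, δ, hA, hδ, hgap⟩ := P.exists_extremalGap_le hv
  have hε : 0 < κ / (2 * A) := by positivity
  obtain ⟨T₀, hT₀, hexp⟩ := exists_exp_mul_le hδ hε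
  obtain ⟨t, ht, htS⟩ := P.exists_le_sub_lt_wdiff hv hS hsup (min T T₀) hε
  have htT₀ : t ≤ T₀ := ht.trans (min_le_right _ _)
  refine ⟨t, ht.trans (min_le_left _ _), ?_⟩
  calc F.extremalGap G r S t ≤ A * (S - wdiff r F.v G.v t + exp (δ * t)) :=
        hgap t (htT₀.trans hT₀)
    _ ≤ A * (κ / (2 * A) + κ / (2 * A)) :=
        mul_le_mul_of_nonneg_left (by linarith [hexp t htT₀]) hA.le
    _ = κ := by field_simp; ring

end

lemma extremalGap_nonneg (t : ℝ) : 0 ≤ F.extremalGap G r S t :=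
  (sub_nonneg.2 ((le_abs_self _).trans (hv t))).trans
    (F.sub_wdiff_v_le_extremalGap G P.r_pos.le hv t)

lemma exists_antitoneOn_exp_mul_extremalGap_sub (hS : 0 < S) (hm : 0 < chiSlope b c h r) :
    ∃ T, AntitoneOn (fun t => exp (-chiSlope b c h r * t) * (F.extremalGap G r S t - S / 2))
      (Iic T) := by
  have hC := P.fst.C_pos
  set m := chiSlope b c h r with hm_def
  obtain ⟨T, -, hT⟩ := exists_exp_mul_le (half_pos P.r_pos)
    (by positivity : 0 < m * S / 2 / C)
  refine ⟨T, antitoneOn_of_hasDerivAt_nonpos (convex_Iic T) (fun t _ => hasDerivAt_exp_mul_mul (-m)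
    ((F.hasDerivAt_gap G P.r_pos.le S _ t).sub_const (S / 2))) fun t ht => ?_⟩
  refine mul_nonpos_of_nonneg_of_nonpos (exp_pos _).le ?_
  have hexp := hT t ht
  rw [le_div_iff₀ hC] at hexp
  have hgap := mul_le_mul_of_nonneg_left (F.sub_wdiff_v_le_extremalGap G P.r_pos.le hv t) hm.le
  rw [← hm_def]
  unfold Front.extremalGap at hgap ⊢
  linarith [P.symm.flux_sub_le t]

lemma exists_wdiff_le_sub_of_chiSlope_pos (hS : 0 < S) (hm : 0 < chiSlope b c h r) :
    ∃ ε, 0 < ε ∧ ∀ t, wdiff r F.v G.v t ≤ S - ε := by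
  by_contra! hsup
  obtain ⟨T, hanti⟩ := P.exists_antitoneOn_exp_mul_extremalGap_sub hv hS hm
  set m := chiSlope b c h r
  have hm' : 0 < 1 / m := one_div_pos.2 hm
  obtain ⟨t, ht, hgap⟩ := P.exists_extremalGap_le_of_pos hv hS hsup (T - 1 / m)
    (by positivity : 0 < S / 4)
  have hstep : exp (-m * (t + 1 / m)) * (F.extremalGap G r S (t + 1 / m) - S / 2) ≤
      exp (-m * t) * (F.extremalGap G r S t - S / 2) :=
    hanti (mem_Iic.2 (by linarith)) (mem_Iic.2 (by linarith)) (by linarith)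
  have hexp : exp (-m * t) = exp (-m * (t + 1 / m)) * exp 1 := by
    rw [← exp_add]
    congr 1
    field_simp
    ring
  rw [hexp, mul_assoc] at hstep
  have hlower := le_of_mul_le_mul_left hstep (exp_pos _)
  have htwo : 2 < exp 1 := by linarith [add_one_lt_exp (one_ne_zero (α := ℝ))]
  have hupper : exp 1 * (F.extremalGap G r S t - S / 2) ≤ exp 1 * (-(S / 4)) :=
    mul_le_mul_of_nonneg_left (by linarith) (exp_pos 1).le
  linarith [P.extremalGap_nonneg hv (t + 1 / m), mul_lt_mul_of_pos_right htwo hS]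

section
variable {K T t : ℝ} (hK : ∀ t ≤ T, F.extremalGap G r S t ≤ K) (ht : t ≤ T)
include hK ht

lemma neg_le_wdiff_φ : -(K / (1 - b * exp (-(r * h)))) ≤ wdiff r F.φ G.φ t := by
  have ha := P.one_sub_mul_exp_pos
  have hK0 : 0 ≤ K := (P.extremalGap_nonneg hv t).trans (hK t ht)
  set a := 1 - b * exp (-(r * h)) with ha_def
  have hβ : b * exp (-(r * h)) = 1 - a := by rw [ha_def]; ring
  have hdiff := nonneg_of_mul_comp_le (mul_nonneg F.b_nonneg (exp_pos (-(r * h))).le)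
    (by linarith : b * exp (-(r * h)) < 1) (T := (· - h)) (s := Iic T)
    (fun x hx => (sub_le_self x F.h_nonneg).trans hx) (C := 2 * (S / a))
    (D := fun t => K / a - (S / a - wdiff r F.φ G.φ t)) (fun t _ => ?_) (fun t ht => ?_) t ht
  · have hS : 0 ≤ S / a := div_nonneg ((abs_nonneg _).trans (hv 0)) ha.le
    linarith
  · have hK' : 0 ≤ K / a := by positivity
    linarith [(abs_le.1 (F.abs_wdiff_φ_le G P.r_pos.le hv t)).1]
  · have hgap := (F.sub_wdiff_v_le_extremalGap G P.r_pos.le hv t).trans (hK t ht)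
    rw [F.wdiff_v, hβ] at hgap
    have hKa : a * (K / a) = K := mul_div_cancel₀ _ ha.ne'
    have hSa : a * (S / a) = S := mul_div_cancel₀ _ ha.ne'
    rw [hβ]
    linarith

lemma exp_mul_φ_mul_φ_sub_le : exp (-r * t) * (G.φ t * G.φ (t - h)) -
    exp (-r * t) * (F.φ t * F.φ (t - h)) ≤
      2 * (K / (1 - b * exp (-(r * h)))) * C * exp (3 / 4 * r * t) := by
  have hpresent := P.neg_le_wdiff_φ hv hK ht
  have hdelayed := P.neg_le_wdiff_φ hv hK ((sub_le_self t F.h_nonneg).trans ht)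
  have hQ : 0 ≤ K / (1 - b * exp (-(r * h))) :=
    div_nonneg ((P.extremalGap_nonneg hv t).trans (hK t ht)) P.one_sub_mul_exp_pos.le
  set Q := K / (1 - b * exp (-(r * h)))
  have hexp : exp (-(r * h)) * exp (-r * (t - h)) = exp (-r * t) := by rw [← exp_add]; ring_nf
  have hfirst : F.φ (t - h) * -wdiff r F.φ G.φ t ≤ C * exp (3 / 4 * r * t) * Q :=
    (mul_le_mul_of_nonneg_left (neg_le.1 hpresent) (F.nonneg _)).trans
      (mul_le_mul_of_nonneg_right ((F.shift_le t).trans (P.fst.φ_le t)) hQ)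
  have hβ : exp (-(r * h)) ≤ 1 :=
    exp_le_one_iff.2 (neg_nonpos.2 (mul_nonneg P.r_pos.le F.h_nonneg))
  have hsecond : G.φ t * (exp (-(r * h)) * -wdiff r F.φ G.φ (t - h)) ≤
      C * exp (3 / 4 * r * t) * Q :=
    calc G.φ t * (exp (-(r * h)) * -wdiff r F.φ G.φ (t - h)) ≤ G.φ t * (1 * Q) :=
          mul_le_mul_of_nonneg_left ((mul_le_mul_of_nonneg_left (neg_le.1 hdelayed)
            (exp_pos _).le).trans (mul_le_mul_of_nonneg_right hβ hQ)) (G.nonneg t)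
      _ ≤ C * exp (3 / 4 * r * t) * Q := by
          rw [one_mul]
          exact mul_le_mul_of_nonneg_right (P.snd.φ_le t) hQ
  calc exp (-r * t) * (G.φ t * G.φ (t - h)) - exp (-r * t) * (F.φ t * F.φ (t - h))
      = F.φ (t - h) * -wdiff r F.φ G.φ t +
        G.φ t * (exp (-(r * h)) * -wdiff r F.φ G.φ (t - h)) := by
        unfold wdiff
        linear_combination (G.φ t * (F.φ (t - h) - G.φ (t - h))) * hexp
    _ ≤ 2 * Q * C * exp (3 / 4 * r * t) := by linarith

lemma flux_sub_le_of_extremalGap_le : G.flux r t - F.flux r t ≤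
    2 * (K / (1 - b * exp (-(r * h)))) * C / (3 / 4 * r) * exp (3 / 4 * r * t) := by
  have hχ := P.isLeadingRoot.chi_eq_zero
  have hQ : 0 ≤ K / (1 - b * exp (-(r * h))) :=
    div_nonneg ((P.extremalGap_nonneg hv t).trans (hK t ht)) P.one_sub_mul_exp_pos.le
  have hlim : Tendsto (fun t => G.flux r t - F.flux r t) atBot (𝓝 0) := by
    simpa using (P.snd.tendsto_flux P.r_pos).sub (P.fst.tendsto_flux P.r_pos)
  have := le_add_of_hasDerivAt_le_exp_mul (by linarith [P.r_pos] : 0 < 3 / 4 * r)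
    (mul_nonneg (mul_nonneg zero_le_two hQ) P.fst.C_pos.le)
    (fun x _ => (G.hasDerivAt_flux_of_chi_eq_zero P.r_pos.le hχ x).sub
      (F.hasDerivAt_flux_of_chi_eq_zero P.r_pos.le hχ x))
    (fun x hx => P.exp_mul_φ_mul_φ_sub_le hv hK (hx.trans ht)) hlim
  rwa [zero_add] at this

end

section
variable (hm : chiSlope b c h r = 0)
include hm

omit hv in
lemma hasDerivAt_extremalGap (S t : ℝ) :
    HasDerivAt (F.extremalGap G r S) (G.flux r t - F.flux r t) t :=
  (F.hasDerivAt_gap G P.r_pos.le S _ t).congr_deriv (by rw [hm]; ring)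

variable (hS : 0 < S) (hsup : ∀ ε, 0 < ε → ∃ t, S - ε < wdiff r F.v G.v t)
include hS hsup

lemma extremalGap_le_exp_mul (t : ℝ) :
    F.extremalGap G r S t ≤ C / (r / 2) * exp (r / 2 * t) := by
  refine le_of_forall_pos_le_add fun κ hκ => ?_
  obtain ⟨s, hs, hgap⟩ := P.exists_extremalGap_le_of_pos hv hS hsup t hκ
  linarith [sub_le_of_hasDerivAt_le_exp_mul (half_pos P.r_pos) P.fst.C_pos.le
    (fun x _ => P.hasDerivAt_extremalGap hm S x) (fun x _ => P.symm.flux_sub_le x) hs]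

lemma tendsto_extremalGap : Tendsto (F.extremalGap G r S) atBot (𝓝 0) :=
  squeeze_zero (P.extremalGap_nonneg hv) (P.extremalGap_le_exp_mul hv hm hS hsup)
    (by simpa using (tendsto_exp_mul_atBot (half_pos P.r_pos)).const_mul (C / (r / 2)))

lemma exists_extremalGap_le_half : ∃ T, ∀ K, (∀ t ≤ T, F.extremalGap G r S t ≤ K) →
    ∀ t ≤ T, F.extremalGap G r S t ≤ K / 2 := by
  have hr := P.r_pos
  have hC := P.fst.C_pos
  have ha := P.one_sub_mul_exp_pos
  set a := 1 - b * exp (-(r * h))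
  set δ := 3 / 4 * r
  have hδ : 0 < δ := by positivity
  obtain ⟨T, -, hT⟩ := exists_exp_mul_le hδ (by positivity : 0 < a * δ ^ 2 / (4 * C))
  refine ⟨T, fun K hK t ht => ?_⟩
  have hK0 : 0 ≤ K := (P.extremalGap_nonneg hv t).trans (hK t ht)
  have hflux : ∀ x ≤ t, G.flux r x - F.flux r x ≤ 2 * (K / a) * C / δ * exp (δ * x) :=
    fun x hx => P.flux_sub_le_of_extremalGap_le hv hK (hx.trans ht)
  calc F.extremalGap G r S t ≤ 0 + 2 * (K / a) * C / δ / δ * exp (δ * t) :=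
        le_add_of_hasDerivAt_le_exp_mul hδ (by positivity)
          (fun x _ => P.hasDerivAt_extremalGap hm S x) hflux
          (P.tendsto_extremalGap hv hm hS hsup)
    _ ≤ 0 + 2 * (K / a) * C / δ / δ * (a * δ ^ 2 / (4 * C)) := by
        have := hT t ht
        gcongr
    _ = K / 2 := by field_simp; ring

end

lemma exists_wdiff_le_sub_of_chiSlope_eq_zero (hS : 0 < S) (hm : chiSlope b c h r = 0) :
    ∃ ε, 0 < ε ∧ ∀ t, wdiff r F.v G.v t ≤ S - ε := by
  by_contra! hsup
  obtain ⟨T, hhalf⟩ := P.exists_extremalGap_le_half hv hm hS hsup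
  set X := F.extremalGap G r S
  have hbdd : BddAbove (X '' Iic T) := by
    refine ⟨C / (r / 2) * exp (r / 2 * T), ?_⟩
    rintro _ ⟨t, ht, rfl⟩
    refine (P.extremalGap_le_exp_mul hv hm hS hsup t).trans
      (mul_le_mul_of_nonneg_left (exp_le_exp.2 ?_) (div_pos P.fst.C_pos (half_pos P.r_pos)).le)
    exact mul_le_mul_of_nonneg_left ht (half_pos P.r_pos).le
  have hle : ∀ t ≤ T, X t ≤ sSup (X '' Iic T) := fun t ht => le_csSup hbdd ⟨t, ht, rfl⟩
  have hsup_le : sSup (X '' Iic T) ≤ sSup (X '' Iic T) / 2 := by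
    refine csSup_le ⟨_, T, self_mem_Iic, rfl⟩ ?_
    rintro _ ⟨t, ht, rfl⟩
    exact hhalf _ hle t ht
  have hpos : 0 < X T := (sub_pos.2 (P.wdiff_v_lt hS hv T)).trans_le
    (F.sub_wdiff_v_le_extremalGap G P.r_pos.le hv T)
  linarith [hle T le_rfl]

lemma exists_wdiff_le_sub (hS : 0 < S) : ∃ ε, 0 < ε ∧ ∀ t, wdiff r F.v G.v t ≤ S - ε := by
  rcases P.isLeadingRoot.chiSlope_nonneg.eq_or_lt with hm | hm
  · exact P.exists_wdiff_le_sub_of_chiSlope_eq_zero hv hS hm.symm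
  · exact P.exists_wdiff_le_sub_of_chiSlope_pos hv hS hm

omit hv in
lemma v_eq (t : ℝ) : F.v t = G.v t := by
  obtain ⟨M, hM⟩ := P.exists_abs_wdiff_v_le
  set S := ⨆ t, |wdiff r F.v G.v t|
  have hv : ∀ t, |wdiff r F.v G.v t| ≤ S := le_ciSup ⟨M, forall_mem_range.2 hM⟩
  have hS : S ≤ 0 := by
    by_contra! hS
    obtain ⟨ε₁, hε₁, hFG⟩ := P.exists_wdiff_le_sub hv hS
    obtain ⟨ε₂, hε₂, hGF⟩ := P.symm.exists_wdiff_le_sub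
      (fun t => by rw [wdiff_swap, abs_neg]; exact hv t) hS
    have hle : S ≤ S - min ε₁ ε₂ := ciSup_le fun t => by
      have hneg := hGF t
      rw [wdiff_swap] at hneg
      exact abs_le'.2 ⟨by linarith [hFG t, min_le_left ε₁ ε₂],
        by linarith [min_le_right ε₁ ε₂]⟩
    linarith [lt_min hε₁ hε₂]
  rw [← sub_eq_zero, ← exp_mul_wdiff r, abs_nonpos_iff.1 ((hv t).trans hS), mul_zero]

omit hv in
theorem φ_eq : F.φ = G.φ :=
  eq_of_sub_shift_eq F.b_nonneg F.b_lt_one (h := h) (C := 1)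
    (fun t => abs_le.2 ⟨by linarith [F.nonneg t], F.le_one t⟩)
    (fun t => abs_le.2 ⟨by linarith [G.nonneg t], G.le_one t⟩)
    fun t => by rw [← F.v_eq, ← G.v_eq, P.v_eq]

end FrontPair

theorem Front.exists_translate {b c h z : ℝ} (F G : Front b c h) (hz : 0 < z)
    (hχ : chi b c h 1 z = 0) : ∃ s, ∀ t, G.φ t = F.φ (t + s) := by
  obtain ⟨r, hr⟩ := exists_isLeadingRoot F.b_nonneg F.b_lt_one F.h_nonneg hz hχ
  obtain ⟨L₁, C₁, hL₁, hF⟩ := F.exists_fluxAsymptotics hr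
  obtain ⟨L₂, C₂, hL₂, hG⟩ := G.exists_fluxAsymptotics hr
  set s := log (L₂ / L₁) / r with hs
  have hscale : exp (r * s) * L₁ = L₂ := by
    rw [hs, mul_div_cancel₀ _ hr.pos.ne', exp_log (div_pos_of_neg_of_neg hL₂ hL₁),
      div_mul_cancel₀ _ hL₁.ne]
  obtain ⟨L, C, -, hFs⟩ := (F.translate s).exists_fluxAsymptotics hr
  have hlim : Tendsto ((F.translate s).flux r) atBot (𝓝 L₂) := by
    rw [funext (F.translate_flux r s), ← hscale]
    exact ((hF.tendsto_flux hr.pos).comp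
      (tendsto_atBot_add_const_right _ s tendsto_id)).const_mul _
  obtain rfl : L = L₂ := tendsto_nhds_unique (hFs.tendsto_flux hr.pos) hlim
  have P : FrontPair G (F.translate s) r L (max C₂ C) :=
    ⟨hr, hG.mono (le_max_left _ _), hFs.mono (le_max_right _ _)⟩
  exact ⟨s, congrFun P.φ_eq⟩

lemma speed_pos_of_mem_frontDomain {b τ c : ℝ} (hτc : (τ, c) ∈ frontDomain b) : 0 < c := by
  obtain ⟨-, hc, ⟨z, -, hz, hχ⟩, -⟩ := hτc
  refine lt_of_le_of_ne hc fun hc0 => ?_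
  dsimp only at hz hχ
  unfold chiZero at hχ
  rw [← hc0] at hχ hz
  linarith [sq_nonneg z, one_div_pos.2 hz]

lemma stepParams_of_chiOne_eq_zero {b τ c z : ℝ} (hb0 : 0 ≤ b) (hb1 : b < 1) (hc : 0 < c)
    (hτ : 0 ≤ τ) (hz : z < 0) (hbz : 0 < 1 - b * exp (-(z * c * τ)))
    (hχ : chiOne b τ c z = 0) : StepParams b c (c * τ) (-z) 1 := by
  have hexp : -z * (c * τ) = -(z * c * τ) := by ring
  refine ⟨hb0, hb1, hc, mul_nonneg hc.le hτ, neg_pos.2 hz, one_pos, le_rfl, by rwa [hexp], ?_⟩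
  unfold chiOne at hχ
  rw [hexp, one_mul, ← div_le_iff₀ hbz]
  linarith

end NeutralKPP
end

theorem theorem1p7 (b : ℝ) (hb0 : 0 ≤ b) (hb1 : b < 1) (τ c : ℝ) (hτc : (τ, c) ∈ frontDomain b) :
    ∃ u : ℝ → ℝ → ℝ,
      IsMonotoneTravelingFront b τ c u ∧
      ∀ w : ℝ → ℝ → ℝ, IsMonotoneTravelingFront b τ c w →
        ∃ s : ℝ, ∀ t x : ℝ, w t x = u t (x + s) := by
  have hc : 0 < c := NeutralKPP.speed_pos_of_mem_frontDomain hτc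
  obtain ⟨hτ, -, ⟨z, hz, -, hχ₀⟩, z₁, hz₁, hbz₁, hχ₁⟩ := hτc
  have hh : 0 ≤ c * τ := mul_nonneg hc.le hτ
  have hχ : NeutralKPP.chi b c (c * τ) 1 z = 0 := by
    rwa [NeutralKPP.chi, ← mul_assoc]
  have H := NeutralKPP.stepParams_of_chiOne_eq_zero hb0 hb1 hc hτ hz₁ hbz₁ hχ₁
  obtain ⟨φ, hφ⟩ := NeutralKPP.exists_isIntegralFront H hz hχ
  let F : NeutralKPP.Front b c (c * τ) := ⟨φ, hφ.isProfile H, hb0, hb1, hc, hh⟩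
  refine ⟨fun t x => φ (x + c * t), (NeutralKPP.isMonotoneTravelingFront_iff b τ c _).2
    ⟨φ, F.isProfile, fun _ _ => rfl⟩, fun w hw => ?_⟩
  obtain ⟨ψ, hψ, hwψ⟩ := (NeutralKPP.isMonotoneTravelingFront_iff b τ c w).1 hw
  let G : NeutralKPP.Front b c (c * τ) := ⟨ψ, hψ, hb0, hb1, hc, hh⟩
  obtain ⟨s, hs⟩ : ∃ s, ∀ t, ψ t = φ (t + s) := F.exists_translate G hz hχ
  exact ⟨s, fun t x => by rw [hwψ, hs, add_right_comm]⟩
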